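/- Let $\mathbf v_1,\dots,\mathbf v_d$ be a basis of $\mathbb R^d$ and $\mathcal L=\{\sum_j n_j\mathbf v_j : n\in\mathbb Z^d\}$. Let $\Gamma$ be a $1$-point periodic graph on $\mathcal V=\mathcal L$, that is, a connected, locally finite simple (undirected, loopless) graph with vertex set $\mathcal L$ whose edge set is invariant under translation by $\mathcal L$. Let $e_1,\dots,e_k\in\mathcal L$ be such that the $2k$ vectors $\pm e_j$ are pairwise distinct and the edges of $\Gamma$ are exactly the pairs $(x,x\pm e_j)$, $x\in\mathcal L$, $1\le j\le k$. For $h>0$ let $h\Gamma$ be the scaled graph, with vertex set $h\mathcal V=h\mathcal L$ and edges $(x,x\pm he_j)$. Let $E$ be the $k\times d$ matrix with rows $e_1,\dots,e_k$, and put $$|x|_\Gamma=\sqrt{x^{T}(E^{T}E)^{-1}x},\qquad B_r=\{x\in\mathbb R^d:\ |x|_\Gamma\le r\}.$$ For $f:h\mathcal V\to\mathbb R$ put $\Delta_{h\Gamma}f(x)=\sum_{y\sim x}(f(y)-f(x))$, $D_j^sf(x)=f(x+he_j)-f(x-he_j)$, $$D_sf=\Big(\sum_{j=1}^k|D_j^sf|^2\Big)^{1/2},\qquad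 D_s^2f=\Big(\sum_{j=1}^k|D_j^s(D_j^sf)|^2\Big)^{1/2},\qquad \|f\|_{\ell^2(h\mathcal V)}^2=\sum_{x\in h\mathcal V}|f(x)|^2 .$$ Let $0<c<2/\pi$ and $$\varphi(t)=-\log t+c\Big(\log t\,\arctan(\log t)-\tfrac12\log(1+\log^2t)\Big),\qquad \phi_\tau(x)=\tau\,\varphi(|x|_\Gamma).$$ **Theorem (Carleman estimate).** There exist $h_0,\delta_0\in(0,1)$ with $h_0<\delta_0$, $C>1$ and $1<\tau_0<\delta_0h_0^{-1}$, depending only on $\Gamma$ and $c$, such that for all $h\in(0,h_0)$, all $\tau\in(\tau_0,\delta_0h^{-1})$ and all $u:h\mathcal V\to\mathbb R$ supported in $B_2\setminus B_{1/2}$, the function $g$ defined by $g=h^{-2}\Delta_{h\Gamma}u$ on $h\mathcal V\cap B_4$ and $g=0$ on $h\mathcal V\setminus B_4$ satisfies $$\tau^3\|e^{\phi_\tau}u\|_{\ell^2(h\mathcal V)}^2+\tau\|e^{\phi_\tau}h^{-1}D_su\|_{\ell^2(h\mathcal V)}^2+\tau^{-1}\|e^{\phi_\tau}h^{-2}D_s^2u\|_{\ell^2(h\mathcal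 V)}^2\le C\,\|e^{\phi_\tau}g\|_{\ell^2(h\mathcal V)}^2 .$$ (For these $h$ the functions $u$, $D_su$, $D_s^2u$ and $g$ vanish at $x=0$, where the weight is undefined; the corresponding terms are read as $0$.) -/

import Mathlib

/-- A `d`-dimensional 1-point periodic graph `Γ` (mesh size `1`): a lattice generated by a basis
`v` of `ℝ^d`, which is also the vertex set, with a connected and locally finite simple graph
structure invariant under translation by the lattice. -/
structure OnePointPeriodicGraph (d : ℕ) where
  /-- The basis `v_1, …, v_d` of `ℝ^d`. -/
  v : Module.Basis (Fin d) ℝ (Fin d → ℝ)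
  /-- The edges, on the vertex set `𝓥 = 𝓛 = {∑ n_j v_j : n ∈ ℤ^d}`. -/
  graph : SimpleGraph (AddSubgroup.closure (Set.range v))
  /-- The edges are periodic. -/
  periodic : ∀ m x y, graph.Adj x y → graph.Adj (x + m) (y + m)
  /-- The graph is connected. -/
  connected : graph.Connected
  /-- Every vertex has finitely many neighbours (by periodicity, it suffices to ask it at `0`). -/
  locallyFinite : (graph.neighborSet 0).Finite

namespace OnePointPeriodicGraph

variable {d k : ℕ} (Γ : OnePointPeriodicGraph d)

/-- The lattice `𝓛`, equal to the vertex set `𝓥` of `Γ`. -/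
abbrev lattice : AddSubgroup (Fin d → ℝ) := AddSubgroup.closure (Set.range Γ.v)

/-- The vertex set `h𝓥 = h𝓛` of the scaled graph `hΓ`. -/
def vertices (h : ℝ) : AddSubgroup (Fin d → ℝ) :=
  Γ.lattice.map (DistribSMul.toAddMonoidHom (Fin d → ℝ) h)

/-- The map `x ↦ h x` from `𝓥` onto `h𝓥`. -/
def scale (h : ℝ) (x : Γ.lattice) : Γ.vertices h := ⟨h • (x : Fin d → ℝ), x, x.2, rfl⟩

/-- The edges of `hΓ`: the pairs `(h a, h b)` with `(a, b)` an edge of `Γ`. -/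
def Adj (h : ℝ) (x y : Γ.vertices h) : Prop :=
  ∃ a b : Γ.lattice, Γ.graph.Adj a b ∧ x = Γ.scale h a ∧ y = Γ.scale h b

/-- The graph Laplacian `Δ_{hΓ} f(x) = ∑_{y ∼ x} (f(y) - f(x))`; the sum is finite for `h ≠ 0`. -/
noncomputable def laplacian (h : ℝ) (f : Γ.vertices h → ℝ) (x : Γ.vertices h) : ℝ :=
  ∑ᶠ y ∈ {y | Γ.Adj h x y}, (f y - f x)

/-- `e_1, …, e_k` represent the edges of `Γ`: the `2k` vectors `±e_j` are pairwise distinct and the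
edges of `Γ` are exactly the pairs `(x, x ± e_j)`. Hence `Γ` has degree `2k`. -/
structure IsEdgeSystem (e : Fin k → Γ.lattice) : Prop where
  injective : Function.Injective e
  ne_neg : ∀ i j, e i ≠ -e j
  adj_iff : ∀ x y, Γ.graph.Adj x y ↔ ∃ j, y = x + e j ∨ y = x - e j

variable {Γ}

/-- The matrix `E` of size `k × d` with rows `e_1, …, e_k`. -/
def edgeMatrix (e : Fin k → Γ.lattice) : Matrix (Fin k) (Fin d) ℝ :=
  Matrix.of fun j => (e j : Fin d → ℝ)

/-- The norm `|x|_Γ = √(xᵀ (Eᵀ E)⁻¹ x)` on `ℝ^d`. -/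
noncomputable def gNorm (e : Fin k → Γ.lattice) (x : Fin d → ℝ) : ℝ :=
  √(x ⬝ᵥ (((edgeMatrix e).transpose * edgeMatrix e)⁻¹.mulVec x))

/-- The closed ball `B_r = {x ∈ ℝ^d : |x|_Γ ≤ r}`. -/
def gBall (e : Fin k → Γ.lattice) (r : ℝ) : Set (Fin d → ℝ) := {x | gNorm e x ≤ r}

/-- The symmetric difference `D_j^s f(x) = f(x + h e_j) - f(x - h e_j)`. -/
def symDiff (e : Fin k → Γ.lattice) (h : ℝ) (j : Fin k) (f : Γ.vertices h → ℝ)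
    (x : Γ.vertices h) : ℝ :=
  f (x + Γ.scale h (e j)) - f (x - Γ.scale h (e j))

/-- `D_s f = (∑_j |D_j^s f|^2)^{1/2}`. -/
noncomputable def Ds (e : Fin k → Γ.lattice) (h : ℝ) (f : Γ.vertices h → ℝ)
    (x : Γ.vertices h) : ℝ :=
  √(∑ j, |symDiff e h j f x| ^ 2)

/-- `D_s^2 f = (∑_j |(D_j^s)^2 f|^2)^{1/2}`, where `(D_j^s)^2` is `D_j^s` applied twice. -/
noncomputable def Ds2 (e : Fin k → Γ.lattice) (h : ℝ) (f : Γ.vertices h → ℝ)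
    (x : Γ.vertices h) : ℝ :=
  √(∑ j, |symDiff e h j (symDiff e h j f) x| ^ 2)

/-- The squared norm of `ℓ²(h𝓥)`. It is only applied to functions with finite support. -/
noncomputable def l2NormSq {h : ℝ} (f : Γ.vertices h → ℝ) : ℝ := ∑' x, |f x| ^ 2

/-- `φ(t) = -log t + c (log t · arctan (log t) - (1/2) log (1 + log² t))`. -/
noncomputable def carlemanPhi (c t : ℝ) : ℝ :=
  -Real.log t + c * (Real.log t * Real.arctan (Real.log t)
    - 1 / 2 * Real.log (1 + Real.log t ^ 2))

/-- The Carleman weight `φ_τ(x) = τ φ(|x|_Γ)`. -/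
noncomputable def weight (e : Fin k → Γ.lattice) (c τ : ℝ) (x : Fin d → ℝ) : ℝ :=
  τ * carlemanPhi c (gNorm e x)

end OnePointPeriodicGraph

/-! The proof is the positive commutator method, carried out with differences on the lattice. Put
$\sigma=\tau h$ and $f=e^{\tau\varphi}u$. Conjugating the Laplacian by the weight and linearising
the exponents gives $P-Q$ with $P=\sum_i(\cosh(\sigma a_i)\,\mathrm{lap}_i+2(\cosh(\sigma a_i)-1))$,
$Q=\sum_j\sinh(\sigma a_j)\,\mathrm{sym}_j$, where $a_j$ is the derivative of the weight along
$e_j$. For any bounded $w$ and $W=\sigma hwf$, $\|Pf-Qf\|^2\ge\frac12\|Pf\|^2-2\langle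
Pf,Qf\rangle+2\langle Pf,W\rangle-2\|W\|^2$. Summation by parts turns the two pairings into explicit
quadratic forms in $\nabla f$ and $f$ (`IsWeight.sum_symm_mul_skew`, `IsWeight.sum_symm_mul_mult`).

These forms are positive by the structure of the weight. With $b=E(E^TE)^{-1}x$ one has
$|x|_\Gamma^2=\sum_j b_j(x)^2$ and $x=\sum_j b_j(x)e_j$, so $b$ embeds $\mathbb R^d$ isometrically
in $\mathbb R^k$ and $(b_i(e_j))$ is an orthogonal projection. A radial weight
$\psi(\log|x|_\Gamma)$ with $\psi'<0<\psi''$ then satisfies the condition `PseudoconvexAt` for a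
suitable $w$ (`IsFrame.pseudoconvexAt`). Here $\psi'(\rho)=-1+c\arctan\rho$, negative because
$c<2/\pi$, and $\psi''(\rho)=c/(1+\rho^2)$.

Second differences are recovered from $\|Pf\|^2$ by discrete elliptic regularity
(`IsWeight.energy₂_le`). The controlled energy is $R=\sigma^3E_0+\sigma E_1+\sigma^{-1}E_2$, $E_n$
being the sum of squares of the $n$-th differences of $f$. All errors in the commutator computation
are at most a constant times $h(\sigma+h/\sigma)R$, hence absorbed by $\kappa hR$ when $\sigma=\tau
h$ and $h/\sigma=1/\tau$ are small. This is `exists_carleman_estimate`, stated on an abstract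
abelian group. Returning from $f$ to $u$ and multiplying by $h^{-4}$ gives the theorem. -/

namespace LatticeCarleman

open Finset

/-! ### Difference calculus and summation by parts on an abelian group. -/

section Calculus

variable {X : Type*} [AddCommGroup X]

/-- The forward difference of `f` in direction `v`. -/
def fwd (v : X) (f : X → ℝ) (x : X) : ℝ := f (x + v) - f x

/-- The second difference of `f` in direction `v`. -/
def lap (v : X) (f : X → ℝ) (x : X) : ℝ := f (x + v) + f (x - v) - 2 * f x

/-- The symmetric difference of `f` in direction `v`. -/
def sym (v : X) (f : X → ℝ) (x : X) : ℝ := f (x + v) - f (x - v)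

theorem lap_eq (v : X) (f : X → ℝ) (x : X) : lap v f x = fwd v f x - fwd v f (x - v) := by
  simp only [lap, fwd, sub_add_cancel]; ring

theorem sym_eq (v : X) (f : X → ℝ) (x : X) : sym v f x = fwd v f x + fwd v f (x - v) := by
  simp only [sym, fwd, sub_add_cancel]; ring

theorem fwd_lap (v w : X) (f : X → ℝ) : fwd v (lap w f) = lap w (fwd v f) := by
  funext x
  simp only [fwd, lap, add_right_comm x v w, sub_add_eq_add_sub]; ring

theorem fwd_sym (v w : X) (f : X → ℝ) : fwd v (sym w f) = sym w (fwd v f) := by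
  funext x
  simp only [fwd, sym, add_right_comm x v w, sub_add_eq_add_sub]; ring

theorem fwd_mul (v : X) (f g : X → ℝ) (x : X) :
    fwd v (fun y => f y * g y) x = fwd v f x * g (x + v) + f x * fwd v g x := by
  simp only [fwd]; ring

/-- A sum over `s` stands for a sum over the whole group, which is translation invariant. This is
legitimate once `s` contains the support of both the function and its translate; `Padded` keeps
track of this. -/
theorem sum_comp_add (s : Finset X) (v : X) (F : X → ℝ) (h₀ : ∀ x, F x ≠ 0 → x ∈ s)
    (h₁ : ∀ x, F x ≠ 0 → x - v ∈ s) : ∑ x ∈ s, F (x + v) = ∑ x ∈ s, F x := by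
  refine Finset.sum_bij_ne_zero (fun x _ _ => x + v) (fun x _ h => h₀ _ h)
    (fun x _ _ y _ _ h => add_right_cancel h) (fun y _ h => ⟨y - v, h₁ y h, ?_, ?_⟩)
    (fun _ _ _ => rfl)
  · simpa using h
  · simp

variable {k : ℕ} (e : Fin k → X)

/-- `s` contains all points within `n` steps `± e i` of the support of the function. -/
def Padded (s : Finset X) : ℕ → (X → ℝ) → Prop
  | 0, f => ∀ x, f x ≠ 0 → x ∈ s
  | n + 1, f => Padded s n f ∧
      ∀ i, Padded s n (fun x => f (x + e i)) ∧ Padded s n (fun x => f (x - e i))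

variable {e} {s : Finset X} {n : ℕ} {f g : X → ℝ}

theorem Padded.of_imp (hf : Padded e s n f) (h : ∀ x, f x = 0 → g x = 0) : Padded e s n g := by
  induction n generalizing f g with
  | zero => exact fun x hx => hf x fun h0 => hx (h x h0)
  | succ n ih =>
    exact ⟨ih hf.1 h, fun i => ⟨ih (hf.2 i).1 fun x => h _, ih (hf.2 i).2 fun x => h _⟩⟩

theorem Padded.sub (hf : Padded e s n f) (hg : Padded e s n g) :
    Padded e s n (fun x => f x - g x) := by
  induction n generalizing f g with
  | zero =>
    intro x hx
    by_cases h : f x = 0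
    · exact hg x fun h' => hx (by simp [h, h'])
    · exact hf x h
  | succ n ih =>
    exact ⟨ih hf.1 hg.1, fun i => ⟨ih (hf.2 i).1 (hg.2 i).1, ih (hf.2 i).2 (hg.2 i).2⟩⟩

theorem Padded.fwd (hf : Padded e s (n + 1) f) (i : Fin k) : Padded e s n (fwd (e i) f) :=
  (hf.2 i).1.sub hf.1

theorem Padded.of_succ (hf : Padded e s (n + 1) f) : Padded e s n f := hf.1

theorem Padded.shift (hf : Padded e s (n + 1) f) (i : Fin k) :
    Padded e s n (fun x => f (x + e i)) := (hf.2 i).1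

theorem Padded.unshift (hf : Padded e s (n + 1) f) (i : Fin k) :
    Padded e s n (fun x => f (x - e i)) := (hf.2 i).2

theorem Padded.mem (hf : Padded e s 0 f) {x : X} (hx : f x ≠ 0) : x ∈ s := hf x hx

theorem Padded.add_mem (hf : Padded e s 1 f) (i : Fin k) {x : X} (hx : f x ≠ 0) : x + e i ∈ s :=
  (hf.unshift i).mem (by simpa using hx)

theorem Padded.sub_mem (hf : Padded e s 1 f) (i : Fin k) {x : X} (hx : f x ≠ 0) : x - e i ∈ s :=
  (hf.shift i).mem (by simpa using hx)

theorem Padded.sum_shift (hf : Padded e s 1 f) (i : Fin k) :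
    ∑ x ∈ s, f (x + e i) = ∑ x ∈ s, f x :=
  sum_comp_add s (e i) f (fun _ h => hf.of_succ.mem h) fun _ h => hf.sub_mem i h

theorem Padded.sum_unshift (hf : Padded e s 1 f) (i : Fin k) :
    ∑ x ∈ s, f (x - e i) = ∑ x ∈ s, f x := by
  simpa [sub_eq_add_neg] using sum_comp_add s (-e i) f (fun _ h => hf.of_succ.mem h)
    fun _ h => by simpa using hf.add_mem i h

theorem Padded.sq (hf : Padded e s n f) : Padded e s n (fun x => f x ^ 2) :=
  hf.of_imp fun x h => by simp [h]

theorem exists_padded (e : Fin k → X) (n : ℕ) (f : X → ℝ) (hf : f.support.Finite) :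
    ∃ s : Finset X, Padded e s n f := by
  classical
  have mono : ∀ (n : ℕ) (f : X → ℝ) (s t : Finset X), s ⊆ t → Padded e s n f → Padded e t n f := by
    intro n
    induction n with
    | zero => exact fun f s t h hf x hx => h (hf x hx)
    | succ n ih =>
      exact fun f s t h hf => ⟨ih _ _ _ h hf.1,
        fun i => ⟨ih _ _ _ h (hf.2 i).1, ih _ _ _ h (hf.2 i).2⟩⟩
  induction n generalizing f with
  | zero => exact ⟨hf.toFinset, fun x hx => by simpa using hx⟩
  | succ n ih =>
    obtain ⟨s, hs⟩ := ih f hf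
    have hp : ∀ i, (Function.support fun x => f (x + e i)).Finite := fun i =>
      hf.preimage (f := fun x => x + e i) (add_left_injective (e i)).injOn
    have hm : ∀ i, (Function.support fun x => f (x - e i)).Finite := fun i =>
      hf.preimage (f := fun x => x - e i) (sub_left_injective (b := e i)).injOn
    choose p hp using fun i => ih _ (hp i)
    choose m hm using fun i => ih _ (hm i)
    refine ⟨s ∪ univ.biUnion p ∪ univ.biUnion m, mono _ _ _ _ ?_ hs, fun i =>
      ⟨mono _ _ _ _ ?_ (hp i), mono _ _ _ _ ?_ (hm i)⟩⟩
    · exact subset_union_left.trans subset_union_left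
    · exact (subset_biUnion_of_mem p (mem_univ i)).trans
        (subset_union_right.trans subset_union_left)
    · exact (subset_biUnion_of_mem m (mem_univ i)).trans subset_union_right

/-- Summation by parts against a second difference. -/
theorem sum_mul_lap (hf : Padded e s 1 f) (i : Fin k) (F : X → ℝ) :
    ∑ x ∈ s, F x * lap (e i) f x = -∑ x ∈ s, fwd (e i) F x * fwd (e i) f x := by
  have key : ∑ x ∈ s, F (x + e i) * fwd (e i) f x = ∑ x ∈ s, F x * fwd (e i) f (x - e i) := by
    have := sum_comp_add s (e i) (fun x => F x * fwd (e i) f (x - e i)) ?_ ?_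
    · simpa using this
    all_goals
      intro x hx
      have h : fwd (e i) f (x - e i) ≠ 0 := right_ne_zero_of_mul hx
      by_cases h0 : f x = 0
      · have h1 : f (x - e i) ≠ 0 := fun h1 => h (by simp [fwd, h0, h1])
        first
          | exact hf.of_succ.mem h1
          | simpa using hf.add_mem i h1
      · first
          | exact hf.of_succ.mem h0
          | exact hf.sub_mem i h0
  have : ∀ x, F x * lap (e i) f x
      = F x * fwd (e i) f x - F x * fwd (e i) f (x - e i) := fun x => by rw [lap_eq]; ring
  simp only [this, sum_sub_distrib, ← key]
  rw [← sum_sub_distrib, ← sum_neg_distrib]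
  exact sum_congr rfl fun x _ => by simp only [fwd]; ring

/-- Summation by parts against a symmetric difference. -/
theorem sum_mul_sym (hf : Padded e s 1 f) (i : Fin k) (c : X → ℝ) :
    ∑ x ∈ s, c x * f x * sym (e i) f x
      = -∑ x ∈ s, fwd (e i) c x * (f x * f (x + e i)) := by
  have key := sum_comp_add s (e i) (fun x => c x * f x * f (x - e i))
    (fun x hx => hf.of_succ.mem (right_ne_zero_of_mul (left_ne_zero_of_mul hx)))
    (fun x hx => hf.sub_mem i (right_ne_zero_of_mul (left_ne_zero_of_mul hx)))
  simp only [add_sub_cancel_right] at key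
  have : ∀ x, c x * f x * sym (e i) f x
      = c x * f x * f (x + e i) - c x * f x * f (x - e i) := fun x => by simp only [sym]; ring
  simp only [this, sum_sub_distrib, ← key]
  rw [← sum_sub_distrib, ← sum_neg_distrib]
  exact sum_congr rfl fun x _ => by simp only [fwd]; ring

/-- The commutator identity for a second difference and a symmetric difference. -/
theorem sum_mul_lap_sym (hf : Padded e s 2 f) (i j : Fin k) (α : X → ℝ) :
    ∑ x ∈ s, α x * lap (e i) f x * sym (e j) f x
      = -∑ x ∈ s, fwd (e i) α x * sym (e j) f (x + e i) * fwd (e i) f x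
        + ∑ x ∈ s, fwd (e j) α x * (fwd (e i) f x * fwd (e i) f (x + e j)) := by
  have h1 := sum_mul_lap hf.of_succ i (fun x => α x * sym (e j) f x)
  -- After the second difference is moved off `f`, the term in which it falls on `sym (e j) f` is
  -- again a function times its own symmetric difference, with `fwd (e i) f` in place of `f`. No
  -- second difference survives.
  have h2 := sum_mul_sym (hf.fwd i) j α
  have h3 : ∑ x ∈ s, α x * lap (e i) f x * sym (e j) f x
      = ∑ x ∈ s, α x * sym (e j) f x * lap (e i) f x := sum_congr rfl fun x _ => by ring
  have h4 : ∑ x ∈ s, fwd (e j) α x * (fwd (e i) f x * fwd (e i) f (x + e j))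
      = -∑ x ∈ s, α x * fwd (e i) f x * sym (e j) (fwd (e i) f) x := by rw [h2]; ring
  rw [h3, h1, h4, ← sub_eq_add_neg, ← neg_add', ← sum_add_distrib]
  congr 1
  refine sum_congr rfl fun x _ => ?_
  rw [fwd_mul, fwd_sym]; ring

/-- The sum of the squares of `f`. -/
def energy₀ (s : Finset X) (f : X → ℝ) : ℝ := ∑ x ∈ s, f x ^ 2

/-- The sum of the squares of the first differences of `f`. -/
def energy₁ (e : Fin k → X) (s : Finset X) (f : X → ℝ) : ℝ :=
  ∑ i, ∑ x ∈ s, fwd (e i) f x ^ 2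

/-- The sum of the squares of the second differences of `f`. -/
def energy₂ (e : Fin k → X) (s : Finset X) (f : X → ℝ) : ℝ :=
  ∑ i, ∑ j, ∑ x ∈ s, fwd (e j) (fwd (e i) f) x ^ 2

omit [AddCommGroup X] in
theorem energy₀_nonneg : 0 ≤ energy₀ s f := sum_nonneg fun _ _ => sq_nonneg _

theorem energy₁_nonneg : 0 ≤ energy₁ e s f :=
  sum_nonneg fun _ _ => sum_nonneg fun _ _ => sq_nonneg _

theorem energy₂_nonneg : 0 ≤ energy₂ e s f :=
  sum_nonneg fun _ _ => sum_nonneg fun _ _ => sum_nonneg fun _ _ => sq_nonneg _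

theorem sum_fwd_sq_le (i : Fin k) : ∑ x ∈ s, fwd (e i) f x ^ 2 ≤ energy₁ e s f :=
  single_le_sum (f := fun i => ∑ x ∈ s, fwd (e i) f x ^ 2)
    (fun _ _ => sum_nonneg fun _ _ => sq_nonneg _) (mem_univ i)

theorem sum_fwd_fwd_sq_le (i j : Fin k) :
    ∑ x ∈ s, fwd (e j) (fwd (e i) f) x ^ 2 ≤ energy₂ e s f :=
  (single_le_sum (f := fun j => ∑ x ∈ s, fwd (e j) (fwd (e i) f) x ^ 2)
    (fun _ _ => sum_nonneg fun _ _ => sq_nonneg _) (mem_univ j)).trans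
  (single_le_sum (f := fun i => ∑ j, ∑ x ∈ s, fwd (e j) (fwd (e i) f) x ^ 2)
    (fun _ _ => sum_nonneg fun _ _ => sum_nonneg fun _ _ => sq_nonneg _) (mem_univ i))

/-- Elliptic regularity: the second differences are controlled by the Laplacian. -/
theorem sum_lap_sq (hf : Padded e s 2 f) :
    ∑ x ∈ s, (∑ i, lap (e i) f x) ^ 2 = energy₂ e s f := by
  -- Constant coefficient differences commute, so two summations by parts turn each cross term into
  -- an exact sum of squares.
  have h : ∀ i j, ∑ x ∈ s, lap (e j) f x * lap (e i) f x
      = ∑ x ∈ s, fwd (e j) (fwd (e i) f) x ^ 2 := by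
    intro i j
    rw [sum_mul_lap hf.of_succ i, fwd_lap]
    have := sum_mul_lap (hf.fwd i) j (fwd (e i) f)
    simp only [mul_comm (lap _ _ _), this, neg_neg, sq]
  simp only [energy₂, ← h]
  simp only [sq, sum_mul_sum]
  rw [sum_comm]
  refine sum_congr rfl fun i _ => ?_
  rw [sum_comm]
  exact sum_congr rfl fun j _ => sum_congr rfl fun x _ => mul_comm _ _

end Calculus

/-! ### Summation by parts with variable coefficients, modulo controlled errors. -/

section Errors

theorem abs_mul_le_weighted {σ : ℝ} (hσ : 0 < σ) (a b : ℝ) :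
    |a| * |b| ≤ (σ * a ^ 2 + σ⁻¹ * b ^ 2) / 2 := by
  have h : 0 ≤ σ⁻¹ * (σ * |a| - |b|) ^ 2 := by positivity
  have h2 : σ⁻¹ * (σ * |a| - |b|) ^ 2 = σ * |a| ^ 2 + σ⁻¹ * |b| ^ 2 - 2 * (|a| * |b|) := by
    field_simp
    ring
  rw [h2, sq_abs, sq_abs] at h
  linarith

variable {X : Type*} [AddCommGroup X] {k : ℕ} {e : Fin k → X} {s : Finset X} {f : X → ℝ}

/-- In the commutator identity, moving all factors to the point `x` costs second differences of `f`,
split off by Young's inequality with weight `σ`. Replacing the differences of `α` by `A` and `B`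
costs `η` times first-order energy. -/
theorem abs_sum_lap_sym_sub_le (hf : Padded e s 3 f) (i j : Fin k) {α A B : X → ℝ}
    {σ μ η : ℝ} (hσ : 0 < σ) (hA : ∀ x, |A x| ≤ μ) (hB : ∀ x, |B x| ≤ μ)
    (hαA : ∀ x, |fwd (e i) α x - A x| ≤ η) (hαB : ∀ x, |fwd (e j) α x - B x| ≤ η) :
    |∑ x ∈ s, α x * lap (e i) f x * sym (e j) f x
        - ∑ x ∈ s, (B x * fwd (e i) f x ^ 2 - 2 * A x * fwd (e i) f x * fwd (e j) f x)|
      ≤ 2 * (μ + η) * (σ * energy₁ e s f + σ⁻¹ * energy₂ e s f) + 3 * η * energy₁ e s f := by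
  have hμη : 0 ≤ μ + η :=
    add_nonneg ((abs_nonneg _).trans (hA 0)) ((abs_nonneg _).trans (hαA 0))
  rw [sum_mul_lap_sym hf.of_succ, ← sum_neg_distrib, ← sum_add_distrib, ← sum_sub_distrib]
  refine (abs_sum_le_sum_abs _ _).trans ?_
  have pt : ∀ x ∈ s, |-(fwd (e i) α x * sym (e j) f (x + e i) * fwd (e i) f x)
        + fwd (e j) α x * (fwd (e i) f x * fwd (e i) f (x + e j))
        - (B x * fwd (e i) f x ^ 2 - 2 * A x * fwd (e i) f x * fwd (e j) f x)|
      ≤ (μ + η) * (2 * (σ * fwd (e i) f x ^ 2)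
          + (σ⁻¹ * fwd (e i) (fwd (e j) f) x ^ 2 + σ⁻¹ * fwd (e j) (fwd (e j) f) (x - e j) ^ 2
            + σ⁻¹ * fwd (e i) (fwd (e j) f) (x - e j) ^ 2
            + σ⁻¹ * fwd (e j) (fwd (e i) f) x ^ 2) / 2)
        + η * (2 * fwd (e i) f x ^ 2 + fwd (e j) f x ^ 2) := by
    intro x _
    set g := fwd (e i) f x
    set g' := fwd (e j) f x
    set D₁ := fwd (e i) (fwd (e j) f) x with hD₁
    set D₂ := fwd (e j) (fwd (e j) f) (x - e j) with hD₂
    set D₃ := fwd (e i) (fwd (e j) f) (x - e j) with hD₃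
    set D₄ := fwd (e j) (fwd (e i) f) x with hD₄
    have h1 : sym (e j) f (x + e i) = 2 * g' + (D₁ - D₂ + D₃) := by
      simp only [sym_eq, hD₁, hD₂, hD₃, g', fwd, sub_add_cancel, sub_add_eq_add_sub]; ring
    have h2 : fwd (e i) f (x + e j) = g + D₄ := by
      simp only [hD₄, g, fwd]; ring
    rw [h1, h2]
    have ha : |fwd (e i) α x| ≤ μ + η := by
      have := abs_add_le (A x) (fwd (e i) α x - A x)
      rw [add_sub_cancel] at this
      linarith [hA x, hαA x]
    have hb : |fwd (e j) α x| ≤ μ + η := by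
      have := abs_add_le (B x) (fwd (e j) α x - B x)
      rw [add_sub_cancel] at this
      linarith [hB x, hαB x]
    have hη := (abs_nonneg _).trans (hαA x)
    have e1 : -(fwd (e i) α x * (2 * g' + (D₁ - D₂ + D₃)) * g) + fwd (e j) α x * (g * (g + D₄))
        - (B x * g ^ 2 - 2 * A x * g * g')
        = -(fwd (e i) α x * (g * (D₁ - D₂ + D₃))) + -(2 * ((fwd (e i) α x - A x) * (g * g')))
          + fwd (e j) α x * (g * D₄) + (fwd (e j) α x - B x) * g ^ 2 := by ring
    rw [e1]
    have t1 : |-(fwd (e i) α x * (g * (D₁ - D₂ + D₃)))|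
        ≤ (μ + η) * (3 / 2 * (σ * g ^ 2) + (σ⁻¹ * D₁ ^ 2 + σ⁻¹ * D₂ ^ 2 + σ⁻¹ * D₃ ^ 2) / 2) := by
      rw [abs_neg, abs_mul, abs_mul]
      refine mul_le_mul ha ?_ (by positivity) hμη
      have : |D₁ - D₂ + D₃| ≤ |D₁| + |D₂| + |D₃| :=
        (abs_add_le _ _).trans (by gcongr; exact abs_sub _ _)
      calc |g| * |D₁ - D₂ + D₃| ≤ |g| * (|D₁| + |D₂| + |D₃|) := by gcongr
        _ = |g| * |D₁| + |g| * |D₂| + |g| * |D₃| := by ring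
        _ ≤ _ := by
          linarith [abs_mul_le_weighted hσ g D₁, abs_mul_le_weighted hσ g D₂,
            abs_mul_le_weighted hσ g D₃]
    have t2 : |-(2 * ((fwd (e i) α x - A x) * (g * g')))| ≤ η * (g ^ 2 + g' ^ 2) := by
      rw [abs_neg, abs_mul, abs_mul, abs_two, abs_mul]
      have h3 : |g| * |g'| ≤ (g ^ 2 + g' ^ 2) / 2 := by
        simpa using abs_mul_le_weighted one_pos g g'
      have := mul_le_mul (hαA x) h3 (by positivity) hη
      linarith
    have t3 : |fwd (e j) α x * (g * D₄)| ≤ (μ + η) * ((σ * g ^ 2 + σ⁻¹ * D₄ ^ 2) / 2) := by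
      rw [abs_mul, abs_mul]
      exact mul_le_mul hb (abs_mul_le_weighted hσ _ _) (by positivity) hμη
    have t4 : |(fwd (e j) α x - B x) * g ^ 2| ≤ η * g ^ 2 := by
      rw [abs_mul, abs_of_nonneg (sq_nonneg g)]
      exact mul_le_mul_of_nonneg_right (hαB x) (sq_nonneg _)
    refine (abs_add_le _ _).trans ((add_le_add ((abs_add_le _ _).trans (add_le_add
      ((abs_add_le _ _).trans (add_le_add t1 t2)) t3)) t4).trans (le_of_eq ?_))
    ring
  refine (sum_le_sum pt).trans ?_
  have s2 := ((hf.fwd j).fwd j).sq.sum_unshift j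
  have s3 := ((hf.fwd j).fwd i).sq.sum_unshift j
  simp only [sum_add_distrib, ← mul_sum, ← sum_div, s2, s3]
  have hη := (abs_nonneg _).trans (hαA 0)
  have hσ' : 0 ≤ σ⁻¹ := by positivity
  have b1 := sum_fwd_sq_le (e := e) (s := s) (f := f) i
  have b2 := sum_fwd_sq_le (e := e) (s := s) (f := f) j
  have c1 := mul_le_mul_of_nonneg_left (sum_fwd_fwd_sq_le (e := e) (s := s) (f := f) j i) hσ'
  have c2 := mul_le_mul_of_nonneg_left (sum_fwd_fwd_sq_le (e := e) (s := s) (f := f) j j) hσ'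
  have c3 := mul_le_mul_of_nonneg_left (sum_fwd_fwd_sq_le (e := e) (s := s) (f := f) i j) hσ'
  have b1' := mul_le_mul_of_nonneg_left b1 hσ.le
  have key : 2 * (σ * ∑ x ∈ s, fwd (e i) f x ^ 2)
      + (σ⁻¹ * ∑ x ∈ s, fwd (e i) (fwd (e j) f) x ^ 2
        + σ⁻¹ * ∑ x ∈ s, fwd (e j) (fwd (e j) f) x ^ 2
        + σ⁻¹ * ∑ x ∈ s, fwd (e i) (fwd (e j) f) x ^ 2
        + σ⁻¹ * ∑ x ∈ s, fwd (e j) (fwd (e i) f) x ^ 2) / 2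
      ≤ 2 * (σ * energy₁ e s f + σ⁻¹ * energy₂ e s f) := by linarith
  have k1 := mul_le_mul_of_nonneg_left key hμη
  have k2 := mul_le_mul_of_nonneg_left (show 2 * ∑ x ∈ s, fwd (e i) f x ^ 2
    + ∑ x ∈ s, fwd (e j) f x ^ 2 ≤ 3 * energy₁ e s f by linarith) hη
  linarith

/-- After summation by parts, the product of `f x` and `f (x + e j)` is `f x ^ 2` plus `f x` times a
first difference; the latter goes into the error. -/
theorem abs_sum_mul_sym_add_le (hf : Padded e s 1 f) (j : Fin k) {c A : X → ℝ}
    {σ μ η : ℝ} (hσ : 0 < σ) (hA : ∀ x, |A x| ≤ μ) (hcA : ∀ x, |fwd (e j) c x - A x| ≤ η) :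
    |∑ x ∈ s, c x * f x * sym (e j) f x + ∑ x ∈ s, A x * f x ^ 2|
      ≤ η * energy₀ s f + (μ + η) * (σ * energy₀ s f + σ⁻¹ * energy₁ e s f) := by
  have hμ := (abs_nonneg _).trans (hA 0)
  have hη := (abs_nonneg _).trans (hcA 0)
  rw [sum_mul_sym hf, ← sum_neg_distrib, ← sum_add_distrib]
  refine (abs_sum_le_sum_abs _ _).trans ?_
  have pt : ∀ x ∈ s, |-(fwd (e j) c x * (f x * f (x + e j))) + A x * f x ^ 2|
      ≤ η * f x ^ 2 + (μ + η) * (σ * f x ^ 2 + σ⁻¹ * fwd (e j) f x ^ 2) := by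
    intro x _
    have h1 : f (x + e j) = f x + fwd (e j) f x := by simp only [fwd]; ring
    have e1 : -(fwd (e j) c x * (f x * f (x + e j))) + A x * f x ^ 2
        = -((fwd (e j) c x - A x) * f x ^ 2) + -(fwd (e j) c x * (f x * fwd (e j) f x)) := by
      rw [h1]; ring
    have ha : |fwd (e j) c x| ≤ μ + η := by
      have := abs_add_le (A x) (fwd (e j) c x - A x)
      rw [add_sub_cancel] at this
      linarith [hA x, hcA x]
    rw [e1]
    refine (abs_add_le _ _).trans (add_le_add ?_ ?_)
    · rw [abs_neg, abs_mul, abs_of_nonneg (sq_nonneg (f x))]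
      exact mul_le_mul_of_nonneg_right (hcA x) (sq_nonneg _)
    · rw [abs_neg, abs_mul, abs_mul]
      refine mul_le_mul ha ((abs_mul_le_weighted hσ _ _).trans ?_) (by positivity) (by positivity)
      exact half_le_self (by positivity)
  refine (sum_le_sum pt).trans ?_
  simp only [sum_add_distrib, ← mul_sum]
  have b1 := sum_fwd_sq_le (e := e) (s := s) (f := f) j
  unfold energy₀
  gcongr

/-- Summation by parts and the product rule: the difference falling on `f` gives the gradient term,
the one falling on `W` is the error. -/
theorem abs_sum_mul_lap_add_le (hf : Padded e s 1 f) (i : Fin k) {W w : X → ℝ}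
    {σ μ η : ℝ} (hσ : 0 < σ) (hW : ∀ x, |W x - w x| ≤ η) (hμ : ∀ x, |fwd (e i) W x| ≤ μ) :
    |∑ x ∈ s, W x * f x * lap (e i) f x + ∑ x ∈ s, w x * fwd (e i) f x ^ 2|
      ≤ η * energy₁ e s f + μ * (σ * energy₀ s f + σ⁻¹ * energy₁ e s f) := by
  have hμ0 := (abs_nonneg _).trans (hμ 0)
  have hη := (abs_nonneg _).trans (hW 0)
  rw [sum_mul_lap hf, ← sum_neg_distrib, ← sum_add_distrib]
  refine (abs_sum_le_sum_abs _ _).trans ?_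
  have pt : ∀ x ∈ s, |-(fwd (e i) (fun y => W y * f y) x * fwd (e i) f x)
        + w x * fwd (e i) f x ^ 2|
      ≤ η * fwd (e i) f x ^ 2 + μ * (σ * f (x + e i) ^ 2 + σ⁻¹ * fwd (e i) f x ^ 2) := by
    intro x _
    have e1 : -(fwd (e i) (fun y => W y * f y) x * fwd (e i) f x) + w x * fwd (e i) f x ^ 2
        = -((W x - w x) * fwd (e i) f x ^ 2)
          + -(fwd (e i) W x * (f (x + e i) * fwd (e i) f x)) := by
      rw [fwd_mul]; ring
    rw [e1]
    refine (abs_add_le _ _).trans (add_le_add ?_ ?_)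
    · rw [abs_neg, abs_mul, abs_of_nonneg (sq_nonneg (fwd (e i) f x))]
      exact mul_le_mul_of_nonneg_right (hW x) (sq_nonneg _)
    · rw [abs_neg, abs_mul, abs_mul]
      refine mul_le_mul (hμ x) ((abs_mul_le_weighted hσ _ _).trans ?_) (by positivity) hμ0
      exact half_le_self (by positivity)
  refine (sum_le_sum pt).trans ?_
  simp only [sum_add_distrib, ← mul_sum, hf.sq.sum_shift i]
  have b1 := sum_fwd_sq_le (e := e) (s := s) (f := f) i
  unfold energy₀
  gcongr

end Errors

/-! ### Increments of hyperbolic functions near zero. -/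

section Hyperbolic

open Real

theorem abs_sinh_sub_self_le {t : ℝ} (ht : |t| ≤ 1) : |sinh t - t| ≤ |t| ^ 3 := by
  have h1 := Real.exp_bound ht (n := 3) (by norm_num)
  have h2 := Real.exp_bound (x := -t) (by rwa [abs_neg]) (n := 3) (by norm_num)
  norm_num [Finset.sum_range_succ, Nat.factorial] at h1 h2
  have h0 : 0 ≤ |t| ^ 3 := by positivity
  rw [sinh_eq, abs_le]
  rw [abs_le] at h1 h2
  constructor <;> linarith [h1.1, h1.2, h2.1, h2.2]

theorem abs_cosh_sub_le {t : ℝ} (ht : |t| ≤ 1) : |2 * (cosh t - 1) - t ^ 2| ≤ t ^ 4 := by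
  have h1 := Real.exp_bound ht (n := 4) (by norm_num)
  have h2 := Real.exp_bound (x := -t) (by rwa [abs_neg]) (n := 4) (by norm_num)
  norm_num [Finset.sum_range_succ, Nat.factorial] at h1 h2
  have h4 : |t| ^ 4 = t ^ 4 := by rw [← abs_pow, abs_of_nonneg (by positivity)]
  have h5 : (-t) ^ 3 = -t ^ 3 := by ring
  have h0 : 0 ≤ t ^ 4 := by positivity
  rw [cosh_eq, abs_le]
  rw [abs_le] at h1 h2
  rw [h4] at h1 h2
  rw [h5] at h2
  constructor <;> linarith [h1.1, h1.2, h2.1, h2.2]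

variable {ρ S S' T T' : ℝ}

theorem abs_sinh_le (hρ : ρ ≤ 1) (hT : |T| ≤ ρ) : |sinh T| ≤ 2 * ρ := by
  have h1 := abs_sinh_sub_self_le (hT.trans hρ)
  have h2 := abs_add_le T (sinh T - T)
  rw [add_sub_cancel] at h2
  have h3 : |T| ^ 3 ≤ |T| := pow_le_of_le_one (abs_nonneg _) (hT.trans hρ) (by norm_num)
  linarith

theorem cosh_sub_one_le (hρ : ρ ≤ 1) (hT : |T| ≤ ρ) : cosh T - 1 ≤ ρ ^ 2 := by
  have h1 := (abs_le.1 (abs_cosh_sub_le (hT.trans hρ))).2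
  have h2 : T ^ 2 ≤ ρ ^ 2 := sq_le_sq' (by linarith [neg_abs_le T]) (by linarith [le_abs_self T])
  have h3 : ρ ^ 2 ≤ 1 := by nlinarith [abs_nonneg T]
  nlinarith [sq_nonneg T]

theorem cosh_le_two (hρ : ρ ≤ 1) (hT : |T| ≤ ρ) : cosh T ≤ 2 := by
  have := cosh_sub_one_le hρ hT
  nlinarith [abs_nonneg T]

/-- A Lipschitz bound on `[-ρ, ρ]` from a bound of the derivative. -/
theorem abs_sub_le_of_deriv_le {F F' : ℝ → ℝ} {M : ℝ} (hF : ∀ t, HasDerivAt F (F' t) t)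
    (hM : ∀ t, |t| ≤ ρ → |F' t| ≤ M) (hT : |T| ≤ ρ) (hT' : |T'| ≤ ρ) :
    |F T' - F T| ≤ M * |T' - T| :=
  (convex_Icc (-ρ) ρ).norm_image_sub_le_of_norm_hasDerivWithin_le
    (fun t _ => (hF t).hasDerivWithinAt) (fun t ht => hM t (abs_le.2 ht)) (abs_le.1 hT)
    (abs_le.1 hT')

theorem abs_cosh_sub_cosh_le (hρ : ρ ≤ 1) (hT : |T| ≤ ρ) (hT' : |T'| ≤ ρ) :
    |cosh T' - cosh T| ≤ 2 * ρ * |T' - T| :=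
  abs_sub_le_of_deriv_le hasDerivAt_cosh (fun _ h => abs_sinh_le hρ h) hT hT'

theorem abs_sinh_sub_sinh_le (hρ : ρ ≤ 1) (hT : |T| ≤ ρ) (hT' : |T'| ≤ ρ) :
    |sinh T' - sinh T| ≤ 2 * |T' - T| :=
  abs_sub_le_of_deriv_le hasDerivAt_sinh
    (fun t h => by rw [abs_of_pos (cosh_pos t)]; exact cosh_le_two hρ h) hT hT'

theorem abs_sinh_sub_sinh_sub_le (hρ : ρ ≤ 1) (hT : |T| ≤ ρ) (hT' : |T'| ≤ ρ) :
    |sinh T' - sinh T - (T' - T)| ≤ ρ ^ 2 * |T' - T| := by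
  have := abs_sub_le_of_deriv_le (F := fun t => sinh t - t) (F' := fun t => cosh t - 1)
    (fun t => (hasDerivAt_sinh t).sub (hasDerivAt_id t))
    (fun t h => by
      rw [abs_of_nonneg (by linarith [one_le_cosh t])]; exact cosh_sub_one_le hρ h) hT hT'
  convert this using 2
  ring

theorem abs_cosh_sub_cosh_sub_le (hρ : ρ ≤ 1) (hT : |T| ≤ ρ) (hT' : |T'| ≤ ρ) :
    |2 * (cosh T' - cosh T) - (T' ^ 2 - T ^ 2)| ≤ 2 * ρ ^ 3 * |T' - T| := by
  have := abs_sub_le_of_deriv_le (F := fun t => 2 * cosh t - t ^ 2)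
    (F' := fun t => 2 * sinh t - (2 : ℕ) * t ^ (2 - 1)) (M := 2 * ρ ^ 3)
    (fun t => ((hasDerivAt_cosh t).const_mul 2).sub (hasDerivAt_pow 2 t))
    (fun t h => by
      have h1 := abs_sinh_sub_self_le (h.trans hρ)
      have h2 : |t| ^ 3 ≤ ρ ^ 3 := by gcongr
      have h3 : 2 * sinh t - (2 : ℕ) * t ^ (2 - 1) = 2 * (sinh t - t) := by norm_num; ring
      rw [h3, abs_mul, abs_two]
      linarith) hT hT'
  convert this using 2
  ring

/-- The error must be proportional to the increments `S' - S` and `T' - T`, which later are of size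
`σ * h`. Subtracting two pointwise Taylor expansions would lose this factor, so the mean value
inequality is applied to the Taylor remainders. -/
theorem abs_cosh_mul_sinh_sub_le (hρ : ρ ≤ 1) (hS : |S| ≤ ρ) (hS' : |S'| ≤ ρ) (hT : |T| ≤ ρ)
    (hT' : |T'| ≤ ρ) :
    |cosh S' * sinh T' - cosh S * sinh T - (T' - T)|
      ≤ 4 * ρ ^ 2 * |S' - S| + 3 * ρ ^ 2 * |T' - T| := by
  have hρ0 := (abs_nonneg _).trans hT
  have e1 : cosh S' * sinh T' - cosh S * sinh T - (T' - T)
      = cosh S' * (sinh T' - sinh T - (T' - T)) + (cosh S' - 1) * (T' - T)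
        + (cosh S' - cosh S) * sinh T := by ring
  rw [e1]
  have t1 : |cosh S' * (sinh T' - sinh T - (T' - T))| ≤ 2 * (ρ ^ 2 * |T' - T|) := by
    rw [abs_mul, abs_of_pos (cosh_pos S')]
    exact mul_le_mul (cosh_le_two hρ hS') (abs_sinh_sub_sinh_sub_le hρ hT hT') (abs_nonneg _)
      two_pos.le
  have t2 : |(cosh S' - 1) * (T' - T)| ≤ ρ ^ 2 * |T' - T| := by
    rw [abs_mul, abs_of_nonneg (by linarith [one_le_cosh S'])]
    exact mul_le_mul_of_nonneg_right (cosh_sub_one_le hρ hS') (abs_nonneg _)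
  have t3 : |(cosh S' - cosh S) * sinh T| ≤ 2 * ρ * |S' - S| * (2 * ρ) := by
    rw [abs_mul]
    exact mul_le_mul (abs_cosh_sub_cosh_le hρ hS hS') (abs_sinh_le hρ hT) (abs_nonneg _)
      (by positivity)
  refine (abs_add_le _ _).trans ((add_le_add ((abs_add_le _ _).trans (add_le_add t1 t2)) t3).trans
    (le_of_eq (by ring)))

theorem abs_cosh_sub_one_mul_sinh_sub_le (hρ : ρ ≤ 1) (hS : |S| ≤ ρ) (hS' : |S'| ≤ ρ)
    (hT : |T| ≤ ρ) (hT' : |T'| ≤ ρ) :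
    |2 * (cosh S' - 1) * sinh T' - 2 * (cosh S - 1) * sinh T - (S' ^ 2 * T' - S ^ 2 * T)|
      ≤ 6 * ρ ^ 4 * |S' - S| + 3 * ρ ^ 4 * |T' - T| := by
  have hρ0 := (abs_nonneg _).trans hT
  have e1 : 2 * (cosh S' - 1) * sinh T' - 2 * (cosh S - 1) * sinh T - (S' ^ 2 * T' - S ^ 2 * T)
      = (2 * (cosh S' - cosh S) - (S' ^ 2 - S ^ 2)) * sinh T'
        + (S' - S) * ((S' + S) * (sinh T' - T'))
        + (2 * (cosh S - 1) - S ^ 2) * (sinh T' - sinh T)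
        + S ^ 2 * (sinh T' - sinh T - (T' - T)) := by ring
  rw [e1]
  have q : ∀ U : ℝ, |U| ≤ ρ → ∀ n, |U| ^ n ≤ ρ ^ n := fun U h n => by gcongr
  have t1 : |(2 * (cosh S' - cosh S) - (S' ^ 2 - S ^ 2)) * sinh T'|
      ≤ 2 * ρ ^ 3 * |S' - S| * (2 * ρ) := by
    rw [abs_mul]
    exact mul_le_mul (abs_cosh_sub_cosh_sub_le hρ hS hS') (abs_sinh_le hρ hT') (abs_nonneg _)
      (by positivity)
  have t2 : |(S' - S) * ((S' + S) * (sinh T' - T'))| ≤ |S' - S| * (2 * ρ * ρ ^ 3) := by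
    rw [abs_mul, abs_mul]
    refine mul_le_mul_of_nonneg_left (mul_le_mul ((abs_add_le _ _).trans (by linarith))
      ((abs_sinh_sub_self_le (hT'.trans hρ)).trans (q _ hT' 3)) (abs_nonneg _) (by positivity))
      (abs_nonneg _)
  have t3 : |(2 * (cosh S - 1) - S ^ 2) * (sinh T' - sinh T)| ≤ ρ ^ 4 * (2 * |T' - T|) := by
    rw [abs_mul]
    refine mul_le_mul ((abs_cosh_sub_le (hS.trans hρ)).trans ?_)
      (abs_sinh_sub_sinh_le hρ hT hT') (abs_nonneg _) (by positivity)
    have := q _ hS 4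
    rwa [← abs_pow, abs_of_nonneg (by positivity)] at this
  have t4 : |S ^ 2 * (sinh T' - sinh T - (T' - T))| ≤ ρ ^ 2 * (ρ ^ 2 * |T' - T|) := by
    rw [abs_mul, abs_pow]
    exact mul_le_mul (q _ hS 2) (abs_sinh_sub_sinh_sub_le hρ hT hT') (abs_nonneg _)
      (by positivity)
  refine (abs_add_le _ _).trans ((add_le_add ((abs_add_le _ _).trans (add_le_add
    ((abs_add_le _ _).trans (add_le_add t1 t2)) t3)) t4).trans (le_of_eq (by ring)))

end Hyperbolic

open Real

/-! ### Differences of the coefficients of the conjugated operator. -/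

section Coefficients

variable {X : Type*} [AddCommGroup X] {k : ℕ}

/-- `φ` is a weight on `X` which along the steps `e i`, thought of as steps of size `h`, has
gradient `a` and Hessian `H` up to relative errors of size `h`, with bounds `K`. The function `w`
is a bounded Lipschitz multiplier. -/
structure IsWeight (e : Fin k → X) (K h : ℝ) (φ : X → ℝ) (a : Fin k → X → ℝ)
    (H : Fin k → Fin k → X → ℝ) (w : X → ℝ) : Prop where
  fwd_sub_le : ∀ j x, |fwd (e j) φ x - h * a j x| ≤ K * h ^ 2
  fwd_grad_sub_le : ∀ i j x, |fwd (e i) (a j) x - h * H i j x| ≤ K * h ^ 2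
  grad_le : ∀ j x, |a j x| ≤ K
  hess_le : ∀ i j x, |H i j x| ≤ K
  mult_le : ∀ x, |w x| ≤ K
  fwd_mult_le : ∀ i x, |fwd (e i) w x| ≤ K * h

/-- The pseudoconvexity condition at the point `x`. -/
structure PseudoconvexAt (ε : ℝ) (a : Fin k → X → ℝ) (H : Fin k → Fin k → X → ℝ) (w : X → ℝ)
    (x : X) : Prop where
  grad : ∀ ξ : Fin k → ℝ, 2 * ε * ∑ i, ξ i ^ 2
    ≤ 4 * ∑ i, ∑ j, H i j x * ξ i * ξ j - 2 * (∑ j, H j j x + w x) * ∑ i, ξ i ^ 2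
  zero : 2 * ε ≤ 2 * ∑ i, ∑ j, (2 * a i x * a j x * H j i x + a i x ^ 2 * H j j x)
    + 2 * w x * ∑ i, a i x ^ 2

variable {e : Fin k → X} {K h σ : ℝ} {φ : X → ℝ} {a : Fin k → X → ℝ}
  {H : Fin k → Fin k → X → ℝ} {w : X → ℝ}

theorem IsWeight.abs_fwd_grad_le (D : IsWeight e K h φ a H w) (hh : 0 < h) (hh1 : h ≤ 1)
    (hK : 1 ≤ K) (i j : Fin k) (x : X) : |fwd (e i) (a j) x| ≤ 2 * K * h := by
  have h1 := abs_add_le (h * H i j x) (fwd (e i) (a j) x - h * H i j x)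
  rw [add_sub_cancel, abs_mul, abs_of_pos hh] at h1
  have h2 : h * |H i j x| ≤ h * K := by gcongr; exact D.hess_le i j x
  have h3 : K * h ^ 2 ≤ K * h := by gcongr; nlinarith
  linarith [D.fwd_grad_sub_le i j x]

theorem IsWeight.abs_smul_grad_le (D : IsWeight e K h φ a H w) (hσ : 0 < σ) (j : Fin k) (x : X) :
    |σ * a j x| ≤ σ * K := by
  rw [abs_mul, abs_of_pos hσ]; gcongr; exact D.grad_le j x

theorem IsWeight.abs_fwd_smul_grad_le (D : IsWeight e K h φ a H w) (hh : 0 < h) (hh1 : h ≤ 1)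
    (hK : 1 ≤ K) (hσ : 0 < σ) (i j : Fin k) (x : X) :
    |σ * a j (x + e i) - σ * a j x| ≤ σ * (2 * K * h) := by
  rw [← mul_sub, abs_mul, abs_of_pos hσ]
  exact mul_le_mul_of_nonneg_left (D.abs_fwd_grad_le hh hh1 hK i j x) hσ.le

/-- To leading order `cosh (σ a i) * sinh (σ a j)` is `σ a j`, whose difference is `σ h H l j`. The
error `σ ^ 3 * h` comes from the hyperbolic functions, `σ * h ^ 2` from the Taylor expansion of `a`.
-/
theorem IsWeight.abs_fwd_cosh_mul_sinh_sub_le (D : IsWeight e K h φ a H w) (hh : 0 < h)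
    (hh1 : h ≤ 1) (hK : 1 ≤ K) (hσ : 0 < σ) (hσK : σ * K ≤ 1) (i j l : Fin k) (x : X) :
    |fwd (e l) (fun y => cosh (σ * a i y) * sinh (σ * a j y)) x - σ * h * H l j x|
      ≤ 14 * K ^ 3 * (σ ^ 3 * h + σ * h ^ 2) := by
  have h1 := abs_cosh_mul_sinh_sub_le hσK (D.abs_smul_grad_le hσ i x)
    (D.abs_smul_grad_le hσ i (x + e l)) (D.abs_smul_grad_le hσ j x)
    (D.abs_smul_grad_le hσ j (x + e l))
  have h2 : |(σ * a j (x + e l) - σ * a j x) - σ * h * H l j x| ≤ σ * (K * h ^ 2) := by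
    have : (σ * a j (x + e l) - σ * a j x) - σ * h * H l j x
        = σ * (fwd (e l) (a j) x - h * H l j x) := by simp only [fwd]; ring
    rw [this, abs_mul, abs_of_pos hσ]
    exact mul_le_mul_of_nonneg_left (D.fwd_grad_sub_le l j x) hσ.le
  have h3 : 4 * (σ * K) ^ 2 * |σ * a i (x + e l) - σ * a i x|
      ≤ 4 * (σ * K) ^ 2 * (σ * (2 * K * h)) := by
    gcongr; exact D.abs_fwd_smul_grad_le hh hh1 hK hσ l i x
  have h4 : 3 * (σ * K) ^ 2 * |σ * a j (x + e l) - σ * a j x|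
      ≤ 3 * (σ * K) ^ 2 * (σ * (2 * K * h)) := by
    gcongr; exact D.abs_fwd_smul_grad_le hh hh1 hK hσ l j x
  have h5 : K ≤ 14 * K ^ 3 := by
    have : K ≤ K ^ 3 := le_self_pow₀ hK (by norm_num)
    linarith [show 0 ≤ K ^ 3 by positivity]
  have h6 : σ * (K * h ^ 2) ≤ 14 * K ^ 3 * (σ * h ^ 2) := by
    calc σ * (K * h ^ 2) = K * (σ * h ^ 2) := by ring
      _ ≤ _ := by gcongr
  have h7 := abs_add_le (cosh (σ * a i (x + e l)) * sinh (σ * a j (x + e l))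
    - cosh (σ * a i x) * sinh (σ * a j x) - (σ * a j (x + e l) - σ * a j x))
    ((σ * a j (x + e l) - σ * a j x) - σ * h * H l j x)
  rw [sub_add_sub_cancel] at h7
  simp only [fwd]
  nlinarith

/-- Discrete Leibniz rule for `a ^ 2 * b`: terms with two or more increments are quadratic in `h`.
-/
theorem abs_sq_mul_sub_le {K h a b a' b' A B : ℝ} (hh : 0 < h) (hh1 : h ≤ 1) (hK : 1 ≤ K)
    (ha : |a| ≤ K) (hb : |b| ≤ K) (hA : |a' - a - h * A| ≤ K * h ^ 2)
    (hB : |b' - b - h * B| ≤ K * h ^ 2) (ha' : |a' - a| ≤ 2 * K * h)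
    (hb' : |b' - b| ≤ 2 * K * h) :
    |a' ^ 2 * b' - a ^ 2 * b - h * (2 * a * b * A + a ^ 2 * B)| ≤ 23 * K ^ 3 * h ^ 2 := by
  have e1 : a' ^ 2 * b' - a ^ 2 * b - h * (2 * a * b * A + a ^ 2 * B)
      = 2 * (a * b) * (a' - a - h * A) + a * a * (b' - b - h * B)
        + 2 * a * ((a' - a) * (b' - b)) + (a' - a) * (a' - a) * b
        + (a' - a) * (a' - a) * (b' - b) := by ring
  rw [e1]
  have hK0 : 0 ≤ K := by linarith
  have t1 : |2 * (a * b) * (a' - a - h * A)| ≤ 2 * (K * K) * (K * h ^ 2) := by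
    rw [abs_mul, abs_mul, abs_mul, abs_two]; gcongr
  have t2 : |a * a * (b' - b - h * B)| ≤ K * K * (K * h ^ 2) := by
    rw [abs_mul, abs_mul]; gcongr
  have t3 : |2 * a * ((a' - a) * (b' - b))| ≤ 2 * K * ((2 * K * h) * (2 * K * h)) := by
    rw [abs_mul, abs_mul, abs_mul, abs_two]; gcongr
  have t4 : |(a' - a) * (a' - a) * b| ≤ (2 * K * h) * (2 * K * h) * K := by
    rw [abs_mul, abs_mul]; gcongr
  have t5 : |(a' - a) * (a' - a) * (b' - b)| ≤ (2 * K * h) * (2 * K * h) * (2 * K * h) := by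
    rw [abs_mul, abs_mul]; gcongr
  have t6 : (2 * K * h) * (2 * K * h) * (2 * K * h) ≤ 8 * K ^ 3 * h ^ 2 := by
    have : (2 * K * h) * (2 * K * h) * (2 * K * h) = 8 * K ^ 3 * h ^ 2 * h := by ring
    rw [this]
    exact mul_le_of_le_one_right (by positivity) hh1
  refine (abs_add_le _ _).trans ((add_le_add ((abs_add_le _ _).trans (add_le_add
    ((abs_add_le _ _).trans (add_le_add ((abs_add_le _ _).trans (add_le_add t1 t2)) t3)) t4))
    (t5.trans t6)).trans (le_of_eq (by ring)))

/-- The leading part of `2 * (cosh (σ a i) - 1) * sinh (σ a j)` is `σ ^ 3 * a i ^ 2 * a j`, and the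
main term is its Leibniz derivative along `e l`. -/
theorem IsWeight.abs_fwd_cosh_sub_one_mul_sinh_sub_le (D : IsWeight e K h φ a H w) (hh : 0 < h)
    (hh1 : h ≤ 1) (hK : 1 ≤ K) (hσ : 0 < σ) (hσK : σ * K ≤ 1) (i j l : Fin k) (x : X) :
    |fwd (e l) (fun y => 2 * (cosh (σ * a i y) - 1) * sinh (σ * a j y)) x
        - σ ^ 3 * h * (2 * a i x * a j x * H l i x + a i x ^ 2 * H l j x)|
      ≤ 23 * K ^ 5 * (σ ^ 5 * h + σ ^ 3 * h ^ 2) := by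
  have h1 := abs_cosh_sub_one_mul_sinh_sub_le hσK (D.abs_smul_grad_le hσ i x)
    (D.abs_smul_grad_le hσ i (x + e l)) (D.abs_smul_grad_le hσ j x)
    (D.abs_smul_grad_le hσ j (x + e l))
  have h2 := abs_sq_mul_sub_le hh hh1 hK (D.grad_le i x) (D.grad_le j x)
    (D.fwd_grad_sub_le l i x) (D.fwd_grad_sub_le l j x) (D.abs_fwd_grad_le hh hh1 hK l i x)
    (D.abs_fwd_grad_le hh hh1 hK l j x)
  have h2' : |(σ * a i (x + e l)) ^ 2 * (σ * a j (x + e l)) - (σ * a i x) ^ 2 * (σ * a j x)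
      - σ ^ 3 * h * (2 * a i x * a j x * H l i x + a i x ^ 2 * H l j x)|
      ≤ σ ^ 3 * (23 * K ^ 3 * h ^ 2) := by
    have : (σ * a i (x + e l)) ^ 2 * (σ * a j (x + e l)) - (σ * a i x) ^ 2 * (σ * a j x)
        - σ ^ 3 * h * (2 * a i x * a j x * H l i x + a i x ^ 2 * H l j x)
        = σ ^ 3 * (a i (x + e l) ^ 2 * a j (x + e l) - a i x ^ 2 * a j x
          - h * (2 * a i x * a j x * H l i x + a i x ^ 2 * H l j x)) := by ring
    rw [this, abs_mul, abs_of_pos (by positivity : 0 < σ ^ 3)]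
    exact mul_le_mul_of_nonneg_left h2 (by positivity)
  have h3 : 6 * (σ * K) ^ 4 * |σ * a i (x + e l) - σ * a i x|
      ≤ 6 * (σ * K) ^ 4 * (σ * (2 * K * h)) := by
    gcongr; exact D.abs_fwd_smul_grad_le hh hh1 hK hσ l i x
  have h4 : 3 * (σ * K) ^ 4 * |σ * a j (x + e l) - σ * a j x|
      ≤ 3 * (σ * K) ^ 4 * (σ * (2 * K * h)) := by
    gcongr; exact D.abs_fwd_smul_grad_le hh hh1 hK hσ l j x
  have h5 : K ^ 3 ≤ K ^ 5 := pow_le_pow_right₀ hK (by norm_num)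
  have h6 : σ ^ 3 * (23 * K ^ 3 * h ^ 2) ≤ 23 * K ^ 5 * (σ ^ 3 * h ^ 2) := by
    calc σ ^ 3 * (23 * K ^ 3 * h ^ 2) = 23 * K ^ 3 * (σ ^ 3 * h ^ 2) := by ring
      _ ≤ _ := by gcongr
  have h7 := abs_add_le (2 * (cosh (σ * a i (x + e l)) - 1) * sinh (σ * a j (x + e l))
    - 2 * (cosh (σ * a i x) - 1) * sinh (σ * a j x)
    - ((σ * a i (x + e l)) ^ 2 * (σ * a j (x + e l)) - (σ * a i x) ^ 2 * (σ * a j x)))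
    ((σ * a i (x + e l)) ^ 2 * (σ * a j (x + e l)) - (σ * a i x) ^ 2 * (σ * a j x)
      - σ ^ 3 * h * (2 * a i x * a j x * H l i x + a i x ^ 2 * H l j x))
  rw [sub_add_sub_cancel] at h7
  have h8 : 0 ≤ K ^ 5 * (σ ^ 5 * h) := by positivity
  simp only [fwd]
  nlinarith

theorem IsWeight.abs_mult_sub_le (D : IsWeight e K h φ a H w) (hh : 0 < h)
    (hσ : 0 < σ) (hσK : σ * K ≤ 1) (i : Fin k) (x : X) :
    |σ * h * (cosh (σ * a i x) * w x) - σ * h * w x| ≤ K ^ 3 * (σ ^ 3 * h) := by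
  have e1 : σ * h * (cosh (σ * a i x) * w x) - σ * h * w x
      = σ * h * ((cosh (σ * a i x) - 1) * w x) := by ring
  rw [e1, abs_mul, abs_of_pos (mul_pos hσ hh), abs_mul,
    abs_of_nonneg (by linarith [one_le_cosh (σ * a i x)] : 0 ≤ cosh (σ * a i x) - 1)]
  have h1 := mul_le_mul (cosh_sub_one_le hσK (D.abs_smul_grad_le hσ i x)) (D.mult_le x)
    (abs_nonneg _) (sq_nonneg _)
  calc _ ≤ σ * h * ((σ * K) ^ 2 * K) := by gcongr
    _ = _ := by ring

theorem IsWeight.abs_fwd_mult_le (D : IsWeight e K h φ a H w) (hh : 0 < h) (hh1 : h ≤ 1)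
    (hK : 1 ≤ K) (hσ : 0 < σ) (hσK : σ * K ≤ 1) (i : Fin k) (x : X) :
    |fwd (e i) (fun y => σ * h * (cosh (σ * a i y) * w y)) x| ≤ 6 * K ^ 3 * (σ * h ^ 2) := by
  have e1 : fwd (e i) (fun y => σ * h * (cosh (σ * a i y) * w y)) x
      = σ * h * (cosh (σ * a i (x + e i)) * fwd (e i) w x
        + (cosh (σ * a i (x + e i)) - cosh (σ * a i x)) * w x) := by simp only [fwd]; ring
  have t1 : |cosh (σ * a i (x + e i)) * fwd (e i) w x| ≤ 2 * (K * h) := by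
    rw [abs_mul, abs_of_pos (cosh_pos _)]
    exact mul_le_mul (cosh_le_two hσK (D.abs_smul_grad_le hσ i _)) (D.fwd_mult_le i x)
      (abs_nonneg _) two_pos.le
  have t2 : |(cosh (σ * a i (x + e i)) - cosh (σ * a i x)) * w x|
      ≤ 2 * (σ * K) * (σ * (2 * K * h)) * K := by
    rw [abs_mul]
    refine mul_le_mul ((abs_cosh_sub_cosh_le hσK (D.abs_smul_grad_le hσ i x)
      (D.abs_smul_grad_le hσ i _)).trans ?_) (D.mult_le x) (abs_nonneg _) (by positivity)
    gcongr
    exact D.abs_fwd_smul_grad_le hh hh1 hK hσ i i x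
  have t3 : 2 * (σ * K) * (σ * (2 * K * h)) * K ≤ 4 * (K * h) := by
    have : 2 * (σ * K) * (σ * (2 * K * h)) * K = 4 * (K * h) * ((σ * K) * (σ * K)) := by ring
    rw [this]
    exact mul_le_of_le_one_right (by positivity) (mul_le_one₀ hσK (by positivity) hσK)
  have t4 : K ≤ K ^ 3 := le_self_pow₀ hK (by norm_num)
  rw [e1, abs_mul, abs_of_pos (mul_pos hσ hh)]
  calc _ ≤ σ * h * (6 * (K * h)) := by
        gcongr
        exact (abs_add_le _ _).trans (by linarith)
    _ = 6 * K * (σ * h ^ 2) := by ring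
    _ ≤ _ := by gcongr

end Coefficients

/-! ### The individual terms of the pairings, with errors measured by the Carleman energy. -/

section Terms

variable {X : Type*} [AddCommGroup X] {k : ℕ} {e : Fin k → X} {s : Finset X} {f : X → ℝ}

/-- The energy controlled by the Carleman estimate. -/
noncomputable def carlemanEnergy (e : Fin k → X) (s : Finset X) (σ : ℝ) (f : X → ℝ) : ℝ :=
  σ ^ 3 * energy₀ s f + σ * energy₁ e s f + σ⁻¹ * energy₂ e s f

theorem carlemanEnergy_nonneg {σ : ℝ} (hσ : 0 < σ) : 0 ≤ carlemanEnergy e s σ f := by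
  have h0 := energy₀_nonneg (s := s) (f := f)
  have h1 := energy₁_nonneg (e := e) (s := s) (f := f)
  have h2 := energy₂_nonneg (e := e) (s := s) (f := f)
  unfold carlemanEnergy
  positivity

variable {K h σ : ℝ} {φ : X → ℝ} {a : Fin k → X → ℝ} {H : Fin k → Fin k → X → ℝ} {w : X → ℝ}

/-- The coefficient differences are of size `σ * h`, so the error is at most `h * σ` times `σ *
energy₁ + σ⁻¹ * energy₂`, up to terms of higher order. The assumption `h ≤ σ` says that `τ ≥ 1`. -/
theorem IsWeight.lap_sym_estimate (D : IsWeight e K h φ a H w) (hf : Padded e s 3 f)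
    (hh : 0 < h) (hhσ : h ≤ σ) (hK : 1 ≤ K) (hσ : 0 < σ) (hσ1 : σ ≤ 1) (hσK : σ * K ≤ 1)
    (i j : Fin k) :
    |∑ x ∈ s, cosh (σ * a i x) * sinh (σ * a j x) * lap (e i) f x * sym (e j) f x
      - ∑ x ∈ s, (σ * h * H j j x * fwd (e i) f x ^ 2
          - 2 * (σ * h * H i j x) * fwd (e i) f x * fwd (e j) f x)|
      ≤ 100 * K ^ 3 * (h * (σ + h / σ) * carlemanEnergy e s σ f) := by
  have hh1 := hhσ.trans hσ1
  have hb : ∀ i j x, |σ * h * H i j x| ≤ σ * h * K := fun i j x => by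
    rw [abs_mul, abs_of_pos (mul_pos hσ hh)]; gcongr; exact D.hess_le i j x
  refine (abs_sum_lap_sym_sub_le hf i j
    (α := fun x => cosh (σ * a i x) * sinh (σ * a j x)) hσ (hb i j) (hb j j)
    (D.abs_fwd_cosh_mul_sinh_sub_le hh hh1 hK hσ hσK i j i)
    (D.abs_fwd_cosh_mul_sinh_sub_le hh hh1 hK hσ hσK i j j)).trans ?_
  have h0 := energy₀_nonneg (s := s) (f := f)
  have h1 := energy₁_nonneg (e := e) (s := s) (f := f)
  have h2 := energy₂_nonneg (e := e) (s := s) (f := f)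
  set E₀ := energy₀ s f
  set E₁ := energy₁ e s f
  set E₂ := energy₂ e s f
  have hR : carlemanEnergy e s σ f = σ ^ 3 * E₀ + σ * E₁ + σ⁻¹ * E₂ := rfl
  set R := carlemanEnergy e s σ f
  have hR0 : 0 ≤ R := by rw [hR]; positivity
  have r1 : σ * E₁ + σ⁻¹ * E₂ ≤ R := by
    rw [hR]; have : 0 ≤ σ ^ 3 * E₀ := by positivity
    linarith
  have r2 : σ * E₁ ≤ R := by
    have : 0 ≤ σ⁻¹ * E₂ := by positivity
    linarith
  have l1 : h ≤ h / σ := le_div_self hh.le hσ hσ1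
  have l2 : σ ^ 2 ≤ σ := by nlinarith
  have l3 : σ ≤ σ + h / σ := by linarith [div_pos hh hσ]
  have c1 : σ * h * K + 14 * K ^ 3 * (σ ^ 3 * h + σ * h ^ 2) ≤ 29 * K ^ 3 * (h * σ) := by
    have k1 : K ≤ K ^ 3 := le_self_pow₀ hK (by norm_num)
    have k2 : σ * h * K ≤ σ * h * K ^ 3 := by gcongr
    have k3 : σ ^ 3 * h + σ * h ^ 2 ≤ 2 * (σ * h) := by
      have : σ ^ 3 * h + σ * h ^ 2 = (σ ^ 2 + h) * (σ * h) := by ring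
      rw [this]; gcongr; linarith
    have k4 : 14 * K ^ 3 * (σ ^ 3 * h + σ * h ^ 2) ≤ 14 * K ^ 3 * (2 * (σ * h)) := by gcongr
    linarith
  have c2 : 3 * (14 * K ^ 3 * (σ ^ 3 * h + σ * h ^ 2)) * E₁
      = 42 * K ^ 3 * (h * (σ ^ 2 + h) * (σ * E₁)) := by ring
  rw [c2]
  calc _ ≤ 2 * (29 * K ^ 3 * (h * (σ + h / σ))) * R
        + 42 * K ^ 3 * (h * (σ + h / σ) * R) := by
        gcongr
        · exact c1.trans (by gcongr)
    _ = _ := by ring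

theorem IsWeight.mul_sym_estimate (D : IsWeight e K h φ a H w) (hf : Padded e s 1 f)
    (hh : 0 < h) (hhσ : h ≤ σ) (hK : 1 ≤ K) (hσ : 0 < σ) (hσ1 : σ ≤ 1) (hσK : σ * K ≤ 1)
    (i j : Fin k) :
    |∑ x ∈ s, 2 * (cosh (σ * a i x) - 1) * sinh (σ * a j x) * f x * sym (e j) f x
      + ∑ x ∈ s, σ ^ 3 * h * (2 * a i x * a j x * H j i x + a i x ^ 2 * H j j x) * f x ^ 2|
      ≤ 72 * K ^ 5 * (h * (σ + h / σ) * carlemanEnergy e s σ f) := by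
  have hh1 := hhσ.trans hσ1
  have hb : ∀ x, |σ ^ 3 * h * (2 * a i x * a j x * H j i x + a i x ^ 2 * H j j x)|
      ≤ σ ^ 3 * h * (3 * K ^ 3) := fun x => by
    rw [abs_mul, abs_of_pos (by positivity : 0 < σ ^ 3 * h)]
    gcongr
    have t1 : |2 * a i x * a j x * H j i x| ≤ 2 * K * K * K := by
      rw [abs_mul, abs_mul, abs_mul, abs_two]
      gcongr
      exacts [D.grad_le i x, D.grad_le j x, D.hess_le j i x]
    have t2 : |a i x ^ 2 * H j j x| ≤ K ^ 2 * K := by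
      rw [abs_mul, abs_pow]
      gcongr
      exacts [D.grad_le i x, D.hess_le j j x]
    exact (abs_add_le _ _).trans (by linarith)
  refine (abs_sum_mul_sym_add_le hf j
    (c := fun x => 2 * (cosh (σ * a i x) - 1) * sinh (σ * a j x)) hσ hb
    (D.abs_fwd_cosh_sub_one_mul_sinh_sub_le hh hh1 hK hσ hσK i j j)).trans ?_
  have h0 := energy₀_nonneg (s := s) (f := f)
  have h1 := energy₁_nonneg (e := e) (s := s) (f := f)
  have h2 := energy₂_nonneg (e := e) (s := s) (f := f)
  set E₀ := energy₀ s f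
  set E₁ := energy₁ e s f
  set E₂ := energy₂ e s f
  have hR : carlemanEnergy e s σ f = σ ^ 3 * E₀ + σ * E₁ + σ⁻¹ * E₂ := rfl
  set R := carlemanEnergy e s σ f
  have hR0 : 0 ≤ R := by rw [hR]; positivity
  have r1 : σ ^ 3 * E₀ + σ * E₁ ≤ R := by
    rw [hR]; have : 0 ≤ σ⁻¹ * E₂ := by positivity
    linarith
  have r2 : σ ^ 3 * E₀ ≤ R := by
    have : 0 ≤ σ * E₁ := by positivity
    linarith
  have l1 : h ≤ h / σ := le_div_self hh.le hσ hσ1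
  have l2 : σ ^ 2 ≤ σ := by nlinarith
  have l3 : σ ≤ σ + h / σ := by linarith [div_pos hh hσ]
  have c1 : σ ^ 3 * h * (3 * K ^ 3) + 23 * K ^ 5 * (σ ^ 5 * h + σ ^ 3 * h ^ 2)
      ≤ 49 * K ^ 5 * (σ ^ 3 * h) := by
    have k1 : K ^ 3 ≤ K ^ 5 := pow_le_pow_right₀ hK (by norm_num)
    have k2 : σ ^ 3 * h * (3 * K ^ 3) ≤ σ ^ 3 * h * (3 * K ^ 5) := by gcongr
    have k3 : σ ^ 5 * h + σ ^ 3 * h ^ 2 ≤ 2 * (σ ^ 3 * h) := by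
      have : σ ^ 5 * h + σ ^ 3 * h ^ 2 = (σ ^ 2 + h) * (σ ^ 3 * h) := by ring
      rw [this]; gcongr; linarith
    have k4 : 23 * K ^ 5 * (σ ^ 5 * h + σ ^ 3 * h ^ 2) ≤ 23 * K ^ 5 * (2 * (σ ^ 3 * h)) := by
      gcongr
    linarith
  have c2 : 23 * K ^ 5 * (σ ^ 5 * h + σ ^ 3 * h ^ 2) * E₀
      = 23 * K ^ 5 * (h * (σ ^ 2 + h) * (σ ^ 3 * E₀)) := by ring
  have c3 : 49 * K ^ 5 * (σ ^ 3 * h) * (σ * E₀ + σ⁻¹ * E₁)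
      = 49 * K ^ 5 * (h * σ * (σ ^ 3 * E₀ + σ * E₁)) := by field_simp
  rw [c2]
  calc _ ≤ 23 * K ^ 5 * (h * (σ + h / σ) * R)
        + 49 * K ^ 5 * (σ ^ 3 * h) * (σ * E₀ + σ⁻¹ * E₁) := by gcongr
    _ ≤ 23 * K ^ 5 * (h * (σ + h / σ) * R) + 49 * K ^ 5 * (h * (σ + h / σ) * R) := by
        rw [c3]; gcongr
    _ = _ := by ring

/-- Differences of the multiplier have size `σ * h ^ 2`, which produces an error with factor `h * (h
/ σ)`. Since `h / σ` is `1 / τ`, this error becomes small only for large `τ`. -/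
theorem IsWeight.mul_lap_estimate (D : IsWeight e K h φ a H w) (hf : Padded e s 1 f)
    (hh : 0 < h) (hhσ : h ≤ σ) (hK : 1 ≤ K) (hσ : 0 < σ) (hσ1 : σ ≤ 1) (hσK : σ * K ≤ 1)
    (i : Fin k) :
    |∑ x ∈ s, σ * h * (cosh (σ * a i x) * w x) * f x * lap (e i) f x
      + ∑ x ∈ s, σ * h * w x * fwd (e i) f x ^ 2|
      ≤ 7 * K ^ 3 * (h * (σ + h / σ) * carlemanEnergy e s σ f) := by
  have hh1 := hhσ.trans hσ1
  refine (abs_sum_mul_lap_add_le hf i (W := fun x => σ * h * (cosh (σ * a i x) * w x)) hσ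
    (D.abs_mult_sub_le hh hσ hσK i) (D.abs_fwd_mult_le hh hh1 hK hσ hσK i)).trans ?_
  have h0 := energy₀_nonneg (s := s) (f := f)
  have h1 := energy₁_nonneg (e := e) (s := s) (f := f)
  have h2 := energy₂_nonneg (e := e) (s := s) (f := f)
  set E₀ := energy₀ s f
  set E₁ := energy₁ e s f
  set E₂ := energy₂ e s f
  have hR : carlemanEnergy e s σ f = σ ^ 3 * E₀ + σ * E₁ + σ⁻¹ * E₂ := rfl
  set R := carlemanEnergy e s σ f
  have hR0 : 0 ≤ R := by rw [hR]; positivity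
  have r1 : σ ^ 3 * E₀ + σ * E₁ ≤ R := by
    rw [hR]; have : 0 ≤ σ⁻¹ * E₂ := by positivity
    linarith
  have r2 : σ * E₁ ≤ R := by
    have : 0 ≤ σ ^ 3 * E₀ := by positivity
    linarith
  have l2 : σ ^ 2 ≤ σ + h / σ := by nlinarith [div_pos hh hσ]
  have l3 : h / σ ≤ σ + h / σ := by linarith
  have c2 : K ^ 3 * (σ ^ 3 * h) * E₁ = K ^ 3 * (h * σ ^ 2 * (σ * E₁)) := by ring
  have c3 : 6 * K ^ 3 * (σ * h ^ 2) * (σ * E₀ + σ⁻¹ * E₁)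
      = 6 * K ^ 3 * (h * (h / σ) * (σ ^ 3 * E₀ + σ * E₁)) := by field_simp
  rw [c2, c3]
  calc _ ≤ K ^ 3 * (h * (σ + h / σ) * R) + 6 * K ^ 3 * (h * (σ + h / σ) * R) := by gcongr
    _ = _ := by ring

theorem IsWeight.mul_self_estimate (D : IsWeight e K h φ a H w)
    (hh : 0 < h) (hσ : 0 < σ) (hσ1 : σ ≤ 1) (hσK : σ * K ≤ 1) (i : Fin k) :
    |∑ x ∈ s, σ * h * w x * (2 * (cosh (σ * a i x) - 1)) * f x ^ 2
      - ∑ x ∈ s, σ ^ 3 * h * (w x * a i x ^ 2) * f x ^ 2|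
      ≤ K ^ 5 * (h * (σ + h / σ) * carlemanEnergy e s σ f) := by
  have h0 := energy₀_nonneg (s := s) (f := f)
  have h1 := energy₁_nonneg (e := e) (s := s) (f := f)
  have h2 := energy₂_nonneg (e := e) (s := s) (f := f)
  rw [← sum_sub_distrib]
  have pt : ∀ x ∈ s, |σ * h * w x * (2 * (cosh (σ * a i x) - 1)) * f x ^ 2
      - σ ^ 3 * h * (w x * a i x ^ 2) * f x ^ 2| ≤ σ * h * (K * (σ * K) ^ 4) * f x ^ 2 := by
    intro x _
    have hK0 : 0 ≤ K := (abs_nonneg _).trans (D.mult_le x)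
    have e1 : σ * h * w x * (2 * (cosh (σ * a i x) - 1)) * f x ^ 2
        - σ ^ 3 * h * (w x * a i x ^ 2) * f x ^ 2
        = σ * h * (w x * (2 * (cosh (σ * a i x) - 1) - (σ * a i x) ^ 2)) * f x ^ 2 := by ring
    have hb := D.abs_smul_grad_le hσ i x
    have h4 : (σ * a i x) ^ 4 ≤ (σ * K) ^ 4 := by
      rw [← abs_of_nonneg (by positivity : 0 ≤ (σ * a i x) ^ 4), abs_pow]
      gcongr
    rw [e1, abs_mul, abs_mul (σ * h), abs_of_pos (mul_pos hσ hh), abs_mul,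
      abs_of_nonneg (sq_nonneg (f x))]
    gcongr
    · exact D.mult_le x
    · exact (abs_cosh_sub_le (hb.trans hσK)).trans h4
  refine (abs_sum_le_sum_abs _ _).trans ((sum_le_sum pt).trans ?_)
  rw [← mul_sum]
  change σ * h * (K * (σ * K) ^ 4) * energy₀ s f ≤ _
  have r : σ ^ 3 * energy₀ s f ≤ carlemanEnergy e s σ f := by
    have : 0 ≤ σ * energy₁ e s f + σ⁻¹ * energy₂ e s f := by positivity
    unfold carlemanEnergy; linarith
  have l2 : σ ^ 2 ≤ σ + h / σ := by nlinarith [div_pos hh hσ]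
  calc σ * h * (K * (σ * K) ^ 4) * energy₀ s f
      = K ^ 5 * (h * σ ^ 2 * (σ ^ 3 * energy₀ s f)) := by ring
    _ ≤ _ := by
      have hK0 : 0 ≤ K := (abs_nonneg _).trans (D.mult_le 0)
      have := carlemanEnergy_nonneg (e := e) (s := s) (f := f) hσ
      gcongr

end Terms

/-! ### Positivity of the commutator and the estimate for the leading operator. -/

section Core

variable {X : Type*} [AddCommGroup X] {k : ℕ}

/-- The leading symmetric part of the conjugated Laplacian. -/
noncomputable def symmPart (e : Fin k → X) (σ : ℝ) (a : Fin k → X → ℝ) (f : X → ℝ) (x : X) : ℝ :=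
  ∑ i, (cosh (σ * a i x) * lap (e i) f x + 2 * (cosh (σ * a i x) - 1) * f x)

/-- The leading antisymmetric part of the conjugated Laplacian, up to sign. -/
noncomputable def skewPart (e : Fin k → X) (σ : ℝ) (a : Fin k → X → ℝ) (f : X → ℝ) (x : X) : ℝ :=
  ∑ j, sinh (σ * a j x) * sym (e j) f x

variable {e : Fin k → X} {s : Finset X} {f : X → ℝ} {K h σ ε : ℝ} {φ : X → ℝ}
  {a : Fin k → X → ℝ} {H : Fin k → Fin k → X → ℝ} {w : X → ℝ}

theorem abs_sum_sum_sub_le {ι : Type*} (t : Finset ι) (F G : ι → ℝ) (c : ℝ)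
    (h : ∀ i ∈ t, |F i - G i| ≤ c) : |∑ i ∈ t, F i - ∑ i ∈ t, G i| ≤ #t * c := by
  rw [← sum_sub_distrib]
  refine (abs_sum_le_sum_abs _ _).trans ((sum_le_sum h).trans ?_)
  rw [sum_const, nsmul_eq_mul]

/-- `lap_sym_estimate` yields the quadratic form in the gradient and `mul_sym_estimate` the
zero-order form. The errors `100` and `72` add up over the `k ^ 2` pairs of directions. -/
theorem IsWeight.sum_symm_mul_skew (D : IsWeight e K h φ a H w) (hf : Padded e s 3 f)
    (hh : 0 < h) (hhσ : h ≤ σ) (hK : 1 ≤ K) (hσ : 0 < σ) (hσ1 : σ ≤ 1) (hσK : σ * K ≤ 1) :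
    |∑ x ∈ s, symmPart e σ a f x * skewPart e σ a f x
      - ∑ x ∈ s, h * (σ * (∑ j, H j j x * ∑ i, fwd (e i) f x ^ 2
          - 2 * ∑ i, ∑ j, H i j x * fwd (e i) f x * fwd (e j) f x)
        - σ ^ 3 * (∑ i, ∑ j, (2 * a i x * a j x * H j i x + a i x ^ 2 * H j j x)) * f x ^ 2)|
      ≤ k * (k * (172 * K ^ 5 * (h * (σ + h / σ) * carlemanEnergy e s σ f))) := by
  set R := h * (σ + h / σ) * carlemanEnergy e s σ f with hR
  have hR0 : 0 ≤ R := by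
    have := carlemanEnergy_nonneg (e := e) (s := s) (f := f) hσ
    positivity
  have e1 : ∑ x ∈ s, symmPart e σ a f x * skewPart e σ a f x
      = ∑ i, ∑ j, (∑ x ∈ s, cosh (σ * a i x) * sinh (σ * a j x) * lap (e i) f x * sym (e j) f x
        + ∑ x ∈ s, 2 * (cosh (σ * a i x) - 1) * sinh (σ * a j x) * f x * sym (e j) f x) := by
    simp only [symmPart, skewPart, sum_mul_sum]
    rw [sum_comm]
    refine sum_congr rfl fun i _ => ?_
    rw [sum_comm]
    refine sum_congr rfl fun j _ => ?_
    rw [← sum_add_distrib]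
    exact sum_congr rfl fun x _ => by ring
  have e2 : ∑ x ∈ s, h * (σ * (∑ j, H j j x * ∑ i, fwd (e i) f x ^ 2
          - 2 * ∑ i, ∑ j, H i j x * fwd (e i) f x * fwd (e j) f x)
        - σ ^ 3 * (∑ i, ∑ j, (2 * a i x * a j x * H j i x + a i x ^ 2 * H j j x)) * f x ^ 2)
      = ∑ i, ∑ j, (∑ x ∈ s, (σ * h * H j j x * fwd (e i) f x ^ 2
          - 2 * (σ * h * H i j x) * fwd (e i) f x * fwd (e j) f x)
        - ∑ x ∈ s, σ ^ 3 * h * (2 * a i x * a j x * H j i x + a i x ^ 2 * H j j x)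
            * f x ^ 2) := by
    have pt : ∀ x ∈ s, h * (σ * (∑ j, H j j x * ∑ i, fwd (e i) f x ^ 2
          - 2 * ∑ i, ∑ j, H i j x * fwd (e i) f x * fwd (e j) f x)
        - σ ^ 3 * (∑ i, ∑ j, (2 * a i x * a j x * H j i x + a i x ^ 2 * H j j x)) * f x ^ 2)
        = ∑ i, ∑ j, ((σ * h * H j j x * fwd (e i) f x ^ 2
          - 2 * (σ * h * H i j x) * fwd (e i) f x * fwd (e j) f x)
        - σ ^ 3 * h * (2 * a i x * a j x * H j i x + a i x ^ 2 * H j j x) * f x ^ 2) := by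
      intro x _
      have q : ∑ j, H j j x * ∑ i, fwd (e i) f x ^ 2
          = ∑ i, ∑ j, H j j x * fwd (e i) f x ^ 2 := by
        rw [sum_comm]; simp only [mul_sum]
      rw [q]
      simp only [mul_sum, sum_mul, ← sum_sub_distrib]
      exact sum_congr rfl fun i _ => sum_congr rfl fun j _ => by ring
    rw [sum_congr rfl pt, sum_comm]
    refine sum_congr rfl fun i _ => ?_
    rw [sum_comm]
    exact sum_congr rfl fun j _ => sum_sub_distrib ..
  rw [e1, e2]
  have key : ∀ i j, |(∑ x ∈ s, cosh (σ * a i x) * sinh (σ * a j x) * lap (e i) f x * sym (e j) f x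
        + ∑ x ∈ s, 2 * (cosh (σ * a i x) - 1) * sinh (σ * a j x) * f x * sym (e j) f x)
      - (∑ x ∈ s, (σ * h * H j j x * fwd (e i) f x ^ 2
          - 2 * (σ * h * H i j x) * fwd (e i) f x * fwd (e j) f x)
        - ∑ x ∈ s, σ ^ 3 * h * (2 * a i x * a j x * H j i x + a i x ^ 2 * H j j x)
            * f x ^ 2)| ≤ 172 * K ^ 5 * R := by
    intro i j
    have b1 := D.lap_sym_estimate hf hh hhσ hK hσ hσ1 hσK i j
    have b2 := D.mul_sym_estimate hf.of_succ.of_succ hh hhσ hK hσ hσ1 hσK i j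
    rw [← hR] at b1 b2
    have b3 : 100 * K ^ 3 * R ≤ 100 * K ^ 5 * R := by
      gcongr 100 * ?_ * R
      exact pow_le_pow_right₀ hK (by norm_num)
    rw [abs_le] at b1 b2 ⊢
    constructor <;> linarith [b1.1, b1.2, b2.1, b2.2]
  have inner : ∀ i ∈ (univ : Finset (Fin k)), _ := fun i _ =>
    abs_sum_sum_sub_le univ _ _ _ fun j _ => key i j
  simpa using abs_sum_sum_sub_le univ _ _ _ inner

/-- Pairing with a multiple of `f` itself exchanges gradient energy for zero-order energy at rate
`w`. This freedom is what makes both commutator forms positive simultaneously. -/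
theorem IsWeight.sum_symm_mul_mult (D : IsWeight e K h φ a H w) (hf : Padded e s 1 f)
    (hh : 0 < h) (hhσ : h ≤ σ) (hK : 1 ≤ K) (hσ : 0 < σ) (hσ1 : σ ≤ 1) (hσK : σ * K ≤ 1) :
    |∑ x ∈ s, symmPart e σ a f x * (σ * h * w x * f x)
      - ∑ x ∈ s, h * (σ ^ 3 * (w x * ∑ i, a i x ^ 2) * f x ^ 2
          - σ * (w x * ∑ i, fwd (e i) f x ^ 2))|
      ≤ k * (8 * K ^ 5 * (h * (σ + h / σ) * carlemanEnergy e s σ f)) := by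
  set R := h * (σ + h / σ) * carlemanEnergy e s σ f with hR
  have hR0 : 0 ≤ R := by
    have := carlemanEnergy_nonneg (e := e) (s := s) (f := f) hσ
    positivity
  have e1 : ∑ x ∈ s, symmPart e σ a f x * (σ * h * w x * f x)
      = ∑ i, (∑ x ∈ s, σ * h * (cosh (σ * a i x) * w x) * f x * lap (e i) f x
        + ∑ x ∈ s, σ * h * w x * (2 * (cosh (σ * a i x) - 1)) * f x ^ 2) := by
    simp only [symmPart, sum_mul]
    rw [sum_comm]
    refine sum_congr rfl fun i _ => ?_
    rw [← sum_add_distrib]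
    exact sum_congr rfl fun x _ => by ring
  have e2 : ∑ x ∈ s, h * (σ ^ 3 * (w x * ∑ i, a i x ^ 2) * f x ^ 2
          - σ * (w x * ∑ i, fwd (e i) f x ^ 2))
      = ∑ i, (∑ x ∈ s, σ ^ 3 * h * (w x * a i x ^ 2) * f x ^ 2
        - ∑ x ∈ s, σ * h * w x * fwd (e i) f x ^ 2) := by
    simp only [mul_sum, sum_mul, ← sum_sub_distrib]
    rw [sum_comm]
    exact sum_congr rfl fun i _ => sum_congr rfl fun x _ => by ring
  rw [e1, e2]
  have key : ∀ i ∈ (univ : Finset (Fin k)),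
      |(∑ x ∈ s, σ * h * (cosh (σ * a i x) * w x) * f x * lap (e i) f x
        + ∑ x ∈ s, σ * h * w x * (2 * (cosh (σ * a i x) - 1)) * f x ^ 2)
      - (∑ x ∈ s, σ ^ 3 * h * (w x * a i x ^ 2) * f x ^ 2
        - ∑ x ∈ s, σ * h * w x * fwd (e i) f x ^ 2)| ≤ 8 * K ^ 5 * R := by
    intro i _
    have b1 := D.mul_lap_estimate hf hh hhσ hK hσ hσ1 hσK i
    have b2 := D.mul_self_estimate (e := e) (s := s) (f := f) hh hσ hσ1 hσK i
    rw [← hR] at b1 b2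
    have b3 : 7 * K ^ 3 * R ≤ 7 * K ^ 5 * R := by
      gcongr 7 * ?_ * R
      exact pow_le_pow_right₀ hK (by norm_num)
    rw [abs_le] at b1 b2 ⊢
    constructor <;> linarith [b1.1, b1.2, b2.1, b2.2]
  simpa using abs_sum_sum_sub_le univ _ _ _ key

/-- The plain Laplacian differs from `symmPart` by terms with factor `cosh - 1`, at most `(σ * K) ^
2`. By `sum_lap_sq` its norm is exactly `energy₂`, and `hσk` lets half of `energy₂` absorb the
second-order part of the difference. -/
theorem IsWeight.energy₂_le (D : IsWeight e K h φ a H w) (hf : Padded e s 3 f)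
    (hσ : 0 < σ) (hσK : σ * K ≤ 1) (hσk : 8 * k ^ 2 * (σ * K) ^ 4 ≤ 1) :
    energy₂ e s f ≤ 4 * ∑ x ∈ s, symmPart e σ a f x ^ 2
      + 32 * k ^ 2 * (σ * K) ^ 4 * energy₀ s f := by
  have pt : ∀ x ∈ s, (∑ i, lap (e i) f x) ^ 2 ≤ 2 * symmPart e σ a f x ^ 2
      + 4 * k * (σ * K) ^ 4 * ∑ i, lap (e i) f x ^ 2 + 16 * k ^ 2 * (σ * K) ^ 4 * f x ^ 2 := by
    intro x _
    have e1 : ∑ i, lap (e i) f x = symmPart e σ a f x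
        + -∑ i, (cosh (σ * a i x) - 1) * (lap (e i) f x + 2 * f x) := by
      rw [symmPart, ← sub_eq_add_neg, ← sum_sub_distrib]
      exact sum_congr rfl fun i _ => by ring
    have e2 : (∑ i, (cosh (σ * a i x) - 1) * (lap (e i) f x + 2 * f x)) ^ 2
        ≤ k * ∑ i, ((σ * K) ^ 4 * (2 * lap (e i) f x ^ 2 + 8 * f x ^ 2)) := by
      refine (sq_sum_le_card_mul_sum_sq).trans ?_
      rw [card_univ, Fintype.card_fin]
      gcongr with i _
      have h1 := cosh_sub_one_le hσK (D.abs_smul_grad_le hσ i x)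
      have h0 : 0 ≤ cosh (σ * a i x) - 1 := by linarith [one_le_cosh (σ * a i x)]
      rw [mul_pow]
      have h2 : (cosh (σ * a i x) - 1) ^ 2 ≤ (σ * K) ^ 4 := by
        calc _ ≤ ((σ * K) ^ 2) ^ 2 := by gcongr
          _ = _ := by ring
      gcongr
      nlinarith [sq_nonneg (lap (e i) f x - 2 * f x)]
    have e3 : (k : ℝ) * ∑ i : Fin k, ((σ * K) ^ 4 * (2 * lap (e i) f x ^ 2 + 8 * f x ^ 2))
        = 2 * k * (σ * K) ^ 4 * ∑ i, lap (e i) f x ^ 2 + 8 * k ^ 2 * (σ * K) ^ 4 * f x ^ 2 := by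
      rw [← mul_sum, sum_add_distrib, ← mul_sum, sum_const, card_univ, Fintype.card_fin,
        nsmul_eq_mul]
      ring
    have e4 := add_sq_le (a := symmPart e σ a f x)
      (b := -∑ i, (cosh (σ * a i x) - 1) * (lap (e i) f x + 2 * f x))
    rw [neg_sq] at e4
    rw [e1]
    rw [e3] at e2
    linarith
  have hl : ∑ x ∈ s, ∑ i, lap (e i) f x ^ 2 ≤ k * energy₂ e s f := by
    rw [sum_comm]
    refine (sum_le_card_nsmul univ _ (energy₂ e s f) fun i _ => ?_).trans ?_
    · have h1 : ∀ x, lap (e i) f x = fwd (e i) (fwd (e i) f) (x - e i) := fun x => by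
        rw [lap_eq]; simp only [fwd, sub_add_cancel]
      simp only [h1]
      rw [((hf.fwd i).fwd i).sq.sum_unshift i]
      exact sum_fwd_fwd_sq_le i i
    · simp
  have := sum_le_sum pt
  rw [sum_lap_sq hf.of_succ] at this
  simp only [sum_add_distrib, ← mul_sum] at this
  have h3 : 4 * k * (σ * K) ^ 4 * ∑ x ∈ s, ∑ i, lap (e i) f x ^ 2
      ≤ 4 * k * (σ * K) ^ 4 * (k * energy₂ e s f) := by gcongr
  have h4 : 8 * k ^ 2 * (σ * K) ^ 4 * energy₂ e s f ≤ 1 * energy₂ e s f := by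
    gcongr; exact energy₂_nonneg
  change _ ≤ _ + _ + 16 * k ^ 2 * (σ * K) ^ 4 * energy₀ s f at this
  linarith

/-- The Carleman estimate for the leading part of the conjugated Laplacian. -/
theorem IsWeight.carlemanEnergy_le_leading (D : IsWeight e K h φ a H w) (hf : Padded e s 3 f)
    (hh : 0 < h) (hhσ : 16 * h ≤ σ) (hK : 1 ≤ K) (hσ : 0 < σ) (hσ1 : σ ≤ 1) (hσK : σ * K ≤ 1)
    (hσk : 8 * k ^ 2 * (σ * K) ^ 4 ≤ 1) (hε : 0 < ε)
    (hA : ∀ x, (f x ≠ 0 ∨ ∃ i, fwd (e i) f x ≠ 0) → PseudoconvexAt ε a H w x) :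
    h * (min (ε / (32 * k ^ 2 * K ^ 4 + ε + 1)) ε
        - (344 * k ^ 2 + 16 * k + 2) * K ^ 5 * (σ + h / σ)) * carlemanEnergy e s σ f
      ≤ ∑ x ∈ s, (symmPart e σ a f x - skewPart e σ a f x) ^ 2 := by
  have hhσ' : h ≤ σ := by linarith
  have b1 := D.sum_symm_mul_skew hf hh hhσ' hK hσ hσ1 hσK
  have b2 := D.sum_symm_mul_mult hf.of_succ.of_succ hh hhσ' hK hσ hσ1 hσK
  have b3 := D.energy₂_le hf hσ hσK hσk
  have E0 := energy₀_nonneg (s := s) (f := f)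
  have E1 := energy₁_nonneg (e := e) (s := s) (f := f)
  have E2 := energy₂_nonneg (e := e) (s := s) (f := f)
  have hR := carlemanEnergy_nonneg (e := e) (s := s) (f := f) hσ
  -- the quadratic form of the commutator is positive
  have pos : ∑ x ∈ s, h * (2 * ε * (σ * ∑ i, fwd (e i) f x ^ 2 + σ ^ 3 * f x ^ 2))
      ≤ -2 * ∑ x ∈ s, h * (σ * (∑ j, H j j x * ∑ i, fwd (e i) f x ^ 2
          - 2 * ∑ i, ∑ j, H i j x * fwd (e i) f x * fwd (e j) f x)
        - σ ^ 3 * (∑ i, ∑ j, (2 * a i x * a j x * H j i x + a i x ^ 2 * H j j x)) * f x ^ 2)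
      + 2 * ∑ x ∈ s, h * (σ ^ 3 * (w x * ∑ i, a i x ^ 2) * f x ^ 2
          - σ * (w x * ∑ i, fwd (e i) f x ^ 2)) := by
    rw [mul_sum, mul_sum, ← sum_add_distrib]
    refine sum_le_sum fun x _ => ?_
    have e1 : -2 * (h * (σ * (∑ j, H j j x * ∑ i, fwd (e i) f x ^ 2
          - 2 * ∑ i, ∑ j, H i j x * fwd (e i) f x * fwd (e j) f x)
        - σ ^ 3 * (∑ i, ∑ j, (2 * a i x * a j x * H j i x + a i x ^ 2 * H j j x)) * f x ^ 2))
        + 2 * (h * (σ ^ 3 * (w x * ∑ i, a i x ^ 2) * f x ^ 2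
          - σ * (w x * ∑ i, fwd (e i) f x ^ 2)))
        = h * (σ * (4 * ∑ i, ∑ j, H i j x * fwd (e i) f x * fwd (e j) f x
            - 2 * (∑ j, H j j x + w x) * ∑ i, fwd (e i) f x ^ 2)
          + σ ^ 3 * ((2 * ∑ i, ∑ j, (2 * a i x * a j x * H j i x + a i x ^ 2 * H j j x)
            + 2 * w x * ∑ i, a i x ^ 2) * f x ^ 2)) := by
      rw [← sum_mul]; ring
    rw [e1]
    by_cases hx : f x ≠ 0 ∨ ∃ i, fwd (e i) f x ≠ 0
    · obtain ⟨p1, p2⟩ := hA x hx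
      -- The gradient condition is needed for arbitrary `ξ` because the differences of `f` in the
      -- `k` directions `e i` are treated as independent.
      have p1 := mul_le_mul_of_nonneg_left (p1 fun i => fwd (e i) f x) hσ.le
      have p2 := mul_le_mul_of_nonneg_left
        (mul_le_mul_of_nonneg_right p2 (sq_nonneg (f x))) (pow_pos hσ 3).le
      refine mul_le_mul_of_nonneg_left ?_ hh.le
      linarith
    · push Not at hx
      simp [hx.1, hx.2]
  have pos' : ∑ x ∈ s, h * (2 * ε * (σ * ∑ i, fwd (e i) f x ^ 2 + σ ^ 3 * f x ^ 2))
      = h * (2 * ε * (σ * energy₁ e s f + σ ^ 3 * energy₀ s f)) := by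
    rw [← mul_sum, ← mul_sum, sum_add_distrib, ← mul_sum, ← mul_sum, sum_comm]
    rfl
  -- expanding the square
  have expand : 1 / 2 * ∑ x ∈ s, symmPart e σ a f x ^ 2
      + (-2 * ∑ x ∈ s, symmPart e σ a f x * skewPart e σ a f x
        + 2 * ∑ x ∈ s, symmPart e σ a f x * (σ * h * w x * f x))
      - 2 * (σ ^ 2 * h ^ 2 * K ^ 2 * energy₀ s f)
      ≤ ∑ x ∈ s, (symmPart e σ a f x - skewPart e σ a f x) ^ 2 := by
    simp only [energy₀, mul_sum, ← sum_add_distrib, ← sum_sub_distrib]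
    refine sum_le_sum fun x _ => ?_
    set P := symmPart e σ a f x
    set Q := skewPart e σ a f x
    have hw : (σ * h * w x * f x) ^ 2 ≤ σ ^ 2 * h ^ 2 * K ^ 2 * f x ^ 2 := by
      rw [mul_pow, mul_pow, mul_pow]
      have := D.mult_le x
      have : w x ^ 2 ≤ K ^ 2 := sq_le_sq' (abs_le.1 this).1 (abs_le.1 this).2
      gcongr
    -- With `W = σ * h * w x * f x`, the two sides differ by `Q ^ 2 + (P - 2 * W) ^ 2 / 2` plus the
    -- slack in `hw`.
    nlinarith [sq_nonneg (P / 2 - (σ * h * w x * f x) * 2), sq_nonneg Q,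
      sq_nonneg (P - 2 * (σ * h * w x * f x))]
  set E₀ := energy₀ s f
  set E₁ := energy₁ e s f
  set E₂ := energy₂ e s f
  set P2 := ∑ x ∈ s, symmPart e σ a f x ^ 2
  have hP2 : 0 ≤ P2 := sum_nonneg fun _ _ => sq_nonneg _
  have hRdef : carlemanEnergy e s σ f = σ ^ 3 * E₀ + σ * E₁ + σ⁻¹ * E₂ := rfl
  set R := carlemanEnergy e s σ f
  set M := 32 * (k : ℝ) ^ 2 * K ^ 4 with hM
  have hM0 : 0 ≤ M := by positivity
  -- Recovering second differences costs `M * σ ^ 3 * E₀`. Only a fraction `θ` of them is kept, with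
  -- `θ * M ≤ ε`, so that half of the available `2 * ε * σ ^ 3 * E₀` pays for it.
  set θ := ε / (M + ε + 1) with hθ
  have hθ0 : 0 ≤ θ := by positivity
  have hθ1 : θ ≤ 1 := by rw [hθ, div_le_one (by positivity)]; linarith
  have hθM : θ * M ≤ ε := by
    rw [hθ, div_mul_eq_mul_div, div_le_iff₀ (by positivity)]; nlinarith
  have c1 : h * (σ⁻¹ * E₂) ≤ 1 / 2 * P2 + h * (M * (σ ^ 3 * E₀)) := by
    have : h * (σ⁻¹ * E₂) ≤ h * (σ⁻¹ * (4 * P2 + 32 * k ^ 2 * (σ * K) ^ 4 * E₀)) := by gcongr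
    have e2 : h * (σ⁻¹ * (4 * P2 + 32 * k ^ 2 * (σ * K) ^ 4 * E₀))
        = 4 * (h / σ) * P2 + h * (M * (σ ^ 3 * E₀)) := by
      rw [hM]; field_simp
    have e3 : h / σ ≤ 1 / 16 := by rw [div_le_iff₀ hσ]; linarith
    have e4 : 4 * (h / σ) * P2 ≤ 4 * (1 / 16) * P2 := by gcongr
    linarith
  have c2 : θ * (h * (σ⁻¹ * E₂)) ≤ 1 / 2 * P2 + h * (ε * (σ ^ 3 * E₀)) := by
    have t1 := mul_le_mul_of_nonneg_left c1 hθ0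
    have t2 : θ * (1 / 2 * P2) ≤ 1 * (1 / 2 * P2) := by gcongr
    have t3 : θ * M * (h * (σ ^ 3 * E₀)) ≤ ε * (h * (σ ^ 3 * E₀)) := by gcongr
    linarith
  have c3 : σ ^ 2 * h ^ 2 * K ^ 2 * E₀ ≤ K ^ 5 * (h * (σ + h / σ) * R) := by
    have t1 : σ ^ 3 * E₀ ≤ R := by
      have : 0 ≤ σ * E₁ + σ⁻¹ * E₂ := by positivity
      linarith
    have t2 : σ ^ 2 * h ^ 2 * K ^ 2 * E₀ = K ^ 2 * (h * (h / σ) * (σ ^ 3 * E₀)) := by field_simp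
    have t3 : K ^ 2 ≤ K ^ 5 := pow_le_pow_right₀ hK (by norm_num)
    rw [t2]
    gcongr
    linarith
  have c4 : h * (min θ ε * R) ≤ h * (2 * ε * (σ * E₁ + σ ^ 3 * E₀)) - h * (ε * (σ ^ 3 * E₀))
      + θ * (h * (σ⁻¹ * E₂)) := by
    have t1 : min θ ε * (σ ^ 3 * E₀ + σ * E₁) ≤ ε * (σ ^ 3 * E₀ + σ * E₁) := by
      gcongr; exact min_le_right _ _
    have t2 : min θ ε * (σ⁻¹ * E₂) ≤ θ * (σ⁻¹ * E₂) := by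
      gcongr; exact min_le_left _ _
    have t3 : 0 ≤ ε * (σ * E₁) := by positivity
    have t4 : min θ ε * R ≤ ε * (2 * (σ * E₁) + σ ^ 3 * E₀) + θ * (σ⁻¹ * E₂) := by
      rw [hRdef]; linarith
    have := mul_le_mul_of_nonneg_left t4 hh.le
    linarith
  rw [abs_le] at b1 b2
  have fin : h * (min θ ε - (344 * k ^ 2 + 16 * k + 2) * K ^ 5 * (σ + h / σ)) * R
      = h * (min θ ε * R) - 2 * (k * (k * (172 * K ^ 5 * (h * (σ + h / σ) * R))))
        - 2 * (k * (8 * K ^ 5 * (h * (σ + h / σ) * R)))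
        - 2 * (K ^ 5 * (h * (σ + h / σ) * R)) := by ring
  rw [fin]
  rw [pos'] at pos
  linarith [b1.1, b1.2, b2.1, b2.2]

end Core

/-! ### Conjugation with the weight, and the return from the conjugated function. -/

section Conjugation

theorem abs_exp_sub_exp_le {p q δ : ℝ} (hp : |p| ≤ 1) (hδ : |q - p| ≤ δ) (hδ1 : δ ≤ 1) :
    |exp q - exp p| ≤ 6 * δ := by
  have h1 : exp q - exp p = exp p * (exp (q - p) - 1) := by
    rw [mul_sub, ← exp_add]; simp
  have h2 : |exp (q - p) - 1| ≤ 2 * |q - p| := abs_exp_sub_one_le (hδ.trans hδ1)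
  have h3 : exp p ≤ 3 :=
    (exp_le_exp.2 ((le_abs_self p).trans hp)).trans (exp_one_lt_d9.le.trans (by norm_num))
  rw [h1, abs_mul, abs_of_pos (exp_pos p)]
  calc exp p * |exp (q - p) - 1| ≤ 3 * (2 * δ) := by
        gcongr
        exact h2.trans (by linarith)
    _ = 6 * δ := by ring

variable {X : Type*} [AddCommGroup X] {k : ℕ} {e : Fin k → X} {s : Finset X} {f u : X → ℝ}
  {K h τ ε : ℝ} {φ : X → ℝ} {a : Fin k → X → ℝ} {H : Fin k → Fin k → X → ℝ} {w : X → ℝ}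

theorem IsWeight.abs_grad_sub_le (D : IsWeight e K h φ a H w) (hh : 0 < h) (hh1 : h ≤ 1)
    (hK : 1 ≤ K) (i j : Fin k) (x : X) : |a j (x - e i) - a j x| ≤ 2 * K * h := by
  have := D.abs_fwd_grad_le hh hh1 hK i j (x - e i)
  rwa [fwd, sub_add_cancel, abs_sub_comm] at this

theorem IsWeight.abs_weight_add (D : IsWeight e K h φ a H w) (hτ : 0 < τ)
    (j : Fin k) (x : X) :
    |τ * φ x - τ * φ (x + e j) - -(τ * h * a j x)| ≤ K * (τ * h * h) := by
  have e1 : τ * φ x - τ * φ (x + e j) - -(τ * h * a j x)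
      = -(τ * (fwd (e j) φ x - h * a j x)) := by simp only [fwd]; ring
  rw [e1, abs_neg, abs_mul, abs_of_pos hτ]
  calc _ ≤ τ * (K * h ^ 2) := by gcongr; exact D.fwd_sub_le j x
    _ = _ := by ring

theorem IsWeight.abs_weight_sub (D : IsWeight e K h φ a H w) (hh : 0 < h) (hh1 : h ≤ 1)
    (hK : 1 ≤ K) (hτ : 0 < τ) (j : Fin k) (x : X) :
    |τ * φ x - τ * φ (x - e j) - τ * h * a j x| ≤ 3 * K * (τ * h * h) := by
  have h1 := D.abs_weight_add hτ j (x - e j)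
  rw [sub_add_cancel] at h1
  have h2 : |τ * h * (a j (x - e j) - a j x)| ≤ τ * h * (2 * K * h) := by
    rw [abs_mul, abs_of_pos (mul_pos hτ hh)]
    gcongr
    exact D.abs_grad_sub_le hh hh1 hK j j x
  have e1 : τ * φ x - τ * φ (x - e j) - τ * h * a j x
      = -(τ * φ (x - e j) - τ * φ x - -(τ * h * a j (x - e j)))
        + τ * h * (a j (x - e j) - a j x) := by ring
  rw [e1]
  refine (abs_add_le _ _).trans ?_
  rw [abs_neg]
  linarith

/-- The Laplacian conjugated with the exponential of `ψ`. -/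
noncomputable def conjLap (e : Fin k → X) (ψ f : X → ℝ) (x : X) : ℝ :=
  ∑ j, (exp (ψ x - ψ (x + e j)) * f (x + e j) + exp (ψ x - ψ (x - e j)) * f (x - e j) - 2 * f x)

omit [AddCommGroup X] in
theorem exp_mul_eq (ψ u : X → ℝ) (x y : X) :
    exp (ψ x) * u y = exp (ψ x - ψ y) * (exp (ψ y) * u y) := by
  rw [← mul_assoc, ← exp_add, sub_add_cancel]

theorem conjLap_exp_mul (ψ u : X → ℝ) (x : X) :
    conjLap e ψ (fun y => exp (ψ y) * u y) x = exp (ψ x) * ∑ j, lap (e j) u x := by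
  simp only [conjLap, ← exp_mul_eq, mul_sum]
  exact sum_congr rfl fun j _ => by simp only [lap]; ring

/-- With the exponents replaced by `∓ τ * h * a j x`, the conjugated Laplacian is exactly `symmPart
- skewPart`. The exponents are off by `O(τ * h ^ 2)`, which is the size of the error. -/
theorem IsWeight.abs_conjLap_sub_le (D : IsWeight e K h φ a H w) (hh : 0 < h) (hh1 : h ≤ 1)
    (hK : 1 ≤ K) (hτ : 0 < τ) (hσK : 3 * K * (τ * h) ≤ 1) (f : X → ℝ) (x : X) :
    |symmPart e (τ * h) a f x - skewPart e (τ * h) a f x - conjLap e (fun y => τ * φ y) f x|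
      ≤ 18 * K * (τ * h * h) * ∑ j, (|f (x + e j)| + |f (x - e j)|) := by
  have hσ : 0 < τ * h := mul_pos hτ hh
  simp only [symmPart, skewPart, conjLap, ← sum_sub_distrib]
  rw [mul_sum]
  refine (abs_sum_le_sum_abs _ _).trans (sum_le_sum fun j _ => ?_)
  have hb := D.abs_smul_grad_le hσ j x
  have hK' : τ * h * K ≤ 1 := by nlinarith
  have hδ : 3 * K * (τ * h * h) ≤ 1 := by
    calc 3 * K * (τ * h * h) = 3 * K * (τ * h) * h := by ring
      _ ≤ 1 := mul_le_one₀ hσK hh.le hh1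
  have b1 := abs_exp_sub_exp_le (p := -(τ * h * a j x)) (by rw [abs_neg]; exact hb.trans hK')
    ((D.abs_weight_add hτ j x).trans (by nlinarith [mul_pos hσ hh] :
      K * (τ * h * h) ≤ 3 * K * (τ * h * h))) hδ
  have b2 := abs_exp_sub_exp_le (hb.trans hK') (D.abs_weight_sub hh hh1 hK hτ j x) hδ
  set E₁ := exp (τ * φ x - τ * φ (x + e j))
  set E₂ := exp (τ * φ x - τ * φ (x - e j))
  set t := τ * h * a j x
  have e1 : cosh t * lap (e j) f x + 2 * (cosh t - 1) * f x - sinh t * sym (e j) f x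
      - (E₁ * f (x + e j) + E₂ * f (x - e j) - 2 * f x)
      = -((E₁ - exp (-t)) * f (x + e j)) + -((E₂ - exp t) * f (x - e j)) := by
    rw [cosh_eq, sinh_eq]; simp only [lap, sym]; ring
  rw [e1]
  refine (abs_add_le _ _).trans ?_
  rw [abs_neg, abs_neg, abs_mul, abs_mul]
  have c1 := mul_le_mul_of_nonneg_right b1 (abs_nonneg (f (x + e j)))
  have c2 := mul_le_mul_of_nonneg_right b2 (abs_nonneg (f (x - e j)))
  linarith

theorem IsWeight.sum_leading_sq_le (D : IsWeight e K h φ a H w) (hf : Padded e s 1 f)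
    (hh : 0 < h) (hh1 : h ≤ 1) (hK : 1 ≤ K) (hτ : 0 < τ) (hσK : 3 * K * (τ * h) ≤ 1) :
    ∑ x ∈ s, (symmPart e (τ * h) a f x - skewPart e (τ * h) a f x) ^ 2
      ≤ 2 * ∑ x ∈ s, conjLap e (fun y => τ * φ y) f x ^ 2
        + 2592 * k ^ 2 * K ^ 2 * ((τ * h * h) ^ 2 * energy₀ s f) := by
  have pt : ∀ x ∈ s, (symmPart e (τ * h) a f x - skewPart e (τ * h) a f x) ^ 2
      ≤ 2 * conjLap e (fun y => τ * φ y) f x ^ 2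
        + 1296 * k * K ^ 2 * (τ * h * h) ^ 2 * ∑ j, (f (x + e j) ^ 2 + f (x - e j) ^ 2) := by
    intro x _
    have b := D.abs_conjLap_sub_le hh hh1 hK hτ hσK f x
    set L := conjLap e (fun y => τ * φ y) f x
    set P := symmPart e (τ * h) a f x - skewPart e (τ * h) a f x
    have b2 : (P - L) ^ 2
        ≤ (18 * K * (τ * h * h)) ^ 2 * (2 * k * ∑ j, (f (x + e j) ^ 2 + f (x - e j) ^ 2)) := by
      rw [← sq_abs]
      refine (pow_le_pow_left₀ (abs_nonneg _) b 2).trans ?_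
      rw [mul_pow]
      gcongr
      refine sq_sum_le_card_mul_sum_sq.trans ?_
      rw [card_univ, Fintype.card_fin, mul_comm 2 (k : ℝ), mul_assoc]
      gcongr
      rw [mul_sum]
      refine sum_le_sum fun j _ => add_sq_le.trans ?_
      rw [sq_abs, sq_abs]
    have e1 : P = L + (P - L) := by ring
    have b3 := add_sq_le (a := L) (b := P - L)
    rw [← e1] at b3
    nlinarith
  refine (sum_le_sum pt).trans ?_
  have hs : ∑ x ∈ s, ∑ j, (f (x + e j) ^ 2 + f (x - e j) ^ 2) = 2 * k * energy₀ s f := by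
    rw [sum_comm]
    simp only [sum_add_distrib, hf.sq.sum_shift, hf.sq.sum_unshift, sum_const, card_univ,
      Fintype.card_fin, nsmul_eq_mul]
    unfold energy₀; ring
  rw [sum_add_distrib, ← mul_sum, ← mul_sum, hs]
  exact le_of_eq (by ring)

/-- Undoes the conjugation: the factors `exp (τ * φ x - τ * φ (x ± e j))` are `1 + O(τ * h)`, so
first differences of `u` cost first differences of `f` plus `τ * h` times values of `f`. -/
theorem IsWeight.sum_sym_sq_le (D : IsWeight e K h φ a H w)
    (hf : Padded e s 2 fun y => exp (τ * φ y) * u y) (hh : 0 < h) (hh1 : h ≤ 1) (hK : 1 ≤ K)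
    (hτ : 0 < τ) (hσK : 4 * K * (τ * h) ≤ 1) (j : Fin k) :
    ∑ x ∈ s, (exp (τ * φ x) * sym (e j) u x) ^ 2
      ≤ 3456 * K ^ 2 * (energy₁ e s (fun y => exp (τ * φ y) * u y)
        + (τ * h) ^ 2 * energy₀ s (fun y => exp (τ * φ y) * u y)) := by
  set f : X → ℝ := fun y => exp (τ * φ y) * u y with hfdef
  have hσ : 0 < τ * h := mul_pos hτ hh
  have pt : ∀ x ∈ s, (exp (τ * φ x) * sym (e j) u x) ^ 2
      ≤ 6 * (fwd (e j) f x ^ 2 + fwd (e j) f (x - e j) ^ 2)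
        + 1728 * K ^ 2 * (τ * h) ^ 2 * (f (x + e j) ^ 2 + f (x - e j) ^ 2) := by
    intro x _
    have hb := D.abs_smul_grad_le hσ j x
    have hσh : τ * h * h ≤ τ * h := mul_le_of_le_one_right hσ.le hh1
    have q1 : |τ * φ x - τ * φ (x + e j) - 0| ≤ 4 * K * (τ * h) := by
      have h1 := D.abs_weight_add hτ j x
      have h2 := abs_add_le (τ * φ x - τ * φ (x + e j) - -(τ * h * a j x)) (-(τ * h * a j x))
      rw [sub_add_cancel, abs_neg] at h2
      rw [sub_zero]
      nlinarith
    have q2 : |τ * φ x - τ * φ (x - e j) - 0| ≤ 4 * K * (τ * h) := by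
      have h1 := D.abs_weight_sub hh hh1 hK hτ j x
      have h2 := abs_add_le (τ * φ x - τ * φ (x - e j) - τ * h * a j x) (τ * h * a j x)
      rw [sub_add_cancel] at h2
      rw [sub_zero]
      nlinarith
    have b1 := abs_exp_sub_exp_le (by simp) q1 hσK
    have b2 := abs_exp_sub_exp_le (by simp) q2 hσK
    rw [exp_zero] at b1 b2
    have e1 : exp (τ * φ x) * sym (e j) u x = (fwd (e j) f x + fwd (e j) f (x - e j))
        + (exp (τ * φ x - τ * φ (x + e j)) - 1) * f (x + e j)
        + -((exp (τ * φ x - τ * φ (x - e j)) - 1) * f (x - e j)) := by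
      rw [← sym_eq]
      simp only [sym, mul_sub, exp_mul_eq (fun y => τ * φ y) u x (x + e j),
        exp_mul_eq (fun y => τ * φ y) u x (x - e j), hfdef]
      ring
    set E₁ := exp (τ * φ x - τ * φ (x + e j)) - 1
    set E₂ := exp (τ * φ x - τ * φ (x - e j)) - 1
    have c1 : (E₁ * f (x + e j)) ^ 2 ≤ (6 * (4 * K * (τ * h))) ^ 2 * f (x + e j) ^ 2 := by
      rw [mul_pow]
      gcongr ?_ * _
      exact sq_le_sq' (abs_le.1 b1).1 (abs_le.1 b1).2
    have c2 : (E₂ * f (x - e j)) ^ 2 ≤ (6 * (4 * K * (τ * h))) ^ 2 * f (x - e j) ^ 2 := by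
      rw [mul_pow]
      gcongr ?_ * _
      exact sq_le_sq' (abs_le.1 b2).1 (abs_le.1 b2).2
    have c3 := add_sq_le (a := fwd (e j) f x) (b := fwd (e j) f (x - e j))
    rw [e1]
    have c4 : ∀ A B C : ℝ, (A + B + -C) ^ 2 ≤ 3 * (A ^ 2 + B ^ 2 + C ^ 2) := fun A B C => by
      nlinarith [sq_nonneg (A - B), sq_nonneg (A + C), sq_nonneg (B + C)]
    refine (c4 _ _ _).trans ?_
    linarith
  refine (sum_le_sum pt).trans ?_
  simp only [sum_add_distrib, ← mul_sum, (hf.fwd j).sq.sum_unshift j,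
    hf.of_succ.sq.sum_shift j, hf.of_succ.sq.sum_unshift j]
  have b1 := sum_fwd_sq_le (e := e) (s := s) (f := f) j
  have E1 := energy₁_nonneg (e := e) (s := s) (f := f)
  have hK2 : 1 ≤ K ^ 2 := one_le_pow₀ hK
  have b2 : 6 * (∑ x ∈ s, fwd (e j) f x ^ 2 + ∑ x ∈ s, fwd (e j) f x ^ 2)
      ≤ 3456 * K ^ 2 * energy₁ e s f := by nlinarith
  change _ + 1728 * K ^ 2 * (τ * h) ^ 2 * (energy₀ s f + energy₀ s f) ≤ _
  linarith

/-- The exponential factors must now be expanded to second order. Their linear parts at `x + 2 * e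
j` and `x - 2 * e j` are opposite and combine into first differences of `f`; this leaves `(τ * h) ^
2 * energy₁` and a remainder `(τ * h) ^ 4 * energy₀`, both matching the Carleman energy. -/
theorem IsWeight.sum_sym_sym_sq_le (D : IsWeight e K h φ a H w)
    (hf : Padded e s 4 fun y => exp (τ * φ y) * u y) (hh : 0 < h) (hK : 1 ≤ K)
    (hτ : 0 < τ) (hhσ : h ≤ τ * h) (hσK : 10 * K * (τ * h) ≤ 1) (j : Fin k) :
    ∑ x ∈ s, (exp (τ * φ x) * sym (e j) (sym (e j) u) x) ^ 2
      ≤ 93312 * K ^ 4 * (energy₂ e s (fun y => exp (τ * φ y) * u y)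
        + (τ * h) ^ 2 * energy₁ e s (fun y => exp (τ * φ y) * u y)
        + (τ * h) ^ 4 * energy₀ s (fun y => exp (τ * φ y) * u y)) := by
  set f : X → ℝ := fun y => exp (τ * φ y) * u y with hfdef
  have hσ : 0 < τ * h := mul_pos hτ hh
  have hσ1 : τ * h ≤ 1 := by nlinarith
  have hh1 : h ≤ 1 := hhσ.trans hσ1
  set v := e j
  have pt : ∀ x ∈ s, (exp (τ * φ x) * sym v (sym v u) x) ^ 2
      ≤ 16 * (fwd v (fwd v f) x ^ 2 + fwd v (fwd v f) (x - v) ^ 2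
          + fwd v (fwd v f) (x - v) ^ 2 + fwd v (fwd v f) (x - v - v) ^ 2)
        + 64 * K ^ 2 * (τ * h) ^ 2 * (fwd v f (x + v) ^ 2 + fwd v f x ^ 2
          + fwd v f (x - v) ^ 2 + fwd v f (x - v - v) ^ 2)
        + 46656 * K ^ 4 * (τ * h) ^ 4 * (f (x + v + v) ^ 2 + f (x - v - v) ^ 2) := by
    intro x _
    have hb := D.abs_smul_grad_le hσ j x
    have hσh : τ * h * h ≤ (τ * h) ^ 2 := by rw [sq]; gcongr
    have hσh' : τ * h * h ≤ τ * h := mul_le_of_le_one_right hσ.le hh1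
    have hK2 : K ≤ K ^ 2 := le_self_pow₀ hK (by norm_num)
    have q1 : |τ * φ x - τ * φ (x + v + v) - -(2 * (τ * h * a j x))| ≤ 4 * K * (τ * h * h) := by
      have h1 := D.abs_weight_add hτ j x
      have h2 := D.abs_weight_add hτ j (x + v)
      have h3 : |τ * h * fwd v (a j) x| ≤ τ * h * (2 * K * h) := by
        rw [abs_mul, abs_of_pos hσ]
        gcongr
        exact D.abs_fwd_grad_le hh hh1 hK j j x
      have e1 : τ * φ x - τ * φ (x + v + v) - -(2 * (τ * h * a j x))
          = (τ * φ x - τ * φ (x + v) - -(τ * h * a j x))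
            + (τ * φ (x + v) - τ * φ (x + v + v) - -(τ * h * a j (x + v)))
            - τ * h * fwd v (a j) x := by simp only [fwd]; ring
      rw [e1, abs_le]
      rw [abs_le] at h1 h2 h3
      constructor <;> linarith [h1.1, h1.2, h2.1, h2.2, h3.1, h3.2]
    have q2 : |τ * φ x - τ * φ (x - v - v) - 2 * (τ * h * a j x)| ≤ 8 * K * (τ * h * h) := by
      have h1 := D.abs_weight_sub hh hh1 hK hτ j x
      have h2 := D.abs_weight_sub hh hh1 hK hτ j (x - v)
      have h3 : |τ * h * (a j (x - v) - a j x)| ≤ τ * h * (2 * K * h) := by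
        rw [abs_mul, abs_of_pos hσ]
        gcongr
        exact D.abs_grad_sub_le hh hh1 hK j j x
      have e1 : τ * φ x - τ * φ (x - v - v) - 2 * (τ * h * a j x)
          = (τ * φ x - τ * φ (x - v) - τ * h * a j x)
            + (τ * φ (x - v) - τ * φ (x - v - v) - τ * h * a j (x - v))
            + τ * h * (a j (x - v) - a j x) := by ring
      rw [e1, abs_le]
      rw [abs_le] at h1 h2 h3
      constructor <;> linarith [h1.1, h1.2, h2.1, h2.2, h3.1, h3.2]
    have key : ∀ t p : ℝ, |t - p| ≤ 8 * K * (τ * h * h) → |p| ≤ 2 * K * (τ * h) →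
        |exp t - 1 - p| ≤ 108 * K ^ 2 * (τ * h) ^ 2 := by
      intro t p h1 h2
      have h3 : |t| ≤ 10 * K * (τ * h) := by
        have := abs_add_le (t - p) p
        rw [sub_add_cancel] at this
        nlinarith
      have h4 := abs_exp_sub_one_sub_id_le (h3.trans hσK)
      have h5 : t ^ 2 ≤ (10 * K * (τ * h)) ^ 2 := sq_le_sq' (abs_le.1 h3).1 (abs_le.1 h3).2
      have h6 : 8 * K * (τ * h * h) ≤ 8 * K ^ 2 * (τ * h) ^ 2 := by gcongr
      have h7 := abs_add_le (exp t - 1 - t) (t - p)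
      rw [sub_add_sub_cancel] at h7
      nlinarith
    have b1 := key _ (-(2 * (τ * h * a j x))) (q1.trans (by gcongr; norm_num))
      (by rw [abs_neg, abs_mul, abs_two]; linarith)
    have b2 := key _ (2 * (τ * h * a j x)) q2 (by rw [abs_mul, abs_two]; linarith)
    set E₁ := exp (τ * φ x - τ * φ (x + v + v)) with hE₁
    set E₂ := exp (τ * φ x - τ * φ (x - v - v)) with hE₂
    have e1 : exp (τ * φ x) * sym v (sym v u) x
        = (fwd v (fwd v f) x + fwd v (fwd v f) (x - v) + fwd v (fwd v f) (x - v)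
            + fwd v (fwd v f) (x - v - v))
          + -(2 * (τ * h * a j x)) * (fwd v f (x + v) + fwd v f x + fwd v f (x - v)
            + fwd v f (x - v - v))
          + (E₁ - 1 - -(2 * (τ * h * a j x))) * f (x + v + v)
          + (E₂ - 1 - 2 * (τ * h * a j x)) * f (x - v - v) := by
      have a1 : exp (τ * φ x) * u (x + v + v) = E₁ * f (x + v + v) :=
        exp_mul_eq (fun y => τ * φ y) u x (x + v + v)
      have a2 : exp (τ * φ x) * u (x - v - v) = E₂ * f (x - v - v) :=
        exp_mul_eq (fun y => τ * φ y) u x (x - v - v)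
      have a3 : exp (τ * φ x) * u x = f x := rfl
      simp only [sym, fwd, add_sub_cancel_right, sub_add_cancel, mul_sub, a1, a2, a3]
      ring
    have four : ∀ A B C D : ℝ, (A + B + C + D) ^ 2 ≤ 4 * (A ^ 2 + B ^ 2 + C ^ 2 + D ^ 2) :=
      fun A B C D => by
        nlinarith [sq_nonneg (A - B), sq_nonneg (A - C), sq_nonneg (A - D), sq_nonneg (B - C),
          sq_nonneg (B - D), sq_nonneg (C - D)]
    rw [e1]
    refine (four _ _ _ _).trans ?_
    have c1 := four (fwd v (fwd v f) x) (fwd v (fwd v f) (x - v)) (fwd v (fwd v f) (x - v))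
      (fwd v (fwd v f) (x - v - v))
    have c2 : (-(2 * (τ * h * a j x)) * (fwd v f (x + v) + fwd v f x + fwd v f (x - v)
        + fwd v f (x - v - v))) ^ 2 ≤ (2 * (τ * h * K)) ^ 2 * (4 * (fwd v f (x + v) ^ 2
          + fwd v f x ^ 2 + fwd v f (x - v) ^ 2 + fwd v f (x - v - v) ^ 2)) := by
      rw [mul_pow, neg_sq]
      gcongr ?_ * ?_
      · exact sq_le_sq' (by linarith [(abs_le.1 hb).1]) (by linarith [(abs_le.1 hb).2])
      · exact four _ _ _ _
    have c3 : ((E₁ - 1 - -(2 * (τ * h * a j x))) * f (x + v + v)) ^ 2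
        ≤ (108 * K ^ 2 * (τ * h) ^ 2) ^ 2 * f (x + v + v) ^ 2 := by
      rw [mul_pow]
      gcongr ?_ * _
      exact sq_le_sq' (abs_le.1 b1).1 (abs_le.1 b1).2
    have c4 : ((E₂ - 1 - 2 * (τ * h * a j x)) * f (x - v - v)) ^ 2
        ≤ (108 * K ^ 2 * (τ * h) ^ 2) ^ 2 * f (x - v - v) ^ 2 := by
      rw [mul_pow]
      gcongr ?_ * _
      exact sq_le_sq' (abs_le.1 b2).1 (abs_le.1 b2).2
    linarith
  refine (sum_le_sum pt).trans ?_
  have sh1 : ∀ F : X → ℝ, Padded e s 1 F → ∑ x ∈ s, F (x - v) = ∑ x ∈ s, F x :=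
    fun F hF => hF.sum_unshift j
  have sh1' : ∀ F : X → ℝ, Padded e s 1 F → ∑ x ∈ s, F (x + v) = ∑ x ∈ s, F x :=
    fun F hF => hF.sum_shift j
  have sh2 : ∀ F : X → ℝ, Padded e s 2 F → ∑ x ∈ s, F (x - v - v) = ∑ x ∈ s, F x :=
    fun F hF => ((hF.unshift j).sum_unshift j).trans (hF.of_succ.sum_unshift j)
  have sh2' : ∀ F : X → ℝ, Padded e s 2 F → ∑ x ∈ s, F (x + v + v) = ∑ x ∈ s, F x :=
    fun F hF => ((hF.shift j).sum_shift j).trans (hF.of_succ.sum_shift j)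
  have p1 : Padded e s 3 (fwd v f) := hf.fwd j
  have p2 : Padded e s 2 (fwd v (fwd v f)) := p1.fwd j
  simp only [sum_add_distrib, ← mul_sum, sh1 _ p2.of_succ.sq, sh2 _ p2.sq,
    sh1 _ p1.of_succ.of_succ.sq, sh1' _ p1.of_succ.of_succ.sq,
    sh2 _ p1.of_succ.sq, sh2 _ hf.of_succ.of_succ.sq, sh2' _ hf.of_succ.of_succ.sq]
  have b1 : ∑ x ∈ s, fwd v f x ^ 2 ≤ energy₁ e s f := sum_fwd_sq_le j
  have b2 : ∑ x ∈ s, fwd v (fwd v f) x ^ 2 ≤ energy₂ e s f := sum_fwd_fwd_sq_le j j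
  have E1 := energy₁_nonneg (e := e) (s := s) (f := f)
  have E2 := energy₂_nonneg (e := e) (s := s) (f := f)
  have hK2 : 1 ≤ K ^ 2 := one_le_pow₀ hK
  have hK4 : 1 ≤ K ^ 4 := one_le_pow₀ hK
  have hK24 : K ^ 2 ≤ K ^ 4 := pow_le_pow_right₀ hK (by norm_num)
  have d1 : 64 * ∑ x ∈ s, fwd v (fwd v f) x ^ 2 ≤ 93312 * K ^ 4 * energy₂ e s f := by
    nlinarith
  have d2 : 256 * K ^ 2 * (τ * h) ^ 2 * ∑ x ∈ s, fwd v f x ^ 2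
      ≤ 93312 * K ^ 4 * ((τ * h) ^ 2 * energy₁ e s f) := by
    calc _ = 256 * K ^ 2 * ((τ * h) ^ 2 * ∑ x ∈ s, fwd v f x ^ 2) := by ring
      _ ≤ 93312 * K ^ 4 * ((τ * h) ^ 2 * energy₁ e s f) := by gcongr; norm_num
  unfold energy₀
  linarith

set_option maxHeartbeats 1000000 in
/-- The discrete Carleman estimate on an abelian group, for an abstract pseudoconvex weight. -/
theorem exists_carleman_estimate (k : ℕ) (K ε : ℝ) (hK : 1 ≤ K) (hε : 0 < ε) :
    ∃ δ C : ℝ, 0 < δ ∧ δ < 1 ∧ 1 < C ∧ ∀ {X : Type} [AddCommGroup X] (e : Fin k → X) (h τ : ℝ)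
      (φ : X → ℝ) (a : Fin k → X → ℝ) (H : Fin k → Fin k → X → ℝ) (w : X → ℝ) (s : Finset X)
      (u : X → ℝ), IsWeight e K h φ a H w → 0 < h → δ⁻¹ < τ → τ * h < δ →
      (∀ x, (u x ≠ 0 ∨ ∃ i, u (x + e i) ≠ 0) → PseudoconvexAt ε a H w x) → Padded e s 4 u →
      h * ((τ * h) ^ 3 * ∑ x ∈ s, (exp (τ * φ x) * u x) ^ 2
        + τ * h * ∑ j, ∑ x ∈ s, (exp (τ * φ x) * sym (e j) u x) ^ 2
        + (τ * h)⁻¹ * ∑ j, ∑ x ∈ s, (exp (τ * φ x) * sym (e j) (sym (e j) u) x) ^ 2)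
      ≤ C * ∑ x ∈ s, (exp (τ * φ x) * ∑ j, lap (e j) u x) ^ 2 := by
  set κ := min (ε / (32 * k ^ 2 * K ^ 4 + ε + 1)) ε with hκ
  have hκ0 : 0 < κ := lt_min (by positivity) hε
  -- The first group collects the commutator errors, the last term the linearisation of the
  -- exponents.
  set M := ((344 * k ^ 2 + 16 * k + 2) + 2592 * k ^ 2 : ℝ) * K ^ 5 with hM
  have hM0 : 0 < M := by positivity
  -- Both `τ * h` and `1 / τ` lie below `δ`. The first entry makes the total error at most `2 * M *
  -- δ ≤ κ / 2`; the second provides the smallness of `τ * h * K` used throughout.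
  set δ := min (κ / (4 * M)) (1 / (16 * (k + 1) * K)) with hδ
  have hkK : (1 : ℝ) ≤ (k + 1) * K :=
    one_le_mul_of_one_le_of_one_le (by linarith [(Nat.cast_nonneg k : (0 : ℝ) ≤ k)]) hK
  have hδ0 : 0 < δ := lt_min (by positivity) (by positivity)
  have hδ2 : δ * (16 * ((k + 1) * K)) ≤ 1 := by
    rw [← le_div_iff₀ (by positivity), ← mul_assoc]; exact min_le_right _ _
  have hδ16 : δ ≤ 1 / 16 := by nlinarith
  have hδM : 4 * M * δ ≤ κ := by
    have := min_le_left (κ / (4 * M)) (1 / (16 * (k + 1) * K))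
    rw [← hδ, le_div_iff₀ (by positivity)] at this
    linarith
  -- The price of passing from the energy of `f` back to the three norms of `u`.
  set N := (1 + 3456 * k * K ^ 2 + 93312 * k * K ^ 4 : ℝ) with hN
  refine ⟨δ, 1 + N * (4 / κ), hδ0, by linarith, by
    have : 0 < N * (4 / κ) := by positivity
    linarith, ?_⟩
  intro X _ e h τ φ a H w s u D hh hτδ hσδ hA hs
  have hτ : 0 < τ := (inv_pos.2 hδ0).trans hτδ
  have hσ : 0 < τ * h := mul_pos hτ hh
  have hτ' : 1 < τ * δ := by rwa [inv_eq_one_div, div_lt_iff₀ hδ0] at hτδ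
  have hhσ : 16 * h ≤ τ * h := by nlinarith
  have hσ1 : τ * h ≤ 1 := by linarith
  have hKk : K ≤ (k + 1) * K :=
    le_mul_of_one_le_left (by linarith) (by linarith [(Nat.cast_nonneg k : (0 : ℝ) ≤ k)])
  have hkk : (k : ℝ) ≤ (k + 1) * K := by nlinarith [(Nat.cast_nonneg k : (0 : ℝ) ≤ k)]
  have h16 : 16 * ((k + 1) * K) * (τ * h) ≤ 1 := by nlinarith
  have hσK16 : 16 * K * (τ * h) ≤ 1 := by nlinarith
  have hσk : 8 * (k : ℝ) ^ 2 * (τ * h * K) ^ 4 ≤ 1 := by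
    have t1 : (k : ℝ) * (τ * h * K) ≤ 1 / 16 := by nlinarith
    have t2 : τ * h * K ≤ 1 := by linarith
    calc 8 * (k : ℝ) ^ 2 * (τ * h * K) ^ 4
        = 8 * (k * (τ * h * K)) ^ 2 * (τ * h * K) ^ 2 := by ring
      _ ≤ 8 * (1 / 16) ^ 2 * 1 ^ 2 := by gcongr
      _ ≤ 1 := by norm_num
  set f : X → ℝ := fun y => exp (τ * φ y) * u y with hf
  have hu : ∀ x, f x ≠ 0 → u x ≠ 0 := fun x => right_ne_zero_of_mul
  have hs' : Padded e s 4 f := hs.of_imp fun x hx => by simp [hf, hx]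
  -- A forward difference of `f` can be nonzero only where `u` is nonzero at one of its two
  -- endpoints, so pseudoconvexity is needed only there.
  have main := D.carlemanEnergy_le_leading (ε := ε) hs'.of_succ hh hhσ hK hσ hσ1 (by linarith) hσk
    hε fun x hx => hA x (by
      by_cases h0 : u x = 0
      · right
        obtain h1 | ⟨i, h1⟩ := hx
        · exact absurd h0 (hu x h1)
        · refine ⟨i, hu _ fun h2 => h1 ?_⟩
          simp only [fwd, h2, zero_sub, neg_eq_zero]
          simp [hf, h0]
      · exact Or.inl h0)
  have lead := D.sum_leading_sq_le hs'.of_succ.of_succ.of_succ hh (by linarith) hK hτ (by linarith)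
  have first := fun j => D.sum_sym_sq_le hs'.of_succ.of_succ hh (by linarith) hK hτ (by linarith) j
  have second := fun j => D.sum_sym_sym_sq_le hs' hh hK hτ (by linarith) (by linarith) j
  simp only [← hf] at first second
  have conj : ∀ x, conjLap e (fun y => τ * φ y) f x = exp (τ * φ x) * ∑ j, lap (e j) u x :=
    fun x => conjLap_exp_mul (fun y => τ * φ y) u x
  simp only [conj] at lead
  set L := ∑ x ∈ s, (exp (τ * φ x) * ∑ j, lap (e j) u x) ^ 2
  have hL : 0 ≤ L := sum_nonneg fun _ _ => sq_nonneg _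
  rw [← hκ] at main
  have E0 := energy₀_nonneg (s := s) (f := f)
  have E1 := energy₁_nonneg (e := e) (s := s) (f := f)
  have E2 := energy₂_nonneg (e := e) (s := s) (f := f)
  have hR0 := carlemanEnergy_nonneg (e := e) (s := s) (f := f) hσ
  have hR : carlemanEnergy e s (τ * h) f = (τ * h) ^ 3 * energy₀ s f + τ * h * energy₁ e s f
      + (τ * h)⁻¹ * energy₂ e s f := rfl
  set R := carlemanEnergy e s (τ * h) f
  set E₀ := energy₀ s f
  set E₁ := energy₁ e s f
  set E₂ := energy₂ e s f
  set σ := τ * h with hσdef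
  have hdiv : h / σ ≤ δ := by
    rw [hσdef, div_le_iff₀ hσ]; nlinarith
  have n0 : 0 ≤ σ ^ 3 * E₀ := by positivity
  have n1 : 0 ≤ σ * E₁ := by positivity
  have n2 : 0 ≤ σ⁻¹ * E₂ := by positivity
  have c1 : (σ * h) ^ 2 * E₀ ≤ h * (σ + h / σ) * R := by
    have : (σ * h) ^ 2 * E₀ = h * (h / σ) * (σ ^ 3 * E₀) := by field_simp
    rw [this]
    gcongr <;> linarith
  have c2 : 2592 * (k : ℝ) ^ 2 * K ^ 2 * ((σ * h) ^ 2 * E₀)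
      ≤ 2592 * (k : ℝ) ^ 2 * K ^ 5 * (h * (σ + h / σ) * R) := by
    gcongr
    linarith
  have c3 : h * (κ - M * (σ + h / σ)) * R ≤ 2 * L := by
    rw [hM]; linarith
  have c4 : κ / 2 ≤ κ - M * (σ + h / σ) := by nlinarith
  have c5 : h * R ≤ 4 / κ * L := by
    have : h * (κ / 2) * R ≤ h * (κ - M * (σ + h / σ)) * R := by gcongr
    rw [div_mul_eq_mul_div, le_div_iff₀ hκ0]
    linarith
  have c6 : σ * ∑ j, ∑ x ∈ s, (exp (τ * φ x) * sym (e j) u x) ^ 2 ≤ 3456 * k * K ^ 2 * R := by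
    have := sum_le_card_nsmul univ (fun j => ∑ x ∈ s, (exp (τ * φ x) * sym (e j) u x) ^ 2) _
      fun j _ => first j
    rw [card_univ, Fintype.card_fin, nsmul_eq_mul] at this
    calc _ ≤ σ * (k * (3456 * K ^ 2 * (E₁ + σ ^ 2 * E₀))) := by gcongr
      _ = 3456 * k * K ^ 2 * (σ ^ 3 * E₀ + σ * E₁) := by ring
      _ ≤ _ := by gcongr; linarith
  have c7 : σ⁻¹ * ∑ j, ∑ x ∈ s, (exp (τ * φ x) * sym (e j) (sym (e j) u) x) ^ 2
      ≤ 93312 * k * K ^ 4 * R := by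
    have := sum_le_card_nsmul univ
      (fun j => ∑ x ∈ s, (exp (τ * φ x) * sym (e j) (sym (e j) u) x) ^ 2) _ fun j _ => second j
    rw [card_univ, Fintype.card_fin, nsmul_eq_mul] at this
    calc _ ≤ σ⁻¹ * (k * (93312 * K ^ 4 * (E₂ + σ ^ 2 * E₁ + σ ^ 4 * E₀))) := by gcongr
      _ = 93312 * k * K ^ 4 * R := by rw [hR]; field_simp; ring
  have c8 : σ ^ 3 * ∑ x ∈ s, (exp (τ * φ x) * u x) ^ 2 ≤ R := by
    change σ ^ 3 * E₀ ≤ R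
    linarith
  calc _ ≤ h * (R + 3456 * k * K ^ 2 * R + 93312 * k * K ^ 4 * R) := by gcongr
    _ = N * (h * R) := by ring
    _ ≤ N * (4 / κ * L) := by gcongr
    _ ≤ _ := by linarith

end Conjugation

open Filter Topology
open scoped ContDiff

/-! ### Radial weights for the norm attached to a frame. -/

section Frame

variable {E : Type*} [NormedAddCommGroup E] [NormedSpace ℝ E]

/-- Compact support makes the derivative globally Lipschitz, so a single constant serves all base
points and all steps. -/
theorem exists_taylor_bound {F : E → ℝ} (hF : ContDiff ℝ ∞ F) (hc : HasCompactSupport F) :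
    ∃ K : ℝ, 0 ≤ K ∧ ∀ x v, |F (x + v) - F x - fderiv ℝ F x v| ≤ K * ‖v‖ ^ 2 := by
  obtain ⟨K, hK⟩ := ContDiff.lipschitzWith_of_hasCompactSupport (hc.fderiv ℝ)
    (hF.fderiv_right (m := 1) (by norm_cast)) one_ne_zero
  refine ⟨K, K.2, fun x v => ?_⟩
  have := (convex_segment x (x + v)).norm_image_sub_le_of_norm_hasFDerivWithin_le'
    (f := F) (f' := fderiv ℝ F) (φ := fderiv ℝ F x) (C := K * ‖v‖) (x := x) (y := x + v)
    (fun y _ => ((hF.differentiable (by simp)) y).hasFDerivAt.hasFDerivWithinAt)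
    (fun y hy => ?_) (left_mem_segment ℝ _ _) (right_mem_segment ℝ _ _)
  · rw [add_sub_cancel_left] at this
    calc _ ≤ K * ‖v‖ * ‖v‖ := this
      _ = _ := by ring
  · refine (hK.norm_sub_le y x).trans ?_
    gcongr
    have := norm_sub_le_of_mem_segment hy
    simpa using this

theorem exists_lipschitz_bound {F : E → ℝ} (hF : ContDiff ℝ ∞ F) (hc : HasCompactSupport F) :
    ∃ K : ℝ, 0 ≤ K ∧ ∀ x v, |F (x + v) - F x| ≤ K * ‖v‖ := by
  obtain ⟨K, hK⟩ := ContDiff.lipschitzWith_of_hasCompactSupport hc hF (by simp)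
  refine ⟨K, K.2, fun x v => ?_⟩
  simpa using hK.norm_sub_le (x + v) x

variable {k : ℕ}

/-- The quadratic form `∑ j, b j ^ 2`. -/
def quad (b : Fin k → E →L[ℝ] ℝ) (x : E) : ℝ := ∑ j, b j x ^ 2

/-- A symmetric Parseval-type frame: `x = ∑ j, b j x • e j` and `b i (e j) = b j (e i)`. -/
structure IsFrame (e : Fin k → E) (b : Fin k → E →L[ℝ] ℝ) : Prop where
  sum_smul : ∀ x, ∑ j, b j x • e j = x
  symm : ∀ i j, b i (e j) = b j (e i)

variable {e : Fin k → E} {b : Fin k → E →L[ℝ] ℝ}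

theorem quad_nonneg (b : Fin k → E →L[ℝ] ℝ) (x : E) : 0 ≤ quad b x :=
  sum_nonneg fun _ _ => sq_nonneg _

/-- The symmetric matrix `b i (e j)` fixes the vector `(b j x)`, being the orthogonal projection
onto the range of `b`. Consequently the derivative of `quad b` along `e i` is `2 * b i x`. -/
theorem IsFrame.sum_mul_apply (hb : IsFrame e b) (x : E) (i : Fin k) :
    ∑ j, b j x * b j (e i) = b i x := by
  conv_rhs => rw [← hb.sum_smul x, map_sum]
  exact sum_congr rfl fun j _ => by rw [map_smul, smul_eq_mul, hb.symm]

theorem IsFrame.sum_mul_sum (hb : IsFrame e b) (x : E) (ξ : Fin k → ℝ) :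
    ∑ j, b j x * b j (∑ i, ξ i • e i) = ∑ i, ξ i * b i x := by
  simp only [map_sum, map_smul, smul_eq_mul, mul_sum]
  rw [sum_comm]
  refine sum_congr rfl fun i _ => ?_
  rw [← hb.sum_mul_apply x i, mul_sum]
  exact sum_congr rfl fun j _ => by ring

/-- Bessel's inequality: `(b i η)` is the orthogonal projection of `ξ`, and the squared distance
between them is the difference of the two sides. -/
theorem IsFrame.quad_sum_le (hb : IsFrame e b) (ξ : Fin k → ℝ) :
    quad b (∑ i, ξ i • e i) ≤ ∑ i, ξ i ^ 2 := by
  set η := ∑ i, ξ i • e i with hη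
  have h1 : ∑ i, ξ i * b i η = quad b η := by
    rw [← hb.sum_mul_sum η ξ, ← hη]
    exact sum_congr rfl fun j _ => by ring
  have h2 : 0 ≤ ∑ i, (ξ i - b i η) ^ 2 := sum_nonneg fun _ _ => sq_nonneg _
  have h3 : ∑ i, (ξ i - b i η) ^ 2 = ∑ i, ξ i ^ 2 - 2 * ∑ i, ξ i * b i η + quad b η := by
    rw [quad, mul_sum, ← sum_sub_distrib, ← sum_add_distrib]
    exact sum_congr rfl fun j _ => by ring
  rw [h3, h1] at h2
  linarith

theorem contDiff_quad (b : Fin k → E →L[ℝ] ℝ) : ContDiff ℝ ∞ (quad b) := by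
  unfold quad; fun_prop

theorem hasFDerivAt_quad (b : Fin k → E →L[ℝ] ℝ) (x : E) :
    HasFDerivAt (quad b) (∑ j, (2 * b j x) • b j) x := by
  unfold quad
  refine HasFDerivAt.fun_sum fun j _ => ?_
  simpa using (b j).hasFDerivAt.pow 2

theorem IsFrame.isBounded_quad_le (hb : IsFrame e b) (R : ℝ) :
    Bornology.IsBounded {x | quad b x ≤ R} := by
  refine isBounded_iff_forall_norm_le.2 ⟨∑ j, (R + 1) * ‖e j‖, fun x hx => ?_⟩
  conv_lhs => rw [← hb.sum_smul x]
  refine (norm_sum_le _ _).trans (sum_le_sum fun j _ => ?_)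
  rw [norm_smul]
  gcongr
  have h1 : b j x ^ 2 ≤ R :=
    (single_le_sum (f := fun j => b j x ^ 2) (fun _ _ => sq_nonneg _) (mem_univ j)).trans hx
  rw [Real.norm_eq_abs, ← abs_of_nonneg (by nlinarith [sq_nonneg (b j x)] : 0 ≤ R + 1)]
  rw [← sq_le_sq]
  nlinarith [sq_nonneg (b j x)]

theorem IsFrame.hasCompactSupport [FiniteDimensional ℝ E] (hb : IsFrame e b) {A : ℝ → ℝ} (hA : HasCompactSupport A)
    (P : E → ℝ) : HasCompactSupport fun x => A (quad b x) * P x := by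
  obtain ⟨R, hR⟩ := hA.isCompact.isBounded.subset_closedBall 0
  refine HasCompactSupport.intro (K := {x | quad b x ≤ R})
    (Metric.isCompact_of_isClosed_isBounded
      (isClosed_le (contDiff_quad b).continuous continuous_const) (hb.isBounded_quad_le R)) ?_
  intro x hx
  have : quad b x ∉ tsupport A := fun h => hx (by
    have := hR h
    rw [Metric.mem_closedBall, dist_zero_right, Real.norm_eq_abs] at this
    exact (le_abs_self _).trans this)
  rw [image_eq_zero_of_notMem_tsupport this, zero_mul]

/-- The gradient of `G ∘ quad b` along the frame. -/
noncomputable def radialGrad (b : Fin k → E →L[ℝ] ℝ) (G : ℝ → ℝ) (j : Fin k) (x : E) : ℝ :=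
  deriv G (quad b x) * (2 * b j x)

/-- The Hessian of `G ∘ quad b` along the frame. -/
noncomputable def radialHess (e : Fin k → E) (b : Fin k → E →L[ℝ] ℝ) (G : ℝ → ℝ) (i j : Fin k)
    (x : E) : ℝ :=
  deriv G (quad b x) * (2 * b j (e i)) + deriv (deriv G) (quad b x) * (4 * (b i x * b j x))

/-- The multiplier compensating the indefinite part of the Hessian. -/
noncomputable def radialMult (e : Fin k → E) (b : Fin k → E →L[ℝ] ℝ) (G : ℝ → ℝ) (ε : ℝ)
    (x : E) : ℝ :=
  deriv G (quad b x) * 4 - ∑ j, radialHess e b G j j x - ε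

theorem IsFrame.fderiv_radial (hb : IsFrame e b) {A : ℝ → ℝ} (hA : ContDiff ℝ ∞ A)
    {P : E → ℝ} {P' : E →L[ℝ] ℝ} {x : E} (hP : HasFDerivAt P P' x) (i : Fin k) :
    fderiv ℝ (fun x => A (quad b x) * P x) x (e i)
      = A (quad b x) * P' (e i) + deriv A (quad b x) * (2 * b i x) * P x := by
  have h1 : HasDerivAt A (deriv A (quad b x)) (quad b x) :=
    ((hA.differentiable (by simp)) _).hasDerivAt
  have h2 := (h1.comp_hasFDerivAt x (hasFDerivAt_quad b x)).mul hP
  have h3 : fderiv ℝ (fun x => A (quad b x) * P x) x = _ := h2.fderiv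
  rw [h3]
  have h4 : ∑ j, 2 * b j x * b j (e i) = 2 * b i x := by
    rw [← hb.sum_mul_apply x i, mul_sum]
    exact sum_congr rfl fun j _ => by ring
  simp only [_root_.add_apply, _root_.smul_apply, _root_.sum_apply,
    smul_eq_mul, h4, Function.comp]
  ring

/-- All coefficients are smooth functions on `E`, compactly supported up to an additive constant.
Hence `K` depends neither on `h` nor on the group that is mapped into `E`. -/
theorem IsFrame.exists_isWeight [FiniteDimensional ℝ E] (hb : IsFrame e b) {G : ℝ → ℝ} (hG : ContDiff ℝ ∞ G)
    (hGc : HasCompactSupport G) (ε : ℝ) :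
    ∃ K : ℝ, 1 ≤ K ∧ ∀ {X : Type} [AddCommGroup X] (p : X → E) (v : Fin k → X) (h : ℝ),
      0 < h → (∀ x j, p (x + v j) = p x + h • e j) →
      IsWeight v K h (fun x => G (quad b (p x))) (fun j x => radialGrad b G j (p x))
        (fun i j x => radialHess e b G i j (p x)) (fun x => radialMult e b G ε (p x)) := by
  have hG1 : ContDiff ℝ ∞ (deriv G) := (contDiff_infty_iff_deriv.1 hG).2
  have hG2 : ContDiff ℝ ∞ (deriv (deriv G)) := (contDiff_infty_iff_deriv.1 hG1).2
  have hQ := contDiff_quad b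
  have cφ : ContDiff ℝ ∞ fun x => G (quad b x) * 1 :=
    (hG.comp hQ).mul contDiff_const
  have ca : ∀ j, ContDiff ℝ ∞ (radialGrad b G j) := fun j =>
    (hG1.comp hQ).mul (by fun_prop)
  have cH : ∀ i j, ContDiff ℝ ∞ (radialHess e b G i j) := fun i j =>
    ((hG1.comp hQ).mul (by fun_prop)).add ((hG2.comp hQ).mul (by fun_prop))
  -- The constant `-ε` of `radialMult` is left out because it is not compactly supported. It
  -- disappears from differences and adds `|ε|` to the bound.
  have cw : ContDiff ℝ ∞ fun x => deriv G (quad b x) * 4 - ∑ j, radialHess e b G j j x :=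
    ((hG1.comp hQ).mul contDiff_const).sub (ContDiff.sum fun j _ => cH j j)
  have sφ : HasCompactSupport fun x => G (quad b x) * 1 := hb.hasCompactSupport hGc _
  have sa : ∀ j, HasCompactSupport (radialGrad b G j) := fun j =>
    hb.hasCompactSupport hGc.deriv _
  have sH : ∀ i j, HasCompactSupport (radialHess e b G i j) := fun i j =>
    (hb.hasCompactSupport hGc.deriv fun _ => 2 * b j (e i)).add
      (hb.hasCompactSupport hGc.deriv.deriv fun x => 4 * (b i x * b j x))
  have sw : HasCompactSupport fun x =>
      deriv G (quad b x) * 4 - ∑ j, radialHess e b G j j x := by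
    have h1 : HasCompactSupport fun x => ∑ j, radialHess e b G j j x := by
      have : (fun x => ∑ j, radialHess e b G j j x) = fun x =>
          deriv G (quad b x) * (∑ j, 2 * b j (e j))
            + deriv (deriv G) (quad b x) * (∑ j, 4 * (b j x * b j x)) := by
        funext x
        simp only [radialHess, sum_add_distrib, mul_sum]
      rw [this]
      exact (hb.hasCompactSupport hGc.deriv fun _ => ∑ j, 2 * b j (e j)).add
        (hb.hasCompactSupport hGc.deriv.deriv fun x => ∑ j, 4 * (b j x * b j x))
    exact (hb.hasCompactSupport hGc.deriv fun _ => 4).sub h1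
  obtain ⟨K₁, hK₁, tφ⟩ := exists_taylor_bound cφ sφ
  choose K₂ hK₂ ta using fun j => exists_taylor_bound (ca j) (sa j)
  choose K₃ ba using fun j => (ca j).continuous.bounded_above_of_compact_support (sa j)
  choose K₄ bH using fun i j => (cH i j).continuous.bounded_above_of_compact_support (sH i j)
  obtain ⟨K₅, bw⟩ := cw.continuous.bounded_above_of_compact_support sw
  obtain ⟨K₆, hK₆, lw⟩ := exists_lipschitz_bound cw sw
  have ev : ∀ᶠ K : ℝ in atTop, 1 ≤ K ∧ (∀ j, K₁ * ‖e j‖ ^ 2 ≤ K) ∧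
      (∀ i j, K₂ j * ‖e i‖ ^ 2 ≤ K) ∧ (∀ j, K₃ j ≤ K) ∧ (∀ i j, K₄ i j ≤ K) ∧
      K₅ + |ε| ≤ K ∧ ∀ j, K₆ * ‖e j‖ ≤ K := by
    simp only [eventually_and, eventually_all, eventually_ge_atTop, true_and, implies_true]
  obtain ⟨K, k0, k1, k2, k3, k4, k5, k6⟩ := ev.exists
  refine ⟨K, k0, fun {X} _ p v h hh hp => ?_⟩
  have hn : ∀ j, ‖h • e j‖ = h * ‖e j‖ := fun j => by
    rw [norm_smul, Real.norm_eq_abs, abs_of_pos hh]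
  refine ⟨fun j x => ?_, fun i j x => ?_, fun j x => (ba j _).trans (k3 j),
    fun i j x => (bH i j _).trans (k4 i j), fun x => ?_, fun j x => ?_⟩
  · have := tφ (p x) (h • e j)
    rw [map_smul, hb.fderiv_radial hG (hasFDerivAt_const (1 : ℝ) (p x)) j, hn] at this
    simp only [mul_one, zero_apply, mul_zero, zero_add, smul_eq_mul] at this
    simp only [fwd, hp, radialGrad]
    refine this.trans ?_
    calc K₁ * (h * ‖e j‖) ^ 2 = K₁ * ‖e j‖ ^ 2 * h ^ 2 := by ring
      _ ≤ _ := by gcongr; exact k1 j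
  · have := ta j (p x) (h • e i)
    have hd : fderiv ℝ (radialGrad b G j) (p x) (e i) = radialHess e b G i j (p x) := by
      have h2 : HasFDerivAt (fun x => 2 * b j x) ((2 : ℝ) • b j) (p x) :=
        (b j).hasFDerivAt.const_mul 2
      refine (hb.fderiv_radial hG1 h2 i).trans ?_
      simp only [radialHess, _root_.smul_apply, smul_eq_mul]
      ring
    rw [map_smul, hd, hn, smul_eq_mul] at this
    simp only [fwd, hp]
    refine this.trans ?_
    calc K₂ j * (h * ‖e i‖) ^ 2 = K₂ j * ‖e i‖ ^ 2 * h ^ 2 := by ring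
      _ ≤ _ := by gcongr; exact k2 i j
  · refine (abs_sub _ _).trans ((add_le_add_left (bw _) _).trans k5)
  · have := lw (p x) (h • e j)
    rw [hn] at this
    simp only [fwd, hp, radialMult]
    rw [sub_sub_sub_cancel_right]
    refine this.trans ?_
    calc K₆ * (h * ‖e j‖) = K₆ * ‖e j‖ * h := by ring
      _ ≤ _ := by gcongr; exact k6 j

/-- Pseudoconvexity of a radial weight `ψ (log r)`, `r ^ 2 = quad b x`, with `ψ' = p < 0` and
`ψ'' = q > 0`. -/
theorem IsFrame.pseudoconvexAt (hb : IsFrame e b) {G : ℝ → ℝ} {x : E} {ε p q p₀ q₀ : ℝ}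
    (hs0 : 0 < quad b x) (hs : quad b x ≤ 16) (hp₀ : 0 < p₀) (hq₀ : 0 < q₀) (hp : p ≤ -p₀)
    (hq : q₀ ≤ q) (hG1 : deriv G (quad b x) = p / (2 * quad b x))
    (hG2 : deriv (deriv G) (quad b x) = (q - 2 * p) / (4 * quad b x ^ 2))
    (hε1 : 16 * ε ≤ q₀) (hε2 : 256 * ε ≤ p₀ ^ 2 * q₀) :
    PseudoconvexAt ε (radialGrad b G) (radialHess e b G) (radialMult e b G ε) x := by
  set s := quad b x with hsdef
  have hsum : ∑ i, b i x ^ 2 = s := rfl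
  constructor
  · intro ξ
    have h1 : ∑ i, ∑ j, radialHess e b G i j x * ξ i * ξ j
        = 2 * deriv G s * quad b (∑ i, ξ i • e i)
          + 4 * deriv (deriv G) s * (∑ i, ξ i * b i x) ^ 2 := by
      have q1 : quad b (∑ i, ξ i • e i) = ∑ i, ∑ j, b j (e i) * ξ i * ξ j := by
        have := hb.sum_mul_sum (∑ i, ξ i • e i) ξ
        rw [quad]
        simp only [sq]
        rw [this, sum_comm]
        simp only [map_sum, map_smul, smul_eq_mul, mul_sum]
        exact sum_congr rfl fun i _ => sum_congr rfl fun j _ => by ring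
      rw [q1, sq (∑ i, ξ i * b i x), Finset.sum_mul_sum]
      simp only [mul_sum, ← sum_add_distrib, radialHess, ← hsdef]
      exact sum_congr rfl fun i _ => sum_congr rfl fun j _ => by ring
    -- The multiplier is designed for this: the trace cancels, and `-8 * deriv G s * ∑ i, ξ i ^ 2`
    -- dominates the negative part `8 * deriv G s * quad b (∑ i, ξ i • e i)` of the Hessian by
    -- Bessel's inequality, since `deriv G s ≤ 0`.
    have h2 : ∑ j, radialHess e b G j j x + radialMult e b G ε x = 4 * deriv G s - ε := by
      simp only [radialMult]; ring
    rw [h1, h2]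
    have h3 : 0 ≤ deriv (deriv G) s * (∑ i, ξ i * b i x) ^ 2 := by
      rw [hG2]
      have : 0 ≤ q - 2 * p := by linarith
      positivity
    have h4 : deriv G s ≤ 0 := by
      rw [hG1]
      exact div_nonpos_of_nonpos_of_nonneg (by linarith) (by positivity)
    have h5 := mul_le_mul_of_nonpos_left (hb.quad_sum_le ξ) h4
    linarith
  · have h1 : ∑ i, radialGrad b G i x ^ 2 = 4 * deriv G s ^ 2 * s := by
      have : ∀ i, radialGrad b G i x ^ 2 = 4 * deriv G s ^ 2 * b i x ^ 2 := fun i => by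
        simp only [radialGrad, ← hsdef]; ring
      simp only [this, ← mul_sum, hsum]
    have h2 : ∑ i, ∑ j, (2 * radialGrad b G i x * radialGrad b G j x * radialHess e b G j i x
        + radialGrad b G i x ^ 2 * radialHess e b G j j x)
        = 8 * deriv G s ^ 2 * (2 * deriv G s * s + 4 * deriv (deriv G) s * s ^ 2)
          + (∑ i, radialGrad b G i x ^ 2) * ∑ j, radialHess e b G j j x := by
      have q1 : s = ∑ i, ∑ j, b i x * b j x * b i (e j) := by
        rw [sum_comm]
        conv_lhs => rw [← hsum]
        refine sum_congr rfl fun j _ => ?_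
        rw [sq, ← hb.sum_mul_apply x j, sum_mul]
        rw [hb.sum_mul_apply x j]
        exact sum_congr rfl fun i _ => by ring
      have q2 : s ^ 2 = ∑ i, ∑ j, b i x ^ 2 * b j x ^ 2 := by
        rw [sq, ← hsum, Finset.sum_mul_sum]
      have q3 : 8 * deriv G s ^ 2 * (2 * deriv G s * s + 4 * deriv (deriv G) s * s ^ 2)
          = 8 * deriv G s ^ 2 * (2 * deriv G s * (∑ i, ∑ j, b i x * b j x * b i (e j))
            + 4 * deriv (deriv G) s * ∑ i, ∑ j, b i x ^ 2 * b j x ^ 2) := by rw [← q1, ← q2]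
      rw [q3, Finset.sum_mul_sum]
      simp only [mul_sum, ← sum_add_distrib]
      refine sum_congr rfl fun i _ => sum_congr rfl fun j _ => ?_
      simp only [radialGrad, radialHess, ← hsdef]
      ring
    -- The trace cancels again, and `2G's + 4G''s² + 2G's = p + (q - 2p) + p = q`. Positivity thus
    -- rests on strict convexity in `log r`; for the pure logarithm `q` would vanish.
    have h3 : 2 * ∑ i, ∑ j, (2 * radialGrad b G i x * radialGrad b G j x * radialHess e b G j i x
        + radialGrad b G i x ^ 2 * radialHess e b G j j x)
        + 2 * radialMult e b G ε x * ∑ i, radialGrad b G i x ^ 2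
        = 2 * p ^ 2 / s * (2 * q / s - ε) := by
      rw [h2, h1]
      simp only [radialMult, ← hsdef, hG1, hG2]
      field_simp
      ring
    rw [h3]
    have h4 : q₀ / 16 ≤ q / s := div_le_div₀ (by linarith) hq hs0 hs
    have h5 : p₀ ^ 2 / 16 ≤ p ^ 2 / s := by
      refine div_le_div₀ (by positivity) ?_ hs0 hs
      nlinarith
    have h6 : q₀ / 16 ≤ 2 * q / s - ε := by
      rw [mul_div_assoc]; linarith
    calc 2 * ε ≤ 2 * (p₀ ^ 2 / 16) * (q₀ / 16) := by linarith
      _ ≤ 2 * (p ^ 2 / s) * (2 * q / s - ε) := by gcongr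
      _ = _ := by ring

end Frame

open OnePointPeriodicGraph
open scoped Matrix

/-! ### The explicit radial profile as a function of the squared radius. -/

section Profile

theorem hasDerivAt_half_log {s : ℝ} (hs : 0 < s) :
    HasDerivAt (fun r => log r / 2) (1 / (2 * s)) s := by
  refine ((hasDerivAt_log hs.ne').div_const 2).congr_deriv ?_
  field_simp

/-- In the variable `ρ = log r = log s / 2` the bracket multiplying `c` is a primitive of `arctan`,
and `dρ/ds = 1 / (2 * s)`. -/
theorem hasDerivAt_carlemanPhi_sqrt (c : ℝ) {s : ℝ} (hs : 0 < s) :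
    HasDerivAt (fun r => carlemanPhi c √r)
      ((-1 + c * arctan (log s / 2)) / (2 * s)) s := by
  have e : (fun r => carlemanPhi c √r) =ᶠ[𝓝 s] fun r => -(log r / 2)
      + c * (log r / 2 * arctan (log r / 2) - 1 / 2 * log (1 + (log r / 2) ^ 2)) := by
    filter_upwards [lt_mem_nhds hs] with r hr
    rw [carlemanPhi, log_sqrt hr.le]
  have hl := hasDerivAt_half_log hs
  have hpos : 0 < 1 + (log s / 2) ^ 2 := by positivity
  have h1 := hl.neg.add (((hl.mul hl.arctan).sub
    (((hl.pow 2).const_add 1).log hpos.ne' |>.const_mul (1 / 2))).const_mul c)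
  refine (h1.congr_of_eventuallyEq e).congr_deriv ?_
  simp only [Pi.pow_apply]
  field_simp
  ring

theorem hasDerivAt_deriv_carlemanPhi_sqrt (c : ℝ) {s : ℝ} (hs : 0 < s) :
    HasDerivAt (fun r => (-1 + c * arctan (log r / 2)) / (2 * r))
      ((c / (1 + (log s / 2) ^ 2) - 2 * (-1 + c * arctan (log s / 2))) / (4 * s ^ 2)) s := by
  have hl := hasDerivAt_half_log hs
  have hpos : 0 < 1 + (log s / 2) ^ 2 := by positivity
  have h2 : HasDerivAt (fun r : ℝ => 2 * r) (2 * 1) s := (hasDerivAt_id s).const_mul 2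
  have h1 := ((hl.arctan.const_mul c).const_add (-1)).div h2 (by positivity)
  refine h1.congr_deriv ?_
  field_simp
  ring

theorem contDiffAt_carlemanPhi_sqrt (c : ℝ) {s : ℝ} (hs : 0 < s) :
    ContDiffAt ℝ ∞ (fun r => carlemanPhi c √r) s := by
  have hl : ContDiffAt ℝ ∞ (fun r => log √r) s :=
    (contDiffAt_log.2 (sqrt_pos.2 hs).ne').comp s (contDiffAt_sqrt hs.ne')
  have ha : ContDiffAt ℝ ∞ (fun r => arctan (log √r)) s := contDiff_arctan.contDiffAt.comp s hl
  have hq : ContDiffAt ℝ ∞ (fun r => log (1 + log √r ^ 2)) s :=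
    (contDiffAt_log.2 (by positivity)).comp s (contDiffAt_const.add (hl.pow 2))
  exact hl.neg.add (contDiffAt_const.mul ((hl.mul ha).sub (contDiffAt_const.mul hq)))

/-- The radial weight as a function of the squared radius, cut off smoothly. -/
theorem exists_profile (c : ℝ) : ∃ G : ℝ → ℝ, ContDiff ℝ ∞ G ∧ HasCompactSupport G ∧
    ∀ s, 1 / 32 < s → s < 20 → G s = carlemanPhi c √s ∧
      deriv G s = (-1 + c * arctan (log s / 2)) / (2 * s) ∧
      deriv (deriv G) s
        = (c / (1 + (log s / 2) ^ 2) - 2 * (-1 + c * arctan (log s / 2))) / (4 * s ^ 2) := by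
  -- The bump equals `1` on `[1/64, 32 - 1/64]`, which contains the interval `(1/32, 20)`, and is
  -- supported in `s ≥ 1/128`, away from the singularity at the origin.
  let χ : ContDiffBump (16 : ℝ) := ⟨16 - 1 / 64, 16 - 1 / 128, by norm_num, by norm_num⟩
  have eqOn : ∀ s ∈ Set.Ioo (1 / 32 : ℝ) 20, χ s * carlemanPhi c √s = carlemanPhi c √s := by
    intro s hs
    rw [χ.one_of_mem_closedBall, one_mul]
    rw [Metric.mem_closedBall, Real.dist_eq, abs_le]
    constructor <;> simp only [χ] <;> linarith [hs.1, hs.2]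
  refine ⟨fun s => χ s * carlemanPhi c √s, ?_, χ.hasCompactSupport.mul_right, ?_⟩
  · rw [contDiff_iff_contDiffAt]
    intro s
    rcases lt_or_ge 0 s with hs | hs
    · exact χ.contDiffAt.mul (contDiffAt_carlemanPhi_sqrt c hs)
    · have : s ∉ tsupport χ := by
        rw [χ.tsupport_eq, Metric.mem_closedBall, Real.dist_eq, abs_le]
        intro h
        have := h.1
        simp only [χ] at this
        linarith
      have h0 : (fun s => χ s * carlemanPhi c √s) =ᶠ[𝓝 s] fun _ => 0 := by
        filter_upwards [(isClosed_tsupport χ).isOpen_compl.mem_nhds this] with r hr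
        rw [image_eq_zero_of_notMem_tsupport hr, zero_mul]
      exact contDiffAt_const.congr_of_eventuallyEq h0
  · intro s h1 h2
    have d1 : ∀ r ∈ Set.Ioo (1 / 32 : ℝ) 20, deriv (fun s => χ s * carlemanPhi c √s) r
        = (-1 + c * arctan (log r / 2)) / (2 * r) := by
      intro r hr
      have e : (fun s => χ s * carlemanPhi c √s) =ᶠ[𝓝 r] fun s => carlemanPhi c √s := by
        filter_upwards [Ioo_mem_nhds hr.1 hr.2] with t ht using eqOn t ht
      rw [e.deriv_eq]
      exact (hasDerivAt_carlemanPhi_sqrt c (by linarith [hr.1])).deriv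
    refine ⟨eqOn s ⟨h1, h2⟩, d1 s ⟨h1, h2⟩, ?_⟩
    have e : deriv (fun s => χ s * carlemanPhi c √s) =ᶠ[𝓝 s]
        fun r => (-1 + c * arctan (log r / 2)) / (2 * r) := by
      filter_upwards [Ioo_mem_nhds h1 h2] with t ht using d1 t ht
    rw [e.deriv_eq]
    exact (hasDerivAt_deriv_carlemanPhi_sqrt c (by linarith)).deriv

theorem profile_slope_le {c : ℝ} (hc : 0 < c) (t : ℝ) :
    -1 + c * arctan t ≤ -(1 - c * (π / 2)) := by
  have := mul_le_mul_of_nonneg_left (arctan_lt_pi_div_two t).le hc.le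
  linarith

/-- On this range `|log s| ≤ log 16 ≤ 4`, so the denominator is at most `1 + 2 ^ 2 = 5`. -/
theorem profile_curvature_ge {c s : ℝ} (hc : 0 < c) (h1 : 1 / 16 ≤ s) (h2 : s ≤ 16) :
    c / 5 ≤ c / (1 + (log s / 2) ^ 2) := by
  have hs : 0 < s := by linarith
  have hl4 : log 16 ≤ 4 := by
    have : (16 : ℝ) = 2 ^ 4 := by norm_num
    rw [this, log_pow]
    have := log_two_lt_d9
    push_cast
    linarith
  have hu : log s ≤ 4 := (log_le_log hs h2).trans hl4
  have hl : -4 ≤ log s := by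
    have := log_le_log (by norm_num) h1
    rw [one_div, log_inv] at this
    linarith
  gcongr
  nlinarith

end Profile

/-! ### The frame, the norm and the Laplacian of the periodic graph. -/

section Graph

variable {d k : ℕ} {Γ : OnePointPeriodicGraph d} {e : Fin k → Γ.lattice}

/-- Connectedness makes the edges span: a functional killing every `e j` is constant along walks,
hence vanishes on the whole lattice and so on the basis. -/
theorem eq_zero_of_dotProduct_eq_zero (he : Γ.IsEdgeSystem e) (x : Fin d → ℝ)
    (hx : ∀ j, (e j : Fin d → ℝ) ⬝ᵥ x = 0) : x = 0 := by
  have hwalk : ∀ a b : Γ.lattice, Γ.graph.Walk a b →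
      (a : Fin d → ℝ) ⬝ᵥ x = (b : Fin d → ℝ) ⬝ᵥ x := by
    intro a b p
    induction p with
    | nil => rfl
    | cons h _ ih =>
      rw [← ih]
      obtain ⟨j, hj | hj⟩ := (he.adj_iff _ _).1 h <;> simp [hj, hx, add_dotProduct, sub_dotProduct]
  have hv : ∀ i, Γ.v i ⬝ᵥ x = 0 := by
    intro i
    obtain ⟨p⟩ := Γ.connected.preconnected
      ⟨Γ.v i, AddSubgroup.subset_closure (Set.mem_range_self i)⟩ 0
    simpa using hwalk _ _ p
  have hall : ∀ y : Fin d → ℝ, y ⬝ᵥ x = 0 := by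
    intro y
    rw [← Γ.v.sum_repr y, sum_dotProduct]
    exact sum_eq_zero fun i _ => by rw [smul_dotProduct, hv, smul_zero]
  exact dotProduct_self_eq_zero.1 (hall x)

theorem isUnit_edgeMatrix (he : Γ.IsEdgeSystem e) :
    IsUnit ((edgeMatrix e)ᵀ * edgeMatrix e) := by
  rw [← Matrix.mulVec_injective_iff_isUnit]
  intro x y hxy
  rw [← sub_eq_zero]
  have h0 : ((edgeMatrix e)ᵀ * edgeMatrix e) *ᵥ (x - y) = 0 := by
    rw [Matrix.mulVec_sub]; exact sub_eq_zero.2 hxy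
  have h1 : edgeMatrix e *ᵥ (x - y) = 0 := by
    have : (x - y) ∈ LinearMap.ker ((edgeMatrix e)ᵀ * edgeMatrix e).mulVecLin := h0
    rw [Matrix.ker_mulVecLin_transpose_mul_self] at this
    exact this
  exact eq_zero_of_dotProduct_eq_zero he _ fun j => congrFun h1 j

/-- The coordinates dual to the edges. -/
noncomputable def dualCoord (e : Fin k → Γ.lattice) (j : Fin k) : (Fin d → ℝ) →L[ℝ] ℝ :=
  LinearMap.toContinuousLinearMap (LinearMap.proj j ∘ₗ
    (edgeMatrix e * ((edgeMatrix e)ᵀ * edgeMatrix e)⁻¹).mulVecLin)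

theorem dualCoord_apply (e : Fin k → Γ.lattice) (j : Fin k) (x : Fin d → ℝ) :
    dualCoord e j x = (edgeMatrix e *ᵥ (((edgeMatrix e)ᵀ * edgeMatrix e)⁻¹ *ᵥ x)) j := by
  rw [Matrix.mulVec_mulVec]; rfl

theorem mul_inv_mulVec (he : Γ.IsEdgeSystem e) (x : Fin d → ℝ) :
    (edgeMatrix e)ᵀ *ᵥ (edgeMatrix e *ᵥ (((edgeMatrix e)ᵀ * edgeMatrix e)⁻¹ *ᵥ x)) = x := by
  rw [Matrix.mulVec_mulVec, Matrix.mulVec_mulVec, Matrix.mul_nonsing_inv, Matrix.one_mulVec]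
  exact (Matrix.isUnit_iff_isUnit_det _).1 (isUnit_edgeMatrix he)

/-- These are the identities `Eᵀ E (Eᵀ E)⁻¹ = 1` and the symmetry of `E (Eᵀ E)⁻¹ Eᵀ`. -/
theorem isFrame_dualCoord (he : Γ.IsEdgeSystem e) :
    IsFrame (fun j => (e j : Fin d → ℝ)) (dualCoord e) := by
  refine ⟨fun x => ?_, fun i j => ?_⟩
  · conv_rhs => rw [← mul_inv_mulVec he x]
    rw [Matrix.mulVec_transpose, Matrix.vecMul_eq_sum]
    simp only [dualCoord_apply]
    rfl
  · simp only [dualCoord_apply]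
    have hsymm : (((edgeMatrix e)ᵀ * edgeMatrix e)⁻¹)ᵀ = ((edgeMatrix e)ᵀ * edgeMatrix e)⁻¹ := by
      rw [Matrix.transpose_nonsing_inv, Matrix.transpose_mul, Matrix.transpose_transpose]
    change (e i : Fin d → ℝ) ⬝ᵥ _ = (e j : Fin d → ℝ) ⬝ᵥ _
    rw [Matrix.dotProduct_mulVec, ← Matrix.mulVec_transpose, hsymm, dotProduct_comm]

theorem gNorm_eq (he : Γ.IsEdgeSystem e) (x : Fin d → ℝ) :
    gNorm e x = √(quad (dualCoord e) x) := by
  rw [gNorm]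
  congr 1
  have h1 : quad (dualCoord e) x
      = (edgeMatrix e *ᵥ (((edgeMatrix e)ᵀ * edgeMatrix e)⁻¹ *ᵥ x))
        ⬝ᵥ (edgeMatrix e *ᵥ (((edgeMatrix e)ᵀ * edgeMatrix e)⁻¹ *ᵥ x)) := by
    rw [quad, dotProduct]
    exact sum_congr rfl fun j _ => by rw [dualCoord_apply, sq]
  rw [h1]
  conv_rhs => rw [Matrix.dotProduct_mulVec, ← Matrix.mulVec_transpose, mul_inv_mulVec he]

variable {h : ℝ}

theorem coe_scale (x : Γ.lattice) : (Γ.scale h x : Fin d → ℝ) = h • (x : Fin d → ℝ) := rfl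

theorem scale_add (x y : Γ.lattice) : Γ.scale h (x + y) = Γ.scale h x + Γ.scale h y :=
  Subtype.ext (smul_add h (x : Fin d → ℝ) y)

theorem scale_sub (x y : Γ.lattice) : Γ.scale h (x - y) = Γ.scale h x - Γ.scale h y :=
  Subtype.ext (smul_sub h (x : Fin d → ℝ) y)

theorem exists_scale_eq (x : Γ.vertices h) : ∃ a, Γ.scale h a = x := by
  obtain ⟨x, a, ha, rfl⟩ := x
  exact ⟨⟨a, ha⟩, rfl⟩

theorem scale_injective (hh : h ≠ 0) : Function.Injective (Γ.scale h) := fun _ _ hxy =>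
  Subtype.ext (smul_right_injective _ hh (congrArg Subtype.val hxy))

/-- The neighbours of `x` are the `2k` points `x ± h e_j`. They are pairwise distinct by
`IsEdgeSystem`, so each is counted once. -/
theorem laplacian_eq (he : Γ.IsEdgeSystem e) (hh : h ≠ 0) (f : Γ.vertices h → ℝ)
    (x : Γ.vertices h) : Γ.laplacian h f x = ∑ j, lap (Γ.scale h (e j)) f x := by
  let g : Fin k ⊕ Fin k → Γ.vertices h :=
    Sum.elim (fun j => x + Γ.scale h (e j)) fun j => x - Γ.scale h (e j)
  have hneg : ∀ i j, Γ.scale h (e i) ≠ -Γ.scale h (e j) := by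
    intro i j hij
    have : Γ.scale h (-e j) = -Γ.scale h (e j) := by
      simpa [show Γ.scale h 0 = 0 from Subtype.ext (smul_zero h)] using
        scale_sub (h := h) 0 (e j)
    rw [← this] at hij
    exact he.ne_neg i j (scale_injective hh hij)
  have hg : Function.Injective g := by
    rintro (i | i) (j | j) hij
    · exact congrArg Sum.inl (he.injective (scale_injective hh (add_left_cancel hij)))
    · refine absurd ?_ (hneg i j)
      simpa [g, sub_eq_add_neg] using hij
    · refine absurd ?_ (hneg j i)
      simpa [g, sub_eq_add_neg] using hij.symm
    · exact congrArg Sum.inr (he.injective (scale_injective hh (sub_right_injective hij)))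
  have hset : {y | Γ.Adj h x y} = Set.range g := by
    ext y
    constructor
    · rintro ⟨a, b, hab, rfl, rfl⟩
      obtain ⟨j, rfl | rfl⟩ := (he.adj_iff _ _).1 hab
      · exact ⟨Sum.inl j, (scale_add _ _).symm⟩
      · exact ⟨Sum.inr j, (scale_sub _ _).symm⟩
    · obtain ⟨a, rfl⟩ := exists_scale_eq x
      rintro ⟨j | j, rfl⟩
      · exact ⟨a, a + e j, (he.adj_iff _ _).2 ⟨j, Or.inl rfl⟩, rfl, (scale_add _ _).symm⟩
      · exact ⟨a, a - e j, (he.adj_iff _ _).2 ⟨j, Or.inr rfl⟩, rfl, (scale_sub _ _).symm⟩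
  rw [laplacian, hset, finsum_mem_range hg, finsum_eq_sum_of_fintype, Fintype.sum_sum_type,
    ← sum_add_distrib]
  exact sum_congr rfl fun j _ => by simp only [g, lap, Sum.elim_inl, Sum.elim_inr]; ring

theorem finite_vertices_of_isBounded (hh : h ≠ 0) {s : Set (Fin d → ℝ)}
    (hs : Bornology.IsBounded s) : {x : Γ.vertices h | (x : Fin d → ℝ) ∈ s}.Finite := by
  have h1 : ((fun y : Fin d → ℝ => h⁻¹ • y) '' s
      ∩ Submodule.span ℤ (Set.range Γ.v)).Finite :=
    ZSpan.setFinite_inter Γ.v (hs.smul₀ h⁻¹)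
  refine (h1.image fun y => h • y).preimage (f := Subtype.val) Subtype.val_injective.injOn
    |>.subset ?_
  intro x hx
  obtain ⟨a, rfl⟩ := exists_scale_eq x
  refine ⟨(a : Fin d → ℝ), ⟨⟨_, hx, ?_⟩, ?_⟩, rfl⟩
  · change h⁻¹ • h • (a : Fin d → ℝ) = a
    rw [inv_smul_smul₀ hh]
  · have : (a : Fin d → ℝ) ∈ AddSubgroup.closure (Set.range Γ.v) := a.2
    rw [← Submodule.span_int_eq_addSubgroupClosure] at this
    exact this

end Graph

/-! ### Stability of annuli under small lattice steps. -/

section Perturbation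

variable {E : Type*} [NormedAddCommGroup E] [NormedSpace ℝ E] {k : ℕ}

theorem quad_smul (b : Fin k → E →L[ℝ] ℝ) (t : ℝ) (x : E) :
    quad b (t • x) = t ^ 2 * quad b x := by
  simp only [quad, map_smul, smul_eq_mul, mul_pow, mul_sum]

/-- The cross term obeys `2 h |b j x * b j v| ≤ h (b j x ^ 2 + b j v ^ 2)`, and `h ^ 2 ≤ h`. -/
theorem abs_quad_add_sub_le (b : Fin k → E →L[ℝ] ℝ) {h : ℝ} (hh : 0 < h) (hh1 : h ≤ 1) (x v : E) :
    |quad b (x + h • v) - quad b x| ≤ h * (quad b x + 2 * quad b v) := by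
  simp only [quad, ← sum_sub_distrib, mul_sum, ← sum_add_distrib]
  refine (abs_sum_le_sum_abs _ _).trans (sum_le_sum fun j _ => ?_)
  rw [map_add, map_smul, smul_eq_mul, abs_le]
  have h2 : h ^ 2 * b j v ^ 2 ≤ h * b j v ^ 2 := by
    gcongr; nlinarith
  constructor <;> nlinarith [mul_nonneg hh.le (sq_nonneg (b j x - b j v)),
    mul_nonneg hh.le (sq_nonneg (b j x + b j v)), sq_nonneg (h * b j v)]

theorem quad_bounds_of_near (b : Fin k → E →L[ℝ] ℝ) {h M : ℝ} (hh : 0 < h) (hh1 : h ≤ 1)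
    (hM : h * (4 + 2 * M) ≤ 1 / 8) {x y w : E} (hy : 1 / 4 < quad b y ∧ quad b y ≤ 4)
    (hw : quad b w ≤ M) (hxy : x = y + h • w) : 1 / 16 ≤ quad b x ∧ quad b x ≤ 16 := by
  have h3 := abs_quad_add_sub_le b hh hh1 y w
  have h4 : h * (quad b y + 2 * quad b w) ≤ h * (4 + 2 * M) :=
    mul_le_mul_of_nonneg_left (by linarith [hy.2]) hh.le
  rw [← hxy, abs_le] at h3
  constructor <;> linarith [h3.1, h3.2, hy.1, hy.2]

end Perturbation

end LatticeCarleman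

/-! ### Localisation and the Carleman estimate on the scaled graph. -/

open LatticeCarleman

set_option maxHeartbeats 1000000 in
theorem theorem3p1 {d k : ℕ} (Γ : OnePointPeriodicGraph d) (e : Fin k → Γ.lattice)
    (he : Γ.IsEdgeSystem e) (c : ℝ) (hc : 0 < c) (hc' : c < 2 / Real.pi) :
    ∃ h₀ δ₀ C τ₀ : ℝ, 0 < h₀ ∧ h₀ < δ₀ ∧ δ₀ < 1 ∧ 1 < C ∧ 1 < τ₀ ∧ τ₀ < δ₀ * h₀⁻¹ ∧
      ∀ h : ℝ, 0 < h → h < h₀ → ∀ τ : ℝ, τ₀ < τ → τ < δ₀ * h⁻¹ →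
      ∀ u g : Γ.vertices h → ℝ,
        (∀ x : Γ.vertices h, u x ≠ 0 → (x : Fin d → ℝ) ∈
          OnePointPeriodicGraph.gBall e 2 \ OnePointPeriodicGraph.gBall e (1 / 2)) →
        (∀ x : Γ.vertices h, (x : Fin d → ℝ) ∈ OnePointPeriodicGraph.gBall e 4 →
          g x = h⁻¹ ^ 2 * Γ.laplacian h u x) →
        (∀ x : Γ.vertices h, (x : Fin d → ℝ) ∉ OnePointPeriodicGraph.gBall e 4 → g x = 0) →
        τ ^ 3 * OnePointPeriodicGraph.l2NormSq (fun x : Γ.vertices h =>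
            Real.exp (OnePointPeriodicGraph.weight e c τ x) * u x)
          + τ * OnePointPeriodicGraph.l2NormSq (fun x : Γ.vertices h =>
            Real.exp (OnePointPeriodicGraph.weight e c τ x) *
              (h⁻¹ * OnePointPeriodicGraph.Ds e h u x))
          + τ⁻¹ * OnePointPeriodicGraph.l2NormSq (fun x : Γ.vertices h =>
            Real.exp (OnePointPeriodicGraph.weight e c τ x) *
              (h⁻¹ ^ 2 * OnePointPeriodicGraph.Ds2 e h u x))
        ≤ C * OnePointPeriodicGraph.l2NormSq (fun x : Γ.vertices h =>
            Real.exp (OnePointPeriodicGraph.weight e c τ x) * g x) := by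
  have hb := isFrame_dualCoord he
  set b := dualCoord e with hbdef
  obtain ⟨G, hG, hGc, hGp⟩ := exists_profile c
  set p₀ : ℝ := 1 - c * (Real.pi / 2) with hp₀
  have hp₀0 : 0 < p₀ := by
    rw [lt_div_iff₀ Real.pi_pos] at hc'
    rw [hp₀]; linarith
  -- The two entries are the two smallness conditions of `IsFrame.pseudoconvexAt`, with curvature
  -- bound `q₀ = c / 5`.
  set ε : ℝ := min (c / 5 / 16) (p₀ ^ 2 * (c / 5) / 256) with hε
  have hε0 : 0 < ε := lt_min (by positivity) (by positivity)
  have hε1 : 16 * ε ≤ c / 5 := by linarith [min_le_left (c / 5 / 16) (p₀ ^ 2 * (c / 5) / 256)]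
  have hε2 : 256 * ε ≤ p₀ ^ 2 * (c / 5) := by
    linarith [min_le_right (c / 5 / 16) (p₀ ^ 2 * (c / 5) / 256)]
  obtain ⟨K, hK, hweight⟩ := hb.exists_isWeight hG hGc ε
  obtain ⟨δ, C, hδ0, hδ1, hC, hcarl⟩ := exists_carleman_estimate k K ε hK hε0
  -- the radius of the stencils
  set M : ℝ := 4 * ∑ j, quad b (e j : Fin d → ℝ) with hM
  have hMj : ∀ j, 4 * quad b (e j : Fin d → ℝ) ≤ M := fun j => by
    have := Finset.single_le_sum (f := fun j => quad b (e j : Fin d → ℝ))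
      (fun _ _ => quad_nonneg b _) (Finset.mem_univ j)
    rw [hM]; linarith
  have hM0 : 0 ≤ M := by
    rw [hM]; exact mul_nonneg (by norm_num) (Finset.sum_nonneg fun _ _ => quad_nonneg b _)
  -- For `h < η`, moving by up to two edges changes the squared norm by at most `1/8`. The factor
  -- `4` in `M` accounts for the double step, `quad` being homogeneous of degree two.
  set η : ℝ := 1 / (8 * (4 + 2 * M)) with hη
  have hη0 : 0 < η := by positivity
  have hη1 : η ≤ 1 := by
    rw [hη, div_le_one (by positivity)]; linarith
  have hηM : η * (4 + 2 * M) = 1 / 8 := by rw [hη]; field_simp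
  -- The bound `δ ^ 2 / 2` makes `h₀ < δ ^ 2`, so the range between `τ₀ = δ⁻¹` and `δ * h₀⁻¹` is
  -- nonempty.
  refine ⟨min η (δ ^ 2 / 2), δ, C, δ⁻¹, lt_min hη0 (by positivity), ?_, hδ1, hC,
    (one_lt_inv₀ hδ0).2 hδ1, ?_, ?_⟩
  · refine (min_le_right _ _).trans_lt ?_
    nlinarith
  · have h0 : 0 < min η (δ ^ 2 / 2) := lt_min hη0 (by positivity)
    rw [← div_eq_mul_inv, lt_div_iff₀ h0, inv_mul_lt_iff₀ hδ0]
    exact (min_le_right _ _).trans_lt (by nlinarith)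
  intro h hh hh0 τ hτ₀ hτδ u g hu hg hg'
  have hhη : h < η := hh0.trans_le (min_le_left _ _)
  have hh1 : h ≤ 1 := hhη.le.trans hη1
  have hτ : 0 < τ := (inv_pos.2 hδ0).trans hτ₀
  have hτh : τ * h < δ := by rwa [← div_eq_mul_inv, lt_div_iff₀ hh] at hτδ
  obtain ⟨v, hv⟩ : ∃ v : Fin k → Γ.vertices h, ∀ j, v j = Γ.scale h (e j) := ⟨_, fun _ => rfl⟩
  -- the points close to the support of `u` stay in a fixed annulus
  have hsupp : ∀ x : Γ.vertices h, u x ≠ 0 →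
      1 / 4 < quad b (x : Fin d → ℝ) ∧ quad b (x : Fin d → ℝ) ≤ 4 := by
    intro x hx
    obtain ⟨h2, h1⟩ := hu x hx
    simp only [OnePointPeriodicGraph.gBall, Set.mem_ofPred_eq, gNorm_eq he, not_le] at h1 h2
    constructor
    · have := (Real.lt_sqrt (by norm_num)).1 h1
      rw [← hbdef] at this
      linarith
    · have := (Real.sqrt_le_left (by norm_num)).1 h2
      rw [← hbdef] at this
      linarith
  have hhM : h * (4 + 2 * M) ≤ 1 / 8 := by
    rw [← hηM]
    exact mul_le_mul_of_nonneg_right hhη.le (by linarith)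
  obtain ⟨P, hP⟩ : ∃ P : Γ.vertices h → Prop, ∀ x, P x ↔
    1 / 16 ≤ quad b (x : Fin d → ℝ) ∧ quad b (x : Fin d → ℝ) ≤ 16 := ⟨_, fun _ => Iff.rfl⟩
  have hclose : ∀ (x y : Γ.vertices h) (w : Fin d → ℝ), u y ≠ 0 → quad b w ≤ M →
      (x : Fin d → ℝ) = y + h • w → P x := fun x y w hy hw hxy =>
    (hP x).2 (quad_bounds_of_near b hh hh1 hhM (hsupp y hy) hw hxy)
  have near0 : ∀ x, u x ≠ 0 → P x := fun x hx =>
    hclose x x 0 hx (by simpa [quad] using hM0) (by simp)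
  have near1 : ∀ x j, u (x + v j) ≠ 0 → P x := fun x j hx =>
    hclose x _ (-(e j : Fin d → ℝ)) hx
      (by rw [← neg_one_smul ℝ, quad_smul]; linarith [hMj j, quad_nonneg b (e j : Fin d → ℝ)])
      (by simp [hv, coe_scale])
  have near2 : ∀ x j, u (x - v j) ≠ 0 → P x := fun x j hx =>
    hclose x _ (e j : Fin d → ℝ) hx
      (by linarith [hMj j, quad_nonneg b (e j : Fin d → ℝ)])
      (by simp [hv, coe_scale])
  have near3 : ∀ x j, u (x + v j + v j) ≠ 0 → P x := fun x j hx =>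
    hclose x _ ((-2 : ℝ) • (e j : Fin d → ℝ)) hx
      (by rw [quad_smul]; linarith [hMj j])
      (by
        simp only [hv, AddSubgroup.coe_add, coe_scale]
        module)
  have near4 : ∀ x j, u (x - v j - v j) ≠ 0 → P x := fun x j hx =>
    hclose x _ ((2 : ℝ) • (e j : Fin d → ℝ)) hx
      (by rw [quad_smul]; linarith [hMj j])
      (by
        simp only [hv, AddSubgroup.coe_sub, coe_scale]
        module)
  have nearsym : ∀ x j, sym (v j) u x ≠ 0 → P x := by
    intro x j hx
    by_cases h1 : u (x + v j) = 0
    · exact near2 x j fun h2 => hx (by simp [sym, h1, h2])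
    · exact near1 x j h1
  have nearsym2 : ∀ x j, sym (v j) (sym (v j) u) x ≠ 0 → P x := by
    intro x j hx
    by_cases h1 : u (x + v j + v j) = 0
    · by_cases h2 : u (x - v j - v j) = 0
      · exact near0 x fun h3 => hx (by simp [sym, h1, h2, h3])
      · exact near4 x j h2
    · exact near3 x j h1
  have nearlap : ∀ x, ∑ j, lap (v j) u x ≠ 0 → P x := by
    intro x hx
    obtain ⟨j, -, hj⟩ := Finset.exists_ne_zero_of_sum_ne_zero hx
    by_cases h1 : u (x + v j) = 0
    · by_cases h2 : u (x - v j) = 0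
      · exact near0 x fun h3 => hj (by simp [lap, h1, h2, h3])
      · exact near2 x j h2
    · exact near1 x j h1
  -- the weight agrees with the cut off weight near the support
  obtain ⟨φ, hφ⟩ : ∃ φ : Γ.vertices h → ℝ, 
      φ = fun x : Γ.vertices h => G (quad b (x : Fin d → ℝ)) := ⟨_, rfl⟩
  have hwt : ∀ x : Γ.vertices h, P x →
      OnePointPeriodicGraph.weight e c τ (x : Fin d → ℝ) = τ * φ x := by
    intro x hx
    rw [hP] at hx
    rw [OnePointPeriodicGraph.weight, gNorm_eq he, ← hbdef, hφ]
    simp only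
    rw [(hGp _ (by linarith [hx.1]) (by linarith [hx.2])).1]
  have hD := hweight (fun x : Γ.vertices h => (x : Fin d → ℝ)) v h hh fun x j => by rw [hv]; rfl
  rw [← hφ] at hD
  have hpc : ∀ x, (u x ≠ 0 ∨ ∃ i, u (x + v i) ≠ 0) →
      PseudoconvexAt ε (fun j (x : Γ.vertices h) => radialGrad b G j (x : Fin d → ℝ))
        (fun i j x => radialHess (fun j => (e j : Fin d → ℝ)) b G i j (x : Fin d → ℝ))
        (fun x => radialMult (fun j => (e j : Fin d → ℝ)) b G ε (x : Fin d → ℝ)) x := by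
    intro x hx
    have hPx : P x := by
      obtain h1 | ⟨i, h1⟩ := hx
      exacts [near0 x h1, near1 x i h1]
    rw [hP] at hPx
    obtain ⟨-, h1, h2⟩ := hGp (quad b (x : Fin d → ℝ)) (by linarith [hPx.1]) (by linarith [hPx.2])
    have := hb.pseudoconvexAt (x := (x : Fin d → ℝ)) (by linarith [hPx.1]) hPx.2 hp₀0
      (by positivity : 0 < c / 5) (profile_slope_le hc _)
      (profile_curvature_ge hc hPx.1 hPx.2) h1 h2 hε1 hε2
    exact ⟨this.grad, this.zero⟩
  have hfin : u.support.Finite :=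
    (finite_vertices_of_isBounded hh.ne' (hb.isBounded_quad_le 4)).subset
      fun x hx => (hsupp x hx).2
  -- Four steps of padding suffice: second symmetric differences reach two steps, and the shifts
  -- used to sum them reach two more.
  obtain ⟨s, hs⟩ := exists_padded v 4 u hfin
  have main := hcarl v h τ φ _ _ _ s u hD hh hτ₀ hτh hpc hs
  have out : ∀ x ∉ s, u x = 0 ∧ (∀ j, u (x + v j) = 0) ∧ (∀ j, u (x - v j) = 0) ∧
      (∀ j, u (x + v j + v j) = 0) ∧ ∀ j, u (x - v j - v j) = 0 := by
    intro x hx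
    have h2 := hs.of_succ.of_succ
    refine ⟨?_, fun j => ?_, fun j => ?_, fun j => ?_, fun j => ?_⟩ <;> by_contra hne <;> apply hx
    · exact h2.of_succ.of_succ.mem hne
    · exact (h2.of_succ.shift j).mem hne
    · exact (h2.of_succ.unshift j).mem hne
    · exact ((h2.shift j).shift j).mem hne
    · exact ((h2.unshift j).unshift j).mem hne
  have outsym : ∀ x ∉ s, ∀ j, sym (v j) u x = 0 := fun x hx j => by
    simp [sym, (out x hx).2.1 j, (out x hx).2.2.1 j]
  have outsym2 : ∀ x ∉ s, ∀ j, sym (v j) (sym (v j) u) x = 0 := fun x hx j => by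
    simp [sym, (out x hx).1, (out x hx).2.2.2.1 j, (out x hx).2.2.2.2 j]
  have outlap : ∀ x ∉ s, ∑ j, lap (v j) u x = 0 := fun x hx =>
    Finset.sum_eq_zero fun j _ => by simp [lap, (out x hx).1, (out x hx).2.1 j, (out x hx).2.2.1 j]
  -- The true weight and its cut-off version may differ outside the annulus, at the origin in
  -- particular, but there the other factor vanishes.
  have hexp : ∀ x : Γ.vertices h, ∀ F : ℝ, (F ≠ 0 → P x) →
      Real.exp (OnePointPeriodicGraph.weight e c τ (x : Fin d → ℝ)) ^ 2 * F ^ 2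
        = (Real.exp (τ * φ x) * F) ^ 2 := by
    intro x F hF
    by_cases h0 : F = 0
    · simp [h0]
    · rw [hwt x (hF h0), mul_pow]
  have n0 : OnePointPeriodicGraph.l2NormSq (fun x : Γ.vertices h =>
      Real.exp (OnePointPeriodicGraph.weight e c τ x) * u x)
      = ∑ x ∈ s, (Real.exp (τ * φ x) * u x) ^ 2 := by
    rw [OnePointPeriodicGraph.l2NormSq, tsum_eq_sum (s := s) fun x hx => by simp [(out x hx).1]]
    refine Finset.sum_congr rfl fun x _ => ?_
    rw [sq_abs, mul_pow, hexp x _ (near0 x)]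
  have n1 : OnePointPeriodicGraph.l2NormSq (fun x : Γ.vertices h =>
      Real.exp (OnePointPeriodicGraph.weight e c τ x) * (h⁻¹ * OnePointPeriodicGraph.Ds e h u x))
      = h⁻¹ ^ 2 * ∑ j, ∑ x ∈ s, (Real.exp (τ * φ x) * sym (v j) u x) ^ 2 := by
    have hDs : ∀ x, OnePointPeriodicGraph.Ds e h u x ^ 2 = ∑ j, sym (v j) u x ^ 2 := fun x => by
      rw [OnePointPeriodicGraph.Ds, Real.sq_sqrt (Finset.sum_nonneg fun _ _ => sq_nonneg _)]
      exact Finset.sum_congr rfl fun j _ => by rw [hv]; exact sq_abs _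
    have hpt : ∀ x : Γ.vertices h, |Real.exp (OnePointPeriodicGraph.weight e c τ x) *
        (h⁻¹ * OnePointPeriodicGraph.Ds e h u x)| ^ 2
        = h⁻¹ ^ 2 * ∑ j, (Real.exp (τ * φ x) * sym (v j) u x) ^ 2 := fun x => by
      rw [sq_abs, mul_pow, mul_pow, hDs, mul_left_comm, Finset.mul_sum]
      congr 1
      exact Finset.sum_congr rfl fun j _ => hexp x _ (nearsym x j)
    rw [OnePointPeriodicGraph.l2NormSq, tsum_eq_sum (s := s) fun x hx => by
      rw [hpt]; simp [outsym x hx]]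
    simp only [hpt]
    rw [← Finset.mul_sum, Finset.sum_comm]
  have n2 : OnePointPeriodicGraph.l2NormSq (fun x : Γ.vertices h =>
      Real.exp (OnePointPeriodicGraph.weight e c τ x) *
        (h⁻¹ ^ 2 * OnePointPeriodicGraph.Ds2 e h u x))
      = h⁻¹ ^ 4 * ∑ j, ∑ x ∈ s, (Real.exp (τ * φ x) * sym (v j) (sym (v j) u) x) ^ 2 := by
    have hDs : ∀ x, OnePointPeriodicGraph.Ds2 e h u x ^ 2
        = ∑ j, sym (v j) (sym (v j) u) x ^ 2 := fun x => by
      rw [OnePointPeriodicGraph.Ds2, Real.sq_sqrt (Finset.sum_nonneg fun _ _ => sq_nonneg _)]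
      exact Finset.sum_congr rfl fun j _ => by rw [hv]; exact sq_abs _
    have hpt : ∀ x : Γ.vertices h, |Real.exp (OnePointPeriodicGraph.weight e c τ x) *
        (h⁻¹ ^ 2 * OnePointPeriodicGraph.Ds2 e h u x)| ^ 2
        = h⁻¹ ^ 4 * ∑ j, (Real.exp (τ * φ x) * sym (v j) (sym (v j) u) x) ^ 2 := fun x => by
      rw [sq_abs, mul_pow, mul_pow, hDs, mul_left_comm, Finset.mul_sum, ← pow_mul]
      congr 1
      exact Finset.sum_congr rfl fun j _ => hexp x _ (nearsym2 x j)
    rw [OnePointPeriodicGraph.l2NormSq, tsum_eq_sum (s := s) fun x hx => by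
      rw [hpt]; simp [outsym2 x hx]]
    simp only [hpt]
    rw [← Finset.mul_sum, Finset.sum_comm]
  have n3 : OnePointPeriodicGraph.l2NormSq (fun x : Γ.vertices h =>
      Real.exp (OnePointPeriodicGraph.weight e c τ x) * g x)
      = h⁻¹ ^ 4 * ∑ x ∈ s, (Real.exp (τ * φ x) * ∑ j, lap (v j) u x) ^ 2 := by
    -- Truncation to the ball of radius `4` loses nothing: the Laplacian of `u` vanishes where `quad
    -- b x > 16`.
    have hgl : ∀ x, g x = h⁻¹ ^ 2 * ∑ j, lap (v j) u x := by
      intro x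
      by_cases hx : (x : Fin d → ℝ) ∈ OnePointPeriodicGraph.gBall e 4
      · simp only [hg x hx, laplacian_eq he hh.ne', hv]
      · rw [hg' x hx]
        by_cases h0 : ∑ j, lap (v j) u x = 0
        · rw [h0, mul_zero]
        · refine absurd ?_ hx
          rw [OnePointPeriodicGraph.gBall, Set.mem_ofPred_eq, gNorm_eq he,
            Real.sqrt_le_left (by norm_num)]
          linarith [((hP x).1 (nearlap x h0)).2]
    have hpt : ∀ x : Γ.vertices h, |Real.exp (OnePointPeriodicGraph.weight e c τ x) * g x| ^ 2
        = h⁻¹ ^ 4 * (Real.exp (τ * φ x) * ∑ j, lap (v j) u x) ^ 2 := fun x => by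
      rw [sq_abs, hgl, mul_pow, mul_pow, mul_left_comm, hexp x _ (nearlap x), ← pow_mul]
    rw [OnePointPeriodicGraph.l2NormSq, tsum_eq_sum (s := s) fun x hx => by
      rw [hpt]; simp [outlap x hx]]
    simp only [hpt]
    rw [← Finset.mul_sum]
  rw [n0, n1, n2, n3]
  -- Multiplication by `h⁻¹ ^ 4` turns `h * (τ * h) ^ 3`, `h * (τ * h)` and `h * (τ * h)⁻¹` into `τ
  -- ^ 3`, `τ * h⁻¹ ^ 2` and `τ⁻¹ * h⁻¹ ^ 4`.
  have final := mul_le_mul_of_nonneg_left main (by positivity : 0 ≤ h⁻¹ ^ 4)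
  refine (le_of_eq ?_).trans (final.trans (le_of_eq ?_))
  · field_simp
  · ring
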